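/- **Setting.** On the upper half-plane $\mathbb H^2$ use the coordinate $w=s+it$, $|t|<\pi/2$, with $z=i e^{w}$; the hyperbolic metric is $g=(ds^2+dt^2)/\cos^2 t$, with almost-complex structure $J$ and Levi-Civita connection $\nabla$. The maps $\gamma_a(s,t)=(s+a,t)$ form the hyperbolic one-parameter group preserving the geodesic $\{t=0\}$, and $\mathbb H^2_+=\{\mathrm{Re}\,z>0\}=\{-\pi/2<t<0\}$. Anti-de Sitter space is $\mathrm{AdS}^3=\mathrm{Isom}(\mathbb H^2)=\mathrm{PSL}(2,\mathbb R)$ with the metric induced by the quadratic form $-\det$ on $2\times2$ matrices, time-oriented so that rotations of positive angle are future-directed. Its boundary is $\partial\mathbb H^2\times\partial\mathbb H^2$, $\partial\mathbb H^2=\mathbb{RP}^1$, where $\gamma_n\to(p,q)$ means that $\gamma_n(x)\to p$ and $\gamma_n^{-1}(x)\to q$ for some $x\in\mathbb H^2$. Write $\mathcal I_x$ for the rotation of angle $\pi$ around $x$; $\mathcal R_\pi=\{\mathcal I_x\}$ is a totally geodesic plane. An orientation-preserving diffeomorphism onto its image $\Phi:\Omega\to\mathbb H^2$ is a $\theta$-landslide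 if $\Phi^*g=g(b\cdot,b\cdot)$ with $b=\cos\theta\,E+\sin\theta\,Jm$ for some smooth positive self-adjoint $m$ with $d^\nabla m=0$ and $\det m=1$. Let $\theta\in(0,\pi)$, $$F(r)=-2\cos\theta\int_0^r\frac{du}{(4+u^2)\sqrt{4\sin^2\theta+u^2}},\quad C=F(+\infty),\quad G(r)=-\arccos\Big(\frac{r^{1/2}}{(r^2+4)^{1/4}}e^{F(r)-C}\Big).$$ For $\varphi:(-\pi/2,0)\to\mathbb R$ put $\Phi(s,t)=(s-\varphi(t),t)$ on $\mathbb H^2_+$, and in the frame $(\partial_s,\partial_t)$ $$b_0=\frac1{\sqrt{4+\varphi'^2}}\begin{pmatrix}2&-\varphi'\\-\varphi'&2+\varphi'^2\end{pmatrix},\qquad \rho=\arccos\frac{2\cos\theta}{\sqrt{4+\varphi'^2}},\qquad b=R_\rho b_0,$$ where $R_\rho$ is the rotation of angle $\rho$. Consider the equation $$-\tan t=\frac{2}{4+\varphi'^2}\Big(\frac1{\varphi'}-\frac{\cos\theta}{\sqrt{4\sin^2\theta+\varphi'^2}}\Big)\varphi''\quad (1)\qquad\text{and}\qquad \frac{\varphi'^{1/2}}{(\varphi'^2+4)^{1/4}}e^{F(\varphi')}=e^{C}\cos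 t\quad(2).$$ **Statement.** 1. Let $\varphi$ be smooth with $\varphi'\ne0$ everywhere. Then $\Phi$ is a $\theta$-landslide if and only if (1) holds, and if and only if $b=R_\rho b_0$ satisfies $\Phi^*g=g(b\cdot,b\cdot)$, $d^\nabla b=0$, $\det b=1$, $\operatorname{tr}b=2\cos\theta$ and $\operatorname{tr}(Jb)<0$. 2. $C$ is finite, and $G$ is strictly increasing from $[0,\infty)$ onto $[-\pi/2,0)$. Every (differentiable) solution $\varphi$ of (2) on $(-\pi/2,0)$ is smooth, satisfies $\varphi'>0$, $G(\varphi'(t))=t$ and (1), and $$\lim_{t\to-\pi/2}\varphi'=0,\quad \lim_{t\to0^-}\varphi'=+\infty,\quad \lim_{t\to0^-}t\varphi'(t)=-\sqrt{2(1-\cos\theta)},\quad \lim_{t\to0^-}\varphi=+\infty,\quad \lim_{t\to0^-}te^{\varphi(t)/2}=0.$$ There is exactly one solution with $\lim_{t\to-\pi/2}\varphi(t)=0$. Fix it from now on, and write $\Phi_\theta$ for the corresponding $\Phi$. 3. $\Phi_\theta$ is a $\theta$-landslide of $\mathbb H^2_+$ onto itself commuting with every $\gamma_a$; $b_0$ is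 positive definite and self-adjoint with $\Phi_\theta^*g=g(b_0\cdot,b_0\cdot)$, and $b=R_\rho b_0$ has the properties listed in 1. For each $x\in\mathbb H^2_+$ there is exactly one isometry $\sigma(x)=\sigma_{\Phi_\theta,R_\rho b_0}(x)$ with $\sigma(x)(\Phi_\theta(x))=x$ and $d(\sigma(x))_{\Phi_\theta(x)}\circ d(\Phi_\theta)_x=-b_x$. 4. $\sigma:\mathbb H^2_+\to\mathrm{AdS}^3$ satisfies $\sigma(\gamma_a x)=\gamma_a\sigma(x)\gamma_a^{-1}$. It is a smooth spacelike immersion and a topological embedding, and the induced metric has constant Gaussian curvature $K=-1/\cos^2(\theta/2)$. 5. For $s_0\in\mathbb R$ let $q(t)=(s_0+\frac12\varphi(t),t)$ and let $m=ie^{s_0}$ be the point $(s_0,0)$. As $t\to0^-$, $\sigma(q(t))\to\mathcal I_{m}$. As $t\to-\pi/2$, both $\sigma(q(t))(m)$ and $\sigma(q(t))^{-1}(m)$ converge to $e^{s_0}\in\partial\mathbb H^2$. 6. $S=\sigma(\mathbb H^2_+)$ and the totally geodesic half-plane $P=\{\mathcal I_x:x\in\mathbb H^2_+\}$ have the same boundary: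 in $\mathrm{AdS}^3$, $\overline S\setminus S=\overline P\setminus P$ is the geodesic $\{\mathcal I_x:\mathrm{Re}\,x=0\}$, and the boundaries at infinity of $S$ and of $P$ are both $\{(p,p):p\in[0,+\infty]\}$. 7. Let $T=\{\gamma\in\mathrm{AdS}^3:\gamma(0)=\infty,\ \gamma(\infty)\in(-\infty,0]\}$. Then $T$ contains the geodesic $\{\mathcal I_x:\mathrm{Re}\,x=0\}$ and is disjoint from $S$, and its boundary at infinity is the sawtooth $\{\infty\}\times[-\infty,0]\,\cup\,[-\infty,0]\times\{0\}$ (with $\pm\infty=\infty$ in $\mathbb{RP}^1$), so that $T$ is the lightlike triangle bounded by that geodesic and by these two null segments. The set $S\cup T$ is closed in $\mathrm{AdS}^3$; its boundary at infinity is the union of $\{(p,p):p\in[0,+\infty]\}$ and the sawtooth. It is a past-convex nowhere timelike surface: it is a connected region of the boundary of a convex subset of $\mathrm{AdS}^3$ contained in an affine chart of the projective model $\mathrm{PSL}(2,\mathbb R)\subset\mathbb{RP}^3$, none of the support planes at its points is timelike, and it lies in the past of each of them. Its spacelike part (the points all of whose support planes are spacelike) is exactly $S$, and its lightlike part (the points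 having a lightlike support plane) is exactly $T$. -/

import Mathlib

open Set Filter Topology
open scoped ContDiff UpperHalfPlane

noncomputable section

namespace AdSBarrier

/-! ### Tensor calculus on open subsets of the plane

The plane is `ℂ = ℝ²`, with coordinates `w = s + i t` and coordinate frame `(∂_s, ∂_t) = (1, i)`. -/

/-- The coordinate frame `(∂_s, ∂_t)`. -/
def frame : Fin 2 → ℂ := ![1, Complex.I]

/-- The coordinates `(s, t)` of a vector. -/
def coord (v : ℂ) : Fin 2 → ℝ := ![v.re, v.im]

/-- The partial derivative `∂_i f`. -/
def pd (i : Fin 2) (f : ℂ → ℝ) (p : ℂ) : ℝ := fderiv ℝ f p (frame i)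

/-- The Christoffel symbol `Γ^k_{ij}` of the metric with Gram matrix `G`. -/
def christoffel (G : ℂ → Matrix (Fin 2) (Fin 2) ℝ) (k i j : Fin 2) (p : ℂ) : ℝ :=
  (1 / 2) * ∑ l, (G p)⁻¹ k l *
    (pd i (fun x => G x j l) p + pd j (fun x => G x i l) p - pd l (fun x => G x i j) p)

/-- The `k`-th component of `∇_{∂_i} X`, for the Levi-Civita connection of `G`. -/
def covDeriv (G : ℂ → Matrix (Fin 2) (Fin 2) ℝ) (i : Fin 2) (X : ℂ → ℂ) (p : ℂ) (k : Fin 2) : ℝ :=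
  pd i (fun x => coord (X x) k) p + ∑ j, christoffel G k i j p * coord (X p) j

/-- The Codazzi equation `d^∇ b = 0` on `Ω`; in dimension two, and since `[∂_s, ∂_t] = 0`, it reads
`∇_{∂_s} (b ∂_t) = ∇_{∂_t} (b ∂_s)`. -/
def IsCodazzi (G : ℂ → Matrix (Fin 2) (Fin 2) ℝ) (b : ℂ → ℂ →L[ℝ] ℂ) (Ω : Set ℂ) : Prop :=
  ∀ p ∈ Ω, ∀ k, covDeriv G 0 (fun x => b x (frame 1)) p k = covDeriv G 1 (fun x => b x (frame 0)) p k

/-- The component `R^l_{kij}` of the curvature tensor, `R(∂_i, ∂_j) ∂_k = ∑ₗ R^l_{kij} ∂_l`. -/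
def riemann (G : ℂ → Matrix (Fin 2) (Fin 2) ℝ) (l k i j : Fin 2) (p : ℂ) : ℝ :=
  pd i (christoffel G l j k) p - pd j (christoffel G l i k) p +
    ∑ m, (christoffel G l i m p * christoffel G m j k p -
      christoffel G l j m p * christoffel G m i k p)

/-- The Gaussian curvature `⟨R(∂_s, ∂_t) ∂_t, ∂_s⟩ / det G`. -/
def gaussCurvature (G : ℂ → Matrix (Fin 2) (Fin 2) ℝ) (p : ℂ) : ℝ :=
  (∑ l, G p 0 l * riemann G l 1 0 1 p) / (G p).det

/-! ### The hyperbolic plane in the coordinate `w = s + i t`, where `z = i exp w` -/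

/-- The coordinate change `z = i exp w`, from the strip `|t| < π/2` to the upper half-plane. -/
def zmap (w : ℂ) : ℂ := Complex.I * Complex.exp w

lemma zmap_im (w : ℂ) : (zmap w).im = Real.exp w.re * Real.cos w.im := by
  simp [zmap, Complex.exp_re]

lemma zmap_re (w : ℂ) : (zmap w).re = -(Real.exp w.re * Real.sin w.im) := by
  simp [zmap, Complex.exp_im]

/-- The point of the upper half-plane with coordinate `w`. -/
def toH (w : ℂ) : ℍ := UpperHalfPlane.ofComplex (zmap w)

lemma coe_toH {w : ℂ} (h₁ : -(Real.pi / 2) < w.im) (h₂ : w.im < Real.pi / 2) :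
    ((toH w : ℍ) : ℂ) = zmap w := by
  have h : 0 < (zmap w).im := by
    rw [zmap_im]
    exact mul_pos (Real.exp_pos _) (Real.cos_pos_of_mem_Ioo ⟨h₁, h₂⟩)
  rw [toH, UpperHalfPlane.ofComplex_apply_of_im_pos h]

/-- The half-plane `ℍ²₊ = {Re z > 0} = {t < 0}`, in the coordinate `w`. -/
def halfStrip : Set ℂ := {w | -(Real.pi / 2) < w.im ∧ w.im < 0}

/-- The hyperbolic metric `|dw|² / cos² t`. -/
def hyp (w u v : ℂ) : ℝ := (u.re * v.re + u.im * v.im) / Real.cos w.im ^ 2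

/-- `hyp` is the pull-back by `z = i exp w` of the metric `|dz|² / (Im z)²`. -/
lemma hyp_eq_pullback (w u v : ℂ) :
    hyp w u v = inner ℝ (deriv zmap w * u) (deriv zmap w * v) / (zmap w).im ^ 2 := by
  have hd : deriv zmap w = zmap w :=
    ((Complex.hasDerivAt_exp w).const_mul Complex.I).deriv
  have he : Real.exp w.re ≠ 0 := (Real.exp_pos _).ne'
  have key : (inner ℝ (zmap w * u) (zmap w * v) : ℝ)
      = Real.exp w.re ^ 2 * (u.re * v.re + u.im * v.im) := by
    have h1 := Real.sin_sq_add_cos_sq w.im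
    rw [Complex.inner]
    simp only [Complex.mul_re, Complex.mul_im, Complex.conj_re, Complex.conj_im, map_mul,
      zmap_re, zmap_im]
    linear_combination (Real.exp w.re ^ 2 * (u.re * v.re + u.im * v.im)) * h1
  rw [hd, key, zmap_im, hyp, mul_pow, mul_div_mul_left _ _ (pow_ne_zero 2 he)]

/-- The Gram matrix of the hyperbolic metric. -/
def hypGram (p : ℂ) : Matrix (Fin 2) (Fin 2) ℝ := Matrix.of fun i j => hyp p (frame i) (frame j)

/-- The rotation of angle `ρ` of the tangent plane (the coordinate `w` is conformal). -/
def rot (ρ : ℝ) : ℂ →L[ℝ] ℂ := Complex.exp (ρ * Complex.I) • ContinuousLinearMap.id ℝ ℂ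

/-- The almost-complex structure. -/
def J : ℂ →L[ℝ] ℂ := Complex.I • ContinuousLinearMap.id ℝ ℂ

/-- `Φ` is an orientation-preserving diffeomorphism of `Ω` onto its image, inside the hyperbolic
plane. -/
structure IsOrientedDiffeo (Ω : Set ℂ) (Φ : ℂ → ℂ) : Prop where
  smooth : ContDiffOn ℝ ∞ Φ Ω
  inj : InjOn Φ Ω
  strip : ∀ w ∈ Ω, |(Φ w).im| < Real.pi / 2
  det_pos : ∀ w ∈ Ω, 0 < LinearMap.det (fderiv ℝ Φ w : ℂ →ₗ[ℝ] ℂ)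

/-- `Φ^* g = g(b ·, b ·)` on `Ω`, for the hyperbolic metric `g`. -/
def PullsBackBy (Ω : Set ℂ) (Φ : ℂ → ℂ) (b : ℂ → ℂ →L[ℝ] ℂ) : Prop :=
  ∀ w ∈ Ω, ∀ u v, hyp (Φ w) (fderiv ℝ Φ w u) (fderiv ℝ Φ w v) = hyp w (b w u) (b w v)

/-- `b` is positive definite and self-adjoint for the hyperbolic metric on `Ω`. -/
def IsPosSelfAdjoint (Ω : Set ℂ) (b : ℂ → ℂ →L[ℝ] ℂ) : Prop :=
  ∀ w ∈ Ω, (∀ u v, hyp w (b w u) v = hyp w u (b w v)) ∧ ∀ u, u ≠ 0 → 0 < hyp w (b w u) u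

/-- `Φ` is a `θ`-landslide on `Ω`. -/
def IsLandslide (θ : ℝ) (Ω : Set ℂ) (Φ : ℂ → ℂ) : Prop :=
  IsOrientedDiffeo Ω Φ ∧ ∃ m : ℂ → ℂ →L[ℝ] ℂ, ContDiffOn ℝ ∞ m Ω ∧
    PullsBackBy Ω Φ (fun w => Real.cos θ • ContinuousLinearMap.id ℝ ℂ + Real.sin θ • J.comp (m w)) ∧
    IsCodazzi hypGram m Ω ∧ (∀ w ∈ Ω, LinearMap.det (m w : ℂ →ₗ[ℝ] ℂ) = 1) ∧ IsPosSelfAdjoint Ω m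

/-- The bundle morphism `b` exhibits `Φ` as a `θ`-landslide: `Φ^* g = g(b ·, b ·)`, `d^∇ b = 0`,
`det b = 1`, `tr b = 2 cos θ` and `tr (J b) < 0`. -/
structure IsLandslideTensor (θ : ℝ) (Ω : Set ℂ) (Φ : ℂ → ℂ) (b : ℂ → ℂ →L[ℝ] ℂ) : Prop where
  smooth : ContDiffOn ℝ ∞ b Ω
  pullback : PullsBackBy Ω Φ b
  codazzi : IsCodazzi hypGram b Ω
  det_eq : ∀ w ∈ Ω, LinearMap.det (b w : ℂ →ₗ[ℝ] ℂ) = 1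
  trace_eq : ∀ w ∈ Ω, LinearMap.trace ℝ ℂ (b w : ℂ →ₗ[ℝ] ℂ) = 2 * Real.cos θ
  trace_neg : ∀ w ∈ Ω, LinearMap.trace ℝ ℂ (J.comp (b w) : ℂ →ₗ[ℝ] ℂ) < 0

/-! ### The ordinary differential equation -/

/-- `F(r) = -2 cos θ ∫₀^r du / ((4 + u²) √(4 sin² θ + u²))`. -/
def F (θ r : ℝ) : ℝ :=
  -2 * Real.cos θ * ∫ u in (0 : ℝ)..r, 1 / ((4 + u ^ 2) * √(4 * Real.sin θ ^ 2 + u ^ 2))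

/-- `C = F(+∞)`. -/
def C (θ : ℝ) : ℝ :=
  -2 * Real.cos θ * ∫ u in Ioi (0 : ℝ), 1 / ((4 + u ^ 2) * √(4 * Real.sin θ ^ 2 + u ^ 2))

/-- `G(r) = - arccos (r^{1/2} (r² + 4)^{-1/4} e^{F(r) - C})`. -/
def G (θ r : ℝ) : ℝ :=
  -Real.arccos (r ^ (1 / 2 : ℝ) / (r ^ 2 + 4) ^ (1 / 4 : ℝ) * Real.exp (F θ r - C θ))

/-- The second order equation
`-tan t = 2 / (4 + φ'²) · (1 / φ' - cos θ / √(4 sin² θ + φ'²)) · φ''` on `(-π/2, 0)`. -/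
def SolvesODE (θ : ℝ) (φ : ℝ → ℝ) : Prop :=
  ∀ t ∈ Ioo (-(Real.pi / 2)) 0,
    -Real.tan t = 2 / (4 + deriv φ t ^ 2) *
      (1 / deriv φ t - Real.cos θ / √(4 * Real.sin θ ^ 2 + deriv φ t ^ 2)) * deriv (deriv φ) t

/-- The integrated equation `φ'^{1/2} (φ'² + 4)^{-1/4} e^{F(φ')} = e^C cos t` on `(-π/2, 0)`,
with `C = F(+∞)`. -/
def SolvesIntegrated (θ : ℝ) (φ : ℝ → ℝ) : Prop :=
  ∀ t ∈ Ioo (-(Real.pi / 2)) 0, DifferentiableAt ℝ φ t ∧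
    deriv φ t ^ (1 / 2 : ℝ) / (deriv φ t ^ 2 + 4) ^ (1 / 4 : ℝ) * Real.exp (F θ (deriv φ t))
      = Real.exp (C θ) * Real.cos t

/-- The solution is normalized by `φ(-π/2) = 0`. -/
def IsProfile (θ : ℝ) (φ : ℝ → ℝ) : Prop :=
  SolvesIntegrated θ φ ∧ Tendsto φ (𝓝[>] (-(Real.pi / 2))) (𝓝 0)

/-- `Φ(s, t) = (s - φ(t), t)`. -/
def shear (φ : ℝ → ℝ) (w : ℂ) : ℂ := w - (φ w.im : ℂ)

/-- `b₀ = (4 + φ'²)^{-1/2} (2, -φ'; -φ', 2 + φ'²)` in the frame `(∂_s, ∂_t)`. -/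
def b₀ (φ : ℝ → ℝ) (w : ℂ) : ℂ →L[ℝ] ℂ :=
  (1 / √(4 + deriv φ w.im ^ 2)) •
    (((2 : ℝ) • Complex.reCLM - deriv φ w.im • Complex.imCLM).smulRight (1 : ℂ) +
      (-deriv φ w.im • Complex.reCLM + (2 + deriv φ w.im ^ 2) • Complex.imCLM).smulRight Complex.I)

/-- `ρ = arccos (2 cos θ / √(4 + φ'²))`. -/
def angle (θ : ℝ) (φ : ℝ → ℝ) (w : ℂ) : ℝ :=
  Real.arccos (2 * Real.cos θ / √(4 + deriv φ w.im ^ 2))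

/-- The bundle morphism `b = R_ρ b₀`. -/
def tensor (θ : ℝ) (φ : ℝ → ℝ) (w : ℂ) : ℂ →L[ℝ] ℂ := (rot (angle θ φ w)).comp (b₀ φ w)

/-! ### Anti-de Sitter space -/

/-- The space of real `2 × 2` matrices. -/
abbrev M2 := Matrix (Fin 2) (Fin 2) ℝ

/-- Anti-de Sitter space `AdS³ = Isom(ℍ²) = PSL(2, ℝ)`. -/
abbrev AdS := Matrix.ProjectiveSpecialLinearGroup (Fin 2) ℝ

/-- The class in `PSL(2, ℝ)` of a matrix of determinant one. -/
def cls (g : Matrix.SpecialLinearGroup (Fin 2) ℝ) : AdS := QuotientGroup.mk g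

lemma coe_smul (g : Matrix.SpecialLinearGroup (Fin 2) ℝ) (z : ℍ) :
    ((g • z : ℍ) : ℂ) =
      (((g 0 0 : ℝ) : ℂ) * z + (g 0 1 : ℝ)) / (((g 1 0 : ℝ) : ℂ) * z + (g 1 1 : ℝ)) :=
  UpperHalfPlane.coe_specialLinearGroup_apply g z

lemma center_smul (g h : Matrix.SpecialLinearGroup (Fin 2) ℝ)
    (hgh : QuotientGroup.leftRel (Subgroup.center _) g h) (z : ℍ) : g • z = h • z := by
  rw [QuotientGroup.leftRel_apply, Matrix.SpecialLinearGroup.mem_center_iff] at hgh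
  obtain ⟨r, hr, hs⟩ := hgh
  have hk : (g⁻¹ * h) • z = z := by
    generalize g⁻¹ * h = k at hs ⊢
    have h0 : r ≠ 0 := by
      rintro rfl
      simp at hr
    have hc : (r : ℂ) ≠ 0 := by exact_mod_cast h0
    have e : ∀ i j, k i j = Matrix.scalar (Fin 2) r i j := fun i j => by rw [hs]
    apply UpperHalfPlane.ext
    rw [coe_smul, e, e, e, e]
    simp [hc]
  rw [mul_smul, inv_smul_eq_iff] at hk
  exact hk.symm

/-- The action of `PSL(2, ℝ)` on the upper half-plane by Möbius transformations. -/
def act (γ : AdS) (z : ℍ) : ℍ :=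
  Quotient.liftOn γ (fun g : Matrix.SpecialLinearGroup (Fin 2) ℝ => g • z)
    fun g h hgh => center_smul g h hgh z

lemma act_cls (g : Matrix.SpecialLinearGroup (Fin 2) ℝ) (z : ℍ) : act (cls g) z = g • z := rfl

/-- The bilinear form of signature `(2, 2)` on matrices with quadratic form `-det`; on tangent
vectors to `SL(2, ℝ)`, it is the Anti-de Sitter metric. -/
def adsForm (M N : M2) : ℝ := -(1 / 2) * (M * N.adjugate).trace

lemma adsForm_self (M : M2) : adsForm M M = -M.det := by
  rw [adsForm, Matrix.mul_adjugate, Matrix.trace_smul, Matrix.trace_one]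
  simp
  ring

/-- The matrix with rows `(a, b)` and `(c, d)`. -/
def slOf (a b c d : ℝ) (h : a * d - b * c = 1) : Matrix.SpecialLinearGroup (Fin 2) ℝ :=
  ⟨!![a, b; c, d], by rw [Matrix.det_fin_two_of, h]⟩

lemma coe_slOf (a b c d : ℝ) (h : a * d - b * c = 1) :
    (slOf a b c d h : M2) = !![a, b; c, d] := rfl

/-- The class of the matrix with rows `(a, b)` and `(c, d)`. -/
def ofEntries (a b c d : ℝ) (h : a * d - b * c = 1) : AdS := cls (slOf a b c d h)

lemma coe_act_ofEntries (a b c d : ℝ) (h : a * d - b * c = 1) (z : ℍ) :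
    ((act (ofEntries a b c d h) z : ℍ) : ℂ) = ((a : ℂ) * z + b) / ((c : ℂ) * z + d) :=
  coe_smul _ z

/-- The translation `γ_a(s, t) = (s + a, t)`. -/
def translation (a : ℝ) : AdS :=
  ofEntries (Real.exp (a / 2)) 0 0 (Real.exp (-(a / 2))) (by rw [← Real.exp_add]; simp)

lemma coe_act_translation (a : ℝ) (z : ℍ) :
    ((act (translation a) z : ℍ) : ℂ) = Real.exp a * (z : ℂ) := by
  rw [translation, coe_act_ofEntries]
  have h : Complex.exp a = Complex.exp ((a : ℂ) / 2) / Complex.exp (-((a : ℂ) / 2)) := by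
    rw [← Complex.exp_sub]
    congr 1
    ring
  push_cast
  rw [h]
  ring

/-- The half-turn `𝓘_z`: the rotation of angle `π` around the point `z`. -/
def halfTurn (z : ℍ) : AdS :=
  ofEntries (z.re / z.im) (-(z.re ^ 2 + z.im ^ 2) / z.im) (1 / z.im) (-z.re / z.im) (by
    have := z.im_ne_zero
    field_simp
    ring)

/-- `𝓘_z` fixes `z`. -/
lemma act_halfTurn (z : ℍ) : act (halfTurn z) z = z := by
  have hc : (z.im : ℂ) ≠ 0 := by exact_mod_cast z.im_ne_zero
  have hz : (z : ℂ) = z.re + z.im * Complex.I := (Complex.re_add_im (z : ℂ)).symm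
  apply UpperHalfPlane.ext
  rw [halfTurn, coe_act_ofEntries, hz]
  have hd : (((1 / z.im : ℝ) : ℂ) * (z.re + z.im * Complex.I) + ((-z.re / z.im : ℝ) : ℂ))
      = Complex.I := by
    push_cast
    field_simp
    ring
  rw [hd, div_eq_iff Complex.I_ne_zero]
  push_cast
  field_simp
  linear_combination (-(z.im : ℂ) ^ 2) * Complex.I_sq

/-- `𝓘_z` is an involution. -/
lemma halfTurn_mul_self (z : ℍ) : halfTurn z * halfTurn z = 1 := by
  have h := z.im_ne_zero
  refine (QuotientGroup.eq_one_iff (slOf _ _ _ _ _ * slOf _ _ _ _ _)).2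
    (Matrix.SpecialLinearGroup.mem_center_iff.2 ⟨-1, by simp, ?_⟩)
  rw [Matrix.SpecialLinearGroup.coe_mul, coe_slOf]
  ext i j
  fin_cases i <;> fin_cases j <;>
    simp [Matrix.mul_apply, Fin.sum_univ_two] <;> field_simp <;> ring

/-- The totally geodesic half-plane of `𝓡_π = {𝓘_z}` over `ℍ²₊ = {Re z > 0}`. -/
def halfPlane : Set AdS := halfTurn '' {z : ℍ | 0 < z.re}

/-- The spacelike geodesic bounding `halfPlane`, over the geodesic `{Re z = 0}`. -/
def edge : Set AdS := halfTurn '' {z : ℍ | z.re = 0}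

/-! ### The boundary at infinity -/

/-- A point of `∂ℍ² = ℝP¹`, seen in the Riemann sphere. -/
def idealPt (p : OnePoint ℝ) : OnePoint ℂ := OnePoint.map (fun x : ℝ => (x : ℂ)) p

/-- The sequence `γₙ` converges to the point `(p, q)` of `∂AdS³ = ∂ℍ² × ∂ℍ²`: for some point `x`,
`γₙ x → p` and `γₙ⁻¹ x → q`. -/
def TendstoIdeal (γ : ℕ → AdS) (p q : OnePoint ℝ) : Prop :=
  ∃ x : ℍ,
    Tendsto (fun n => (((act (γ n) x : ℍ) : ℂ) : OnePoint ℂ)) atTop (𝓝 (idealPt p)) ∧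
    Tendsto (fun n => (((act (γ n)⁻¹ x : ℍ) : ℂ) : OnePoint ℂ)) atTop (𝓝 (idealPt q))

/-- The boundary at infinity of a subset of Anti-de Sitter space. -/
def idealBoundary (S : Set AdS) : Set (OnePoint ℝ × OnePoint ℝ) :=
  {x | ∃ γ : ℕ → AdS, (∀ n, γ n ∈ S) ∧ TendstoIdeal γ x.1 x.2}

/-- The arc `[0, ∞]` of `ℝP¹`. -/
def posArc : Set (OnePoint ℝ) := insert OnePoint.infty ((fun x : ℝ => (x : OnePoint ℝ)) '' Ici 0)

/-- The arc `[∞, 0]` of `ℝP¹`, through the negative numbers. -/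
def negArc : Set (OnePoint ℝ) := insert OnePoint.infty ((fun x : ℝ => (x : OnePoint ℝ)) '' Iic 0)

/-- The sawtooth: the union of the two null segments `{∞} × [∞, 0]` and `[∞, 0] × {0}`, with
common endpoint `(∞, 0)`. -/
def sawtooth : Set (OnePoint ℝ × OnePoint ℝ) :=
  {OnePoint.infty} ×ˢ negArc ∪ negArc ×ˢ {((0 : ℝ) : OnePoint ℝ)}

/-- The lightlike triangle bounded by `sawtooth` and by `edge`: the isometries `γ` such that
`γ(0) = ∞` and `γ(∞) ∈ (-∞, 0]`. -/
def triangle : Set AdS :=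
  {γ | ∃ g : Matrix.SpecialLinearGroup (Fin 2) ℝ, cls g = γ ∧ g 1 1 = 0 ∧ g 0 0 / g 1 0 ≤ 0}

/-! ### Surfaces -/

/-- `γ` is the isometry `σ_{Φ,b}(w)`: it sends `Φ(w)` to `w`, and `dγ_{Φ(w)} ∘ dΦ_w = -b_w`. -/
def IsSigmaAt (Φ : ℂ → ℂ) (b : ℂ → ℂ →L[ℝ] ℂ) (w : ℂ) (γ : AdS) : Prop :=
  act γ (toH (Φ w)) = toH w ∧
    ((fderiv ℝ (fun z : ℂ => ((act γ (UpperHalfPlane.ofComplex z) : ℍ) : ℂ)) (zmap (Φ w))).comp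
      (fderiv ℝ zmap (Φ w))).comp (fderiv ℝ Φ w) = -(fderiv ℝ zmap w).comp (b w)

/-- The first fundamental form of a map into `SL(2, ℝ)`, as a Gram matrix. -/
def firstForm (A : ℂ → M2) (p : ℂ) : Matrix (Fin 2) (Fin 2) ℝ :=
  Matrix.of fun i j => adsForm (Matrix.of fun k l => pd i (fun x => A x k l) p)
    (Matrix.of fun k l => pd j (fun x => A x k l) p)

/-- `σ : Ω → AdS³` is a smooth spacelike immersion whose first fundamental form has Gaussian
curvature constantly equal to `κ`. Smoothness and the metric are read in local lifts of `σ` to the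
double cover `SL(2, ℝ)`. -/
def IsSpacelikeOfCurvature (σ : ℂ → AdS) (Ω : Set ℂ) (κ : ℝ) : Prop :=
  ∀ w ∈ Ω, ∃ U : Set ℂ, IsOpen U ∧ w ∈ U ∧ U ⊆ Ω ∧ ∃ A : ℂ → M2,
    (∀ i j, ContDiffOn ℝ ∞ (fun x => A x i j) U) ∧
    (∀ x ∈ U, ∃ g : Matrix.SpecialLinearGroup (Fin 2) ℝ, (g : M2) = A x ∧ cls g = σ x) ∧
    ∀ x ∈ U, (firstForm A x).PosDef ∧ gaussCurvature (firstForm A) x = κ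

/-- In the projective model, the matrix `M` represents the point `γ`. -/
def Represents (M : M2) (γ : AdS) : Prop :=
  ∃ g : Matrix.SpecialLinearGroup (Fin 2) ℝ, cls g = γ ∧ ∃ c : ℝ, c ≠ 0 ∧ M = c • (g : M2)

/-- The affine chart `{ℓ ≠ 0}` of Anti-de Sitter space, as a region of the affine space `ℓ = 1`. -/
def chart (ℓ : M2 →ₗ[ℝ] ℝ) : Set M2 := {M | ℓ M = 1 ∧ 0 < M.det}

/-- The representatives of the points of `S` in the affine chart. -/
def inChart (ℓ : M2 →ₗ[ℝ] ℝ) (S : Set AdS) : Set M2 := {M | ℓ M = 1 ∧ ∃ γ ∈ S, Represents M γ}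

/-- The topological frontier of `K` in the affine space `ℓ = 1`. -/
def chartFrontier (ℓ : M2 →ₗ[ℝ] ℝ) (K : Set M2) : Set M2 :=
  Subtype.val '' frontier (Subtype.val ⁻¹' K : Set {M : M2 // ℓ M = 1})

/-- The totally geodesic plane orthogonal to `N` is a support plane of `K` at `M`. This plane is
spacelike if `det N > 0`, lightlike if `det N = 0`, and timelike if `det N < 0`. -/
def IsSupport (K : Set M2) (M N : M2) : Prop :=
  N ≠ 0 ∧ adsForm M N = 0 ∧ ((∀ Y ∈ K, 0 ≤ adsForm Y N) ∨ ∀ Y ∈ K, adsForm Y N ≤ 0)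

/-- The causal tangent vector `N` at `M` is future-directed: the element `N M⁻¹` of the Lie algebra,
up to a positive factor, is on the side of the generators of the positive rotations of `ℍ²`. -/
def IsFuture (M N : M2) : Prop := (N * M.adjugate) 1 0 < (N * M.adjugate) 0 1

/-- `S` is a nowhere timelike locally convex surface: a connected region of the boundary of a
convex set `K` of Anti-de Sitter space contained in an affine chart, whose support planes at the
points of `S` are all non timelike. It is past-convex: `S` lies in the past of each of those
support planes. -/
structure IsPastConvex (ℓ : M2 →ₗ[ℝ] ℝ) (K : Set M2) (S : Set AdS) : Prop where
  convex : Convex ℝ K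
  subset_chart : K ⊆ chart ℓ
  covered : ∀ γ ∈ S, ∃ M, ℓ M = 1 ∧ Represents M γ
  connected : IsConnected S
  region : ∃ O : Set M2, IsOpen O ∧ inChart ℓ S = O ∩ chart ℓ ∩ chartFrontier ℓ K
  nontimelike : ∀ M ∈ inChart ℓ S, ∀ N, IsSupport K M N → 0 ≤ N.det
  past : ∀ M ∈ inChart ℓ S, ∀ N, IsSupport K M N → IsFuture M N →
    ∀ Y ∈ inChart ℓ S, 0 ≤ adsForm Y N

/-- The spacelike part: all the support planes are spacelike. -/
def spacelikePart (ℓ : M2 →ₗ[ℝ] ℝ) (K : Set M2) (S : Set AdS) : Set AdS :=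
  {γ ∈ S | ∀ M N, ℓ M = 1 → Represents M γ → IsSupport K M N → 0 < N.det}

/-- The lightlike part: there is a lightlike support plane. -/
def lightlikePart (ℓ : M2 →ₗ[ℝ] ℝ) (K : Set M2) (S : Set AdS) : Set AdS :=
  {γ ∈ S | ∃ M N, ℓ M = 1 ∧ Represents M γ ∧ IsSupport K M N ∧ N.det = 0}

end AdSBarrier

end

open AdSBarrier

/-! Put k = sin(θ/2), n = cos(θ/2) and r = φ'. All the data are invariant under translation in s, so
each assertion reduces to explicit functions of one variable.

Landslides. By polar decomposition of dΦ, R_ρ b₀ = R_ω ∘ dΦ for an angle ω that depends on r only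
(`tensor_eq`). Every algebraic condition on this tensor then holds identically, and the Codazzi
equation becomes ω' = r tan t, which is the second order equation (`codazzi_tensor_iff`).
Conversely, the pull-back condition, the determinant and positivity leave a single candidate for m
(`eq_selfAdjointPart`), whose Codazzi equation is the same one.

The profile. F is elementary (`F_eq`), and squaring the integrated equation turns it into cos² t =
(1 + cos θ) r / (√(4 sin² θ + r²) + r cos θ) (`cosOf_sq`). This can be solved for r (`slope`), and
the slope has an explicit primitive (`profile`) in terms of the parameter η with sinh η = -cot t /
n. Existence, uniqueness and all the limits of φ are read off from these formulas.

The surface. Along the profile, e^{iω} is a perfect square (`cosTwist_slope`, `sinTwist_slope`). The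
condition on dσ prescribes the square of the Möbius denominator, so σ lifts in closed form to
`curveMat k η u` with u = s - φ/2 (`isSigmaAt_of_isLift`). Conjugation by translations shifts u. The
first fundamental form depends on t only, and its curvature is -1/n². The products of two entries,
which survive the quotient by ±1, recover w continuously.

Boundaries. At infinity, lifts divided by their norms subconverge to a rank one matrix N, and the
two ideal points are the images of N and of its adjugate (`TendstoIdeal.exists_scaledLimit`). Inside
AdS, write a lift as (a, -b; c, -d) with c > 0. The surface, the half-plane, the edge and the
triangle are all described by a condition on (a, d) alone: a curve, a diagonal ray, the origin and a
half-line (`graphSet`). Closures and connectedness are therefore questions in the plane.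

Convexity. In the cone of matrices (a, -b; c, d), b, c > 0, the function p = √(bc) is concave. The
surface is p⁻¹(a, d) = (e^{kη}, -e^{-kη}) / cosh η, and this plane curve stays on one side of its
tangent lines (`tangent_nonneg`). Each tangent line gives a concave inequality, and together with
the flat face d ≤ 0 they cut out the convex set. Its support planes on the surface are unique and
spacelike (`IsSupport.eq_normalMat`). Those on the triangle are diagonal, with entries of one sign,
and include the lightlike plane d = 0 (`IsSupport.eq_diagonal`). -/

noncomputable section

namespace AdSBarrier

/-! ### Endomorphisms of the plane given by their entries -/

/-- The endomorphism of `ℂ = ℝ²` with rows `(a, b)` and `(c, d)`. -/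
def ofMat (a b c d : ℝ) : ℂ →L[ℝ] ℂ :=
  (a • Complex.reCLM + b • Complex.imCLM).smulRight (1 : ℂ) +
    (c • Complex.reCLM + d • Complex.imCLM).smulRight Complex.I

@[simp] lemma ofMat_apply_re (a b c d : ℝ) (v : ℂ) : (ofMat a b c d v).re = a * v.re + b * v.im := by
  simp [ofMat]

@[simp] lemma ofMat_apply_im (a b c d : ℝ) (v : ℂ) : (ofMat a b c d v).im = c * v.re + d * v.im := by
  simp [ofMat]

lemma eq_ofMat (L : ℂ →L[ℝ] ℂ) :
    L = ofMat (L 1).re (L Complex.I).re (L 1).im (L Complex.I).im := by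
  ext v
  have hv : v = v.re • (1 : ℂ) + v.im • Complex.I := by
    apply Complex.ext <;> simp
  have h : L v = v.re • L 1 + v.im • L Complex.I := by
    conv_lhs => rw [hv]
    rw [map_add, map_smul, map_smul]
  apply Complex.ext
  · rw [h, ofMat_apply_re]; simp; ring
  · rw [h, ofMat_apply_im]; simp; ring

lemma toMatrix_ofMat (a b c d : ℝ) :
    LinearMap.toMatrix Complex.basisOneI Complex.basisOneI (ofMat a b c d : ℂ →ₗ[ℝ] ℂ)
      = !![a, b; c, d] := by
  ext i j
  rw [LinearMap.toMatrix_apply]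
  fin_cases i <;> fin_cases j <;> simp

lemma det_ofMat (a b c d : ℝ) :
    LinearMap.det (ofMat a b c d : ℂ →ₗ[ℝ] ℂ) = a * d - b * c := by
  rw [← LinearMap.det_toMatrix Complex.basisOneI, toMatrix_ofMat, Matrix.det_fin_two_of]

lemma trace_ofMat (a b c d : ℝ) :
    LinearMap.trace ℝ ℂ (ofMat a b c d : ℂ →ₗ[ℝ] ℂ) = a + d := by
  rw [LinearMap.trace_eq_matrix_trace ℝ Complex.basisOneI, toMatrix_ofMat,
    Matrix.trace_fin_two_of]

lemma J_comp_ofMat (a b c d : ℝ) : J.comp (ofMat a b c d) = ofMat (-c) (-d) a b := by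
  ext v
  apply Complex.ext <;> simp [J]
  ring

lemma id_add_J_comp_ofMat (x y a b c d : ℝ) :
    x • ContinuousLinearMap.id ℝ ℂ + y • J.comp (ofMat a b c d)
      = ofMat (x - y * c) (-(y * d)) (y * a) (x + y * b) := by
  rw [J_comp_ofMat]
  ext v
  apply Complex.ext <;> simp <;> ring

lemma contDiffOn_ofMat {Ω : Set ℂ} {a b c d : ℂ → ℝ} (ha : ContDiffOn ℝ ∞ a Ω)
    (hb : ContDiffOn ℝ ∞ b Ω) (hc : ContDiffOn ℝ ∞ c Ω) (hd : ContDiffOn ℝ ∞ d Ω) :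
    ContDiffOn ℝ ∞ (fun w => ofMat (a w) (b w) (c w) (d w)) Ω := by
  have h : (fun w => ofMat (a w) (b w) (c w) (d w)) = fun w =>
      a w • ofMat 1 0 0 0 + b w • ofMat 0 1 0 0 + c w • ofMat 0 0 1 0 + d w • ofMat 0 0 0 1 := by
    funext w
    ext v
    apply Complex.ext <;> simp
  rw [h]
  exact (((ha.smul contDiffOn_const).add (hb.smul contDiffOn_const)).add
    (hc.smul contDiffOn_const)).add (hd.smul contDiffOn_const)

/-! ### The strip -/

lemma isOpen_halfStrip : IsOpen halfStrip :=
  (isOpen_lt continuous_const Complex.continuous_im).inter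
    (isOpen_lt Complex.continuous_im continuous_const)

lemma mem_halfStrip {w : ℂ} : w ∈ halfStrip ↔ w.im ∈ Ioo (-(Real.pi / 2)) 0 := Iff.rfl

lemma cos_pos_of_mem {t : ℝ} (ht : t ∈ Ioo (-(Real.pi / 2)) 0) : 0 < Real.cos t :=
  Real.cos_pos_of_mem_Ioo ⟨ht.1, by linarith [ht.2, Real.pi_pos]⟩

lemma sin_neg_of_mem {t : ℝ} (ht : t ∈ Ioo (-(Real.pi / 2)) 0) : Real.sin t < 0 :=
  Real.sin_neg_of_neg_of_neg_pi_lt ht.2 (by linarith [ht.1, Real.pi_pos])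

lemma contDiffOn_comp_im {f : ℝ → ℝ} (hf : ContDiffOn ℝ ∞ f (Ioo (-(Real.pi / 2)) 0)) :
    ContDiffOn ℝ ∞ (fun w : ℂ => f w.im) halfStrip :=
  hf.comp Complex.imCLM.contDiff.contDiffOn fun _ hw => hw

/-! ### Metrics depending on `t` only -/

lemma pd_comp_im {h : ℝ → ℝ} {h' : ℝ} {p : ℂ} (hh : HasDerivAt h h' p.im) (i : Fin 2) :
    pd i (fun x => h x.im) p = h' * (frame i).im := by
  have := (hh.hasFDerivAt.comp p Complex.imCLM.hasFDerivAt).fderiv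
  rw [pd]
  change fderiv ℝ (h ∘ Complex.im) p (frame i) = _
  erw [this]
  simp [mul_comm]

lemma pd_congr {f g : ℂ → ℝ} {p : ℂ} (h : f =ᶠ[𝓝 p] g) (i : Fin 2) : pd i f p = pd i g p := by
  rw [pd, pd, h.fderiv_eq]

lemma inv_two_of (a b d : ℝ) :
    (!![a, b; b, d] : Matrix (Fin 2) (Fin 2) ℝ)⁻¹ =
      !![d / (a * d - b ^ 2), -b / (a * d - b ^ 2); -b / (a * d - b ^ 2), a / (a * d - b ^ 2)] := by
  rw [Matrix.inv_def, Matrix.det_fin_two_of, Matrix.adjugate_fin_two_of, Ring.inverse_eq_inv',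
    show a * d - b * b = a * d - b ^ 2 by ring]
  ext i j
  fin_cases i <;> fin_cases j <;> simp <;> ring

/-- The Christoffel symbols of a metric depending on `t` only. -/
lemma christoffel_of_im {G : ℂ → Matrix (Fin 2) (Fin 2) ℝ} {P Q R : ℝ → ℝ} {P' Q' R' : ℝ} {p : ℂ}
    (hG : G =ᶠ[𝓝 p] fun x => !![P x.im, Q x.im; Q x.im, R x.im])
    (hP : HasDerivAt P P' p.im) (hQ : HasDerivAt Q Q' p.im) (hR : HasDerivAt R R' p.im)
    {Δ : ℝ} (hΔ : Δ = P p.im * R p.im - Q p.im ^ 2) :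
    christoffel G 0 0 0 p = Q p.im * P' / (2 * Δ) ∧
    christoffel G 1 0 0 p = -(P p.im * P') / (2 * Δ) ∧
    christoffel G 0 0 1 p = R p.im * P' / (2 * Δ) ∧
    christoffel G 1 0 1 p = -(Q p.im * P') / (2 * Δ) ∧
    christoffel G 0 1 0 p = R p.im * P' / (2 * Δ) ∧
    christoffel G 1 1 0 p = -(Q p.im * P') / (2 * Δ) ∧
    christoffel G 0 1 1 p = (2 * R p.im * Q' - Q p.im * R') / (2 * Δ) ∧
    christoffel G 1 1 1 p = (P p.im * R' - 2 * Q p.im * Q') / (2 * Δ) := by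
  have e : ∀ i j l, pd i (fun x => G x j l) p
      = pd i (fun x => (!![P x.im, Q x.im; Q x.im, R x.im] : Matrix (Fin 2) (Fin 2) ℝ) j l) p :=
    fun i j l => pd_congr (hG.fun_comp fun M => M j l) i
  have h00 : ∀ i, pd i (fun x => G x 0 0) p = P' * (frame i).im := fun i => by
    rw [e]; exact pd_comp_im hP i
  have h01 : ∀ i, pd i (fun x => G x 0 1) p = Q' * (frame i).im := fun i => by
    rw [e]; exact pd_comp_im hQ i
  have h10 : ∀ i, pd i (fun x => G x 1 0) p = Q' * (frame i).im := fun i => by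
    rw [e]; exact pd_comp_im hQ i
  have h11 : ∀ i, pd i (fun x => G x 1 1) p = R' * (frame i).im := fun i => by
    rw [e]; exact pd_comp_im hR i
  have f0 : (frame 0).im = 0 := by simp [frame]
  have f1 : (frame 1).im = 1 := by simp [frame]
  have hGp : (G p)⁻¹ = !![R p.im / Δ, -Q p.im / Δ; -Q p.im / Δ, P p.im / Δ] := by
    rw [hG.self_of_nhds, inv_two_of, ← hΔ]
  simp only [christoffel, hGp, Fin.sum_univ_two, h00, h01, h10, h11, f0, f1]
  simp only [Matrix.of_apply, Matrix.cons_val', Matrix.cons_val_zero, Matrix.cons_val_one,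
    Matrix.cons_val_fin_one]
  refine ⟨?_, ?_, ?_, ?_, ?_, ?_, ?_, ?_⟩ <;> ring

/-- The curvature of a metric depending on `t` only, with `P = G_ss` and `Δ = det G`. -/
lemma gaussCurvature_of_im {G : ℂ → Matrix (Fin 2) (Fin 2) ℝ} {P Q R P₁ Q₁ R₁ : ℝ → ℝ} {P₂ : ℝ}
    {p : ℂ} (hG : ∀ᶠ x in 𝓝 p, G x = !![P x.im, Q x.im; Q x.im, R x.im])
    (hP : ∀ᶠ t in 𝓝 p.im, HasDerivAt P (P₁ t) t) (hQ : ∀ᶠ t in 𝓝 p.im, HasDerivAt Q (Q₁ t) t)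
    (hR : ∀ᶠ t in 𝓝 p.im, HasDerivAt R (R₁ t) t) (hP₁ : HasDerivAt P₁ P₂ p.im)
    {Δ : ℝ} (hΔ : Δ = P p.im * R p.im - Q p.im ^ 2) (hΔ0 : Δ ≠ 0) :
    gaussCurvature G p = -P₂ / (2 * Δ) + P₁ p.im *
      (P₁ p.im * R p.im + P p.im * R₁ p.im - 2 * Q p.im * Q₁ p.im) / (4 * Δ ^ 2) := by
  have him : Tendsto Complex.im (𝓝 p) (𝓝 p.im) := Complex.continuous_im.continuousAt
  have key : ∀ᶠ x in 𝓝 p, christoffel G 0 0 1 x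
        = (fun t => R t * P₁ t / (2 * (P t * R t - Q t ^ 2))) x.im ∧
      christoffel G 1 0 1 x
        = (fun t => -(Q t * P₁ t) / (2 * (P t * R t - Q t ^ 2))) x.im ∧
      christoffel G 0 1 1 x
        = (fun t => (2 * R t * Q₁ t - Q t * R₁ t) / (2 * (P t * R t - Q t ^ 2))) x.im ∧
      christoffel G 1 1 1 x
        = (fun t => (P t * R₁ t - 2 * Q t * Q₁ t) / (2 * (P t * R t - Q t ^ 2))) x.im := by
    filter_upwards [hG.eventually_nhds, him.eventually hP, him.eventually hQ, him.eventually hR]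
      with x h1 h2 h3 h4
    obtain ⟨-, -, a, b, -, -, c, d⟩ := christoffel_of_im h1 h2 h3 h4 rfl
    exact ⟨a, b, c, d⟩
  -- No second derivatives of `Q` and `R` are assumed, so Γ^l_{tt} may fail to be differentiable in
  -- t. Its s-derivative is still zero: if the function is differentiable, it is constant along the
  -- s-line; otherwise `fderiv` is zero by convention.
  have pd0 : ∀ l, pd 0 (christoffel G l 1 1) p = 0 := by
    have tr : ∀ f : ℂ → ℝ, (∃ h : ℝ → ℝ, ∀ᶠ x in 𝓝 p, f x = h x.im) → pd 0 f p = 0 := by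
      rintro f ⟨h, hf⟩
      rw [pd_congr (g := fun x => h x.im) hf, pd]
      by_cases hd : DifferentiableAt ℝ (fun x : ℂ => h x.im) p
      · have h1 : HasDerivAt (fun u : ℝ => h (p + u * frame 0).im)
            (fderiv ℝ (fun x : ℂ => h x.im) p (frame 0)) 0 := by
          have h2 : HasDerivAt (fun u : ℝ => p + u * frame 0) (frame 0) 0 := by
            simpa using ((Complex.ofRealCLM.hasDerivAt (x := (0 : ℝ))).mul_const (frame 0)).const_add p
          have h3 : HasFDerivAt (fun x : ℂ => h x.im) (fderiv ℝ (fun x : ℂ => h x.im) p)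
              ((fun u : ℝ => p + u * frame 0) 0) := by simpa using hd.hasFDerivAt
          exact h3.comp_hasDerivAt (0 : ℝ) h2
        have h4 : (fun u : ℝ => h (p + u * frame 0).im) = fun _ => h p.im := by
          funext u; simp [frame]
        rw [h4] at h1
        exact h1.unique (hasDerivAt_const _ _)
      · rw [fderiv_zero_of_not_differentiableAt hd]; simp
    exact Fin.forall_fin_two.2 ⟨tr _
      ⟨fun t => (2 * R t * Q₁ t - Q t * R₁ t) / (2 * (P t * R t - Q t ^ 2)),
        key.mono fun x hx => hx.2.2.1⟩,
      tr _
      ⟨fun t => (P t * R₁ t - 2 * Q t * Q₁ t) / (2 * (P t * R t - Q t ^ 2)),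
        key.mono fun x hx => hx.2.2.2⟩⟩
  have p1 := hP.self_of_nhds
  have q1 := hQ.self_of_nhds
  have r1 := hR.self_of_nhds
  have hD : HasDerivAt (fun t => 2 * (P t * R t - Q t ^ 2))
      (2 * (P₁ p.im * R p.im + P p.im * R₁ p.im - 2 * Q p.im * Q₁ p.im)) p.im := by
    refine (((p1.mul r1).sub (q1.pow 2)).const_mul 2).congr_deriv ?_
    push_cast; ring
  have hD0 : 2 * (P p.im * R p.im - Q p.im ^ 2) ≠ 0 := by rw [← hΔ]; positivity
  have d0 := (pd_congr (key.mono fun x hx => hx.1) 1).trans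
    (pd_comp_im ((r1.mul hP₁).div hD hD0) 1)
  have d1 := (pd_congr (key.mono fun x hx => hx.2.1) 1).trans
    (pd_comp_im ((q1.mul hP₁).neg.div hD hD0) 1)
  have f1 : (frame 1).im = 1 := by simp [frame]
  obtain ⟨c1, c2, c3, c4, c5, c6, c7, c8⟩ := christoffel_of_im hG p1 q1 r1 hΔ
  have hGp := hG.self_of_nhds
  simp only [gaussCurvature, riemann, Fin.sum_univ_two, pd0, d0, d1, c1, c2, c3, c4, c5, c6, c7, c8,
    f1, hGp, Matrix.det_fin_two_of, Matrix.of_apply, Matrix.cons_val', Matrix.cons_val_zero,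
    Matrix.cons_val_one, Matrix.cons_val_fin_one, Pi.mul_apply, Pi.neg_apply]
  rw [show P p.im * R p.im - Q p.im * Q p.im = Δ by rw [hΔ]; ring, ← hΔ]
  have hPR : P p.im * R p.im = Δ + Q p.im ^ 2 := by rw [hΔ]; ring
  field_simp
  generalize P p.im = a at *
  generalize Q p.im = b at *
  generalize R p.im = d at *
  generalize P₁ p.im = a' at *
  generalize Q₁ p.im = b' at *
  generalize R₁ p.im = d' at *
  subst hΔ
  ring

/-- The Codazzi equation for a field of endomorphisms depending on `t` only. -/
lemma codazzi_of_im {b : ℂ → ℂ →L[ℝ] ℂ} {p : ℂ} (hp : p ∈ halfStrip) {b₁₁ b₁₂ b₂₁ b₂₂ : ℝ → ℝ}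
    {d₁₁ d₂₁ : ℝ} (hb : ∀ᶠ w in 𝓝 p, b w = ofMat (b₁₁ w.im) (b₁₂ w.im) (b₂₁ w.im) (b₂₂ w.im))
    (h₁ : HasDerivAt b₁₁ d₁₁ p.im) (h₂ : HasDerivAt b₂₁ d₂₁ p.im)
    (h₃ : DifferentiableAt ℝ b₁₂ p.im) (h₄ : DifferentiableAt ℝ b₂₂ p.im) :
    (∀ k, covDeriv hypGram 0 (fun x => b x (frame 1)) p k
      = covDeriv hypGram 1 (fun x => b x (frame 0)) p k) ↔
    d₁₁ = Real.tan p.im * (b₂₂ p.im - b₁₁ p.im) ∧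
      d₂₁ = -Real.tan p.im * (b₁₂ p.im + b₂₁ p.im) := by
  have hc : Real.cos p.im ≠ 0 := (cos_pos_of_mem hp).ne'
  have hG : hypGram =ᶠ[𝓝 p] fun x => !![(fun t => 1 / Real.cos t ^ 2) x.im, (fun _ => (0 : ℝ)) x.im;
      (fun _ => (0 : ℝ)) x.im, (fun t => 1 / Real.cos t ^ 2) x.im] := by
    refine Eventually.of_forall fun x => ?_
    ext i j
    fin_cases i <;> fin_cases j <;> simp [hypGram, hyp, frame]
  have hP : HasDerivAt (fun t => 1 / Real.cos t ^ 2) (2 * Real.sin p.im / Real.cos p.im ^ 3) p.im := by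
    refine ((hasDerivAt_const p.im (1 : ℝ)).div ((Real.hasDerivAt_cos p.im).pow 2)
      (pow_ne_zero 2 hc)).congr_deriv ?_
    simp only [Pi.pow_apply]
    field_simp
    norm_num
    ring
  obtain ⟨c1, c2, c3, c4, c5, c6, c7, c8⟩ :=
    christoffel_of_im hG hP (hasDerivAt_const p.im (0 : ℝ)) hP rfl
  have e1 : -(1 / Real.cos p.im ^ 2 * (2 * Real.sin p.im / Real.cos p.im ^ 3)) /
      (2 * (1 / Real.cos p.im ^ 2 * (1 / Real.cos p.im ^ 2) - 0 ^ 2)) = -Real.tan p.im := by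
    rw [Real.tan_eq_sin_div_cos]; field_simp; simp
  have e2 : 1 / Real.cos p.im ^ 2 * (2 * Real.sin p.im / Real.cos p.im ^ 3) /
      (2 * (1 / Real.cos p.im ^ 2 * (1 / Real.cos p.im ^ 2) - 0 ^ 2)) = Real.tan p.im := by
    rw [Real.tan_eq_sin_div_cos]; field_simp; ring
  simp only [zero_mul, mul_zero, sub_zero, neg_zero, zero_div] at c1 c4 c6 c7 c8
  rw [e1] at c2
  rw [e2] at c3 c5
  have c8' : christoffel hypGram 1 1 1 p = Real.tan p.im := by rw [c8, ← e2, zero_pow two_ne_zero, sub_zero]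
  have f0i : (frame 0).im = 0 := by simp [frame]
  have f1i : (frame 1).im = 1 := by simp [frame]
  have f0r : (frame 0).re = 1 := by simp [frame]
  have f1r : (frame 1).re = 0 := by simp [frame]
  have e01 : pd 0 (fun x => coord (b x (frame 1)) 0) p = 0 := by
    rw [pd_congr (g := fun x => b₁₂ x.im) (hb.mono fun x hx => by simp [hx, coord, frame]),
      pd_comp_im h₃.hasDerivAt, f0i, mul_zero]
  have e02 : pd 0 (fun x => coord (b x (frame 1)) 1) p = 0 := by
    rw [pd_congr (g := fun x => b₂₂ x.im) (hb.mono fun x hx => by simp [hx, coord, frame]),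
      pd_comp_im h₄.hasDerivAt, f0i, mul_zero]
  have e11 : pd 1 (fun x => coord (b x (frame 0)) 0) p = d₁₁ := by
    rw [pd_congr (g := fun x => b₁₁ x.im) (hb.mono fun x hx => by simp [hx, coord, frame]),
      pd_comp_im h₁, f1i, mul_one]
  have e12 : pd 1 (fun x => coord (b x (frame 0)) 1) p = d₂₁ := by
    rw [pd_congr (g := fun x => b₂₁ x.im) (hb.mono fun x hx => by simp [hx, coord, frame]),
      pd_comp_im h₂, f1i, mul_one]
  have hbp := hb.self_of_nhds
  rw [Fin.forall_fin_two]
  simp only [covDeriv, Fin.sum_univ_two, e01, e02, e11, e12, c1, c2, c3, c4, c5, c6, c7, c8', hbp]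
  simp only [coord, Matrix.cons_val_zero, Matrix.cons_val_one, ofMat_apply_re, ofMat_apply_im,
    f0i, f1i, f0r, f1r, Matrix.cons_val_fin_one]
  refine and_congr ⟨fun h => ?_, fun h => ?_⟩ ⟨fun h => ?_, fun h => ?_⟩
  · linear_combination -h
  · linear_combination -h
  · linear_combination -h
  · linear_combination -h

/-! ### Landslides of the form `(s - φ(t), t)` -/

lemma hasFDerivAt_shear {φ : ℝ → ℝ} {w : ℂ} (h : DifferentiableAt ℝ φ w.im) :
    HasFDerivAt (shear φ) (ofMat 1 (-deriv φ w.im) 0 1) w := by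
  have h1 := (h.hasDerivAt.hasFDerivAt.comp w Complex.imCLM.hasFDerivAt)
  have h2 := (hasFDerivAt_id w).sub (Complex.ofRealCLM.hasFDerivAt.comp w h1)
  refine h2.congr_fderiv ?_
  ext v
  apply Complex.ext <;> simp
  ring

lemma fderiv_shear {φ : ℝ → ℝ} {w : ℂ} (h : DifferentiableAt ℝ φ w.im) :
    fderiv ℝ (shear φ) w = ofMat 1 (-deriv φ w.im) 0 1 := (hasFDerivAt_shear h).fderiv

@[simp] lemma shear_im (φ : ℝ → ℝ) (w : ℂ) : (shear φ w).im = w.im := by simp [shear]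

@[simp] lemma shear_re (φ : ℝ → ℝ) (w : ℂ) : (shear φ w).re = w.re - φ w.im := by simp [shear]

lemma isOrientedDiffeo_shear {φ : ℝ → ℝ} (hφ : ContDiffOn ℝ ∞ φ (Ioo (-(Real.pi / 2)) 0)) :
    IsOrientedDiffeo halfStrip (shear φ) where
  smooth := by
    have h : ContDiffOn ℝ ∞ (fun w : ℂ => (φ w.im : ℂ)) halfStrip :=
      Complex.ofRealCLM.contDiff.comp_contDiffOn (contDiffOn_comp_im hφ)
    exact contDiffOn_id.sub h
  inj := by
    intro w _ z _ h
    have him : w.im = z.im := by simpa using congrArg Complex.im h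
    have hre : w.re - φ w.im = z.re - φ z.im := by simpa using congrArg Complex.re h
    rw [him] at hre
    exact Complex.ext (by linarith) him
  strip := by
    intro w hw
    rw [shear_im, abs_lt]
    exact ⟨hw.1, by linarith [hw.2, Real.pi_pos]⟩
  det_pos := by
    intro w hw
    have hd : DifferentiableAt ℝ φ w.im :=
      (hφ.differentiableOn (by simp)).differentiableAt (isOpen_Ioo.mem_nhds hw)
    rw [fderiv_shear hd, det_ofMat]
    norm_num

/-! ### The rotation angle of the landslide tensor -/

/-- The radical `√(4 sin² θ + r²)`. -/
def rad (θ r : ℝ) : ℝ := √(4 * Real.sin θ ^ 2 + r ^ 2)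

/-- The cosine of the angle `ρ - β`, where `tan β = r / 2`. -/
def cosTwist (θ r : ℝ) : ℝ := (4 * Real.cos θ + r * rad θ r) / (4 + r ^ 2)

/-- The sine of the angle `ρ - β`, where `tan β = r / 2`. -/
def sinTwist (θ r : ℝ) : ℝ := (2 * rad θ r - 2 * r * Real.cos θ) / (4 + r ^ 2)

lemma rad_sq (θ r : ℝ) : rad θ r ^ 2 = 4 * Real.sin θ ^ 2 + r ^ 2 := Real.sq_sqrt (by positivity)

lemma rad_sq' (θ r : ℝ) : rad θ r ^ 2 = 4 - 4 * Real.cos θ ^ 2 + r ^ 2 := by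
  rw [rad_sq, Real.sin_sq]; ring

lemma sin_pos_of_angle {θ : ℝ} (hθ : θ ∈ Ioo 0 Real.pi) : 0 < Real.sin θ := Real.sin_pos_of_mem_Ioo hθ

lemma abs_lt_rad {θ : ℝ} (hθ : θ ∈ Ioo 0 Real.pi) (r : ℝ) : |r| < rad θ r := by
  rw [rad, ← Real.sqrt_sq_eq_abs]
  have := sin_pos_of_angle hθ
  exact Real.sqrt_lt_sqrt (sq_nonneg r) (by nlinarith)

lemma rad_pos {θ : ℝ} (hθ : θ ∈ Ioo 0 Real.pi) (r : ℝ) : 0 < rad θ r := (abs_nonneg r).trans_lt (abs_lt_rad hθ r)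

lemma mul_cos_lt_rad {θ : ℝ} (hθ : θ ∈ Ioo 0 Real.pi) (r : ℝ) : |r * Real.cos θ| < rad θ r := by
  refine lt_of_le_of_lt ?_ (abs_lt_rad hθ r)
  rw [abs_mul]
  exact mul_le_of_le_one_right (abs_nonneg r) (Real.abs_cos_le_one θ)

lemma hasDerivAt_rad {θ : ℝ} (hθ : θ ∈ Ioo 0 Real.pi) (r : ℝ) : HasDerivAt (rad θ) (r / rad θ r) r := by
  have hs := sin_pos_of_angle hθ
  have h1 : HasDerivAt (fun r : ℝ => 4 * Real.sin θ ^ 2 + r ^ 2) (2 * r) r := by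
    simpa using ((hasDerivAt_id r).pow 2).const_add (4 * Real.sin θ ^ 2)
  have h2 : HasDerivAt (rad θ) (2 * r / (2 * rad θ r)) r := h1.sqrt (by positivity)
  rwa [mul_div_mul_left _ _ two_ne_zero] at h2

lemma contDiff_rad {θ : ℝ} (hθ : θ ∈ Ioo 0 Real.pi) : ContDiff ℝ ∞ (rad θ) := by
  have hs := sin_pos_of_angle hθ
  exact ContDiff.sqrt (by fun_prop) fun r => by positivity

lemma contDiff_cosTwist {θ : ℝ} (hθ : θ ∈ Ioo 0 Real.pi) : ContDiff ℝ ∞ (cosTwist θ) := by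
  have := contDiff_rad hθ
  exact ContDiff.div (by fun_prop) (by fun_prop) fun r => by positivity

lemma contDiff_sinTwist {θ : ℝ} (hθ : θ ∈ Ioo 0 Real.pi) : ContDiff ℝ ∞ (sinTwist θ) := by
  have := contDiff_rad hθ
  exact ContDiff.div (by fun_prop) (by fun_prop) fun r => by positivity

lemma twist_sq (θ r : ℝ) : cosTwist θ r ^ 2 + sinTwist θ r ^ 2 = 1 := by
  have h : (4 + r ^ 2 : ℝ) ≠ 0 := by positivity
  rw [cosTwist, sinTwist, div_pow, div_pow, ← add_div, div_eq_one_iff_eq (pow_ne_zero 2 h)]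
  linear_combination (4 + r ^ 2) * rad_sq' θ r

lemma sinTwist_pos {θ : ℝ} (hθ : θ ∈ Ioo 0 Real.pi) (r : ℝ) : 0 < sinTwist θ r := by
  have := (abs_lt.1 (mul_cos_lt_rad hθ r)).2
  exact div_pos (by linarith) (by positivity)

/-- With ω = ρ - β, this and `hasDerivAt_sinTwist` say that dω/dr = -(2 / (4 + r²)) (1 - r cos θ /
√(4 sin² θ + r²)). Up to sign and a factor r, this is the coefficient of φ'' in the second order
equation. -/
lemma hasDerivAt_cosTwist {θ : ℝ} (hθ : θ ∈ Ioo 0 Real.pi) (r : ℝ) : HasDerivAt (cosTwist θ)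
    (sinTwist θ r * (2 / (4 + r ^ 2) * (1 - r * Real.cos θ / rad θ r))) r := by
  have h : (4 + r ^ 2 : ℝ) ≠ 0 := by positivity
  have hr := (rad_pos hθ r).ne'
  have h1 : HasDerivAt (fun r : ℝ => 4 + r ^ 2) (2 * r) r := by
    simpa using ((hasDerivAt_id r).pow 2).const_add 4
  refine ((((hasDerivAt_id r).mul (hasDerivAt_rad hθ r)).const_add (4 * Real.cos θ)).div h1
    h).congr_deriv ?_
  rw [sinTwist]
  simp only [id, Pi.mul_apply]
  field_simp
  linear_combination (-r ^ 2) * rad_sq' θ r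

lemma hasDerivAt_sinTwist {θ : ℝ} (hθ : θ ∈ Ioo 0 Real.pi) (r : ℝ) : HasDerivAt (sinTwist θ)
    (-cosTwist θ r * (2 / (4 + r ^ 2) * (1 - r * Real.cos θ / rad θ r))) r := by
  have h : (4 + r ^ 2 : ℝ) ≠ 0 := by positivity
  have hr := (rad_pos hθ r).ne'
  have h1 : HasDerivAt (fun r : ℝ => 4 + r ^ 2) (2 * r) r := by
    simpa using ((hasDerivAt_id r).pow 2).const_add 4
  refine ((((hasDerivAt_rad hθ r).const_mul 2).sub
    (((hasDerivAt_id r).const_mul 2).mul_const (Real.cos θ))).div h1 h).congr_deriv ?_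
  rw [cosTwist]
  simp only [id, Pi.sub_apply]
  field_simp
  linear_combination (-r) * rad_sq' θ r

/-- The trace condition on R_ω ∘ dΦ. The companion `rad_eq` computes the trace of its composition
with J, which is minus the radical, and so gives the sign condition. -/
lemma two_cos_eq (θ r : ℝ) : 2 * Real.cos θ = 2 * cosTwist θ r - r * sinTwist θ r := by
  have h : (4 + r ^ 2 : ℝ) ≠ 0 := by positivity
  rw [cosTwist, sinTwist]
  field_simp
  ring

lemma rad_eq (θ r : ℝ) : rad θ r = 2 * sinTwist θ r + r * cosTwist θ r := by
  have h : (4 + r ^ 2 : ℝ) ≠ 0 := by positivity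
  rw [cosTwist, sinTwist]
  field_simp
  ring

/-- The isometry `R_ω`, `ω = ρ - β`, composed with the differential of the shear of slope `r`. -/
def twistTensor (θ r : ℝ) : ℂ →L[ℝ] ℂ :=
  ofMat (cosTwist θ r) (-(r * cosTwist θ r + sinTwist θ r)) (sinTwist θ r)
    (cosTwist θ r - r * sinTwist θ r)

lemma b₀_eq (φ : ℝ → ℝ) (w : ℂ) : b₀ φ w =
    ofMat (2 / √(4 + deriv φ w.im ^ 2)) (-deriv φ w.im / √(4 + deriv φ w.im ^ 2))
      (-deriv φ w.im / √(4 + deriv φ w.im ^ 2))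
      ((2 + deriv φ w.im ^ 2) / √(4 + deriv φ w.im ^ 2)) := by
  ext v
  apply Complex.ext <;> simp [b₀, -Complex.ofReal_pow] <;> ring

/-- Polar decomposition: b₀ is the positive square root of dΦᵀ dΦ, so dΦ = R_β b₀ with tan β = r/2,
and R_ρ b₀ = R_{ρ-β} ∘ dΦ. The sine of ρ is non-negative because ρ is an arccosine. -/
lemma tensor_eq {θ : ℝ} (hθ : θ ∈ Ioo 0 Real.pi) (φ : ℝ → ℝ) (w : ℂ) :
    tensor θ φ w = twistTensor θ (deriv φ w.im) := by
  set r := deriv φ w.im with hr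
  have hq : 0 < √(4 + r ^ 2) := Real.sqrt_pos.2 (by positivity)
  have hq2 : √(4 + r ^ 2) ^ 2 = 4 + r ^ 2 := Real.sq_sqrt (by positivity)
  have hab : |2 * Real.cos θ / √(4 + r ^ 2)| ≤ 1 := by
    rw [abs_div, abs_of_pos hq, div_le_one hq, abs_mul, abs_two]
    have h2 : (2 : ℝ) ≤ √(4 + r ^ 2) := Real.le_sqrt_of_sq_le (by nlinarith [sq_nonneg r])
    linarith [Real.abs_cos_le_one θ]
  have hcos : Real.cos (angle θ φ w) = 2 * Real.cos θ / √(4 + r ^ 2) :=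
    Real.cos_arccos (abs_le.1 hab).1 (abs_le.1 hab).2
  have hsin : Real.sin (angle θ φ w) = rad θ r / √(4 + r ^ 2) := by
    rw [angle, Real.sin_arccos, Real.sqrt_eq_iff_mul_self_eq (by nlinarith [abs_le.1 hab])
      (div_nonneg (rad_pos hθ r).le hq.le), ← hr]
    field_simp
    rw [hq2, rad_sq']
    ring
  have h4 : (4 + r ^ 2 : ℝ) ≠ 0 := by positivity
  have key : ∀ v, rot (angle θ φ w) v = ofMat (2 * Real.cos θ / √(4 + r ^ 2))
      (-(rad θ r / √(4 + r ^ 2))) (rad θ r / √(4 + r ^ 2)) (2 * Real.cos θ / √(4 + r ^ 2)) v := by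
    intro v
    rw [← hcos, ← hsin]
    apply Complex.ext <;> simp [rot, Complex.exp_ofReal_mul_I_re, Complex.exp_ofReal_mul_I_im]
    all_goals ring
  ext v
  rw [tensor, ContinuousLinearMap.comp_apply, key, b₀_eq, ← hr, twistTensor, cosTwist, sinTwist]
  apply Complex.ext
  · simp only [ofMat_apply_re, ofMat_apply_im]
    field_simp
    rw [hq2]
    ring
  · simp only [ofMat_apply_re, ofMat_apply_im]
    field_simp
    rw [hq2]
    ring

lemma hyp_shear (φ : ℝ → ℝ) (w u v : ℂ) : hyp (shear φ w) u v = hyp w u v := by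
  rw [hyp, hyp, shear_im]

/-- The metric is conformal with a factor depending on t, which the shear preserves. The condition
is therefore the Euclidean identity bᵀ b = dΦᵀ dΦ, written for its three independent entries. -/
lemma pullsBackBy_shear_iff {φ : ℝ → ℝ} (hd : ∀ t ∈ Ioo (-(Real.pi / 2)) 0, DifferentiableAt ℝ φ t)
    {b : ℂ → ℂ →L[ℝ] ℂ} {b₁₁ b₁₂ b₂₁ b₂₂ : ℂ → ℝ}
    (hb : ∀ w ∈ halfStrip, b w = ofMat (b₁₁ w) (b₁₂ w) (b₂₁ w) (b₂₂ w)) :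
    PullsBackBy halfStrip (shear φ) b ↔ ∀ w ∈ halfStrip, b₁₁ w ^ 2 + b₂₁ w ^ 2 = 1 ∧
      b₁₁ w * b₁₂ w + b₂₁ w * b₂₂ w = -deriv φ w.im ∧
      b₁₂ w ^ 2 + b₂₂ w ^ 2 = 1 + deriv φ w.im ^ 2 := by
  refine forall₂_congr fun w hw => ?_
  have hc : Real.cos w.im ^ 2 ≠ 0 := pow_ne_zero 2 (cos_pos_of_mem hw).ne'
  rw [fderiv_shear (hd _ hw), hb w hw]
  simp only [hyp_shear]
  simp only [hyp, div_left_inj' hc, ofMat_apply_re, ofMat_apply_im]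
  constructor
  · intro h
    have h1 := h 1 1
    have h2 := h 1 Complex.I
    have h3 := h Complex.I Complex.I
    simp at h1 h2 h3
    refine ⟨?_, ?_, ?_⟩ <;> linarith
  · rintro ⟨h1, h2, h3⟩ u v
    linear_combination (-u.re * v.re) * h1 - (u.re * v.im + u.im * v.re) * h2 - u.im * v.im * h3

lemma hasDerivAt_deriv_of_contDiffOn {φ : ℝ → ℝ} (hφ : ContDiffOn ℝ ∞ φ (Ioo (-(Real.pi / 2)) 0))
    {t : ℝ} (ht : t ∈ Ioo (-(Real.pi / 2)) 0) :
    HasDerivAt (deriv φ) (deriv (deriv φ) t) t :=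
  (((contDiffOn_infty_iff_deriv_of_isOpen isOpen_Ioo).1 hφ).2.differentiableOn
    (by simp)).differentiableAt (isOpen_Ioo.mem_nhds ht) |>.hasDerivAt

lemma contDiffOn_deriv {φ : ℝ → ℝ} (hφ : ContDiffOn ℝ ∞ φ (Ioo (-(Real.pi / 2)) 0)) :
    ContDiffOn ℝ ∞ (deriv φ) (Ioo (-(Real.pi / 2)) 0) :=
  ((contDiffOn_infty_iff_deriv_of_isOpen isOpen_Ioo).1 hφ).2

/-- The second order equation, without denominators in `r = φ'`. -/
lemma solvesODE_iff {θ : ℝ} {φ : ℝ → ℝ} (h0 : ∀ t ∈ Ioo (-(Real.pi / 2)) 0, deriv φ t ≠ 0) :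
    SolvesODE θ φ ↔ ∀ t ∈ Ioo (-(Real.pi / 2)) 0,
      2 / (4 + deriv φ t ^ 2) * (1 - deriv φ t * Real.cos θ / rad θ (deriv φ t)) *
        deriv (deriv φ) t = -(deriv φ t * Real.tan t) := by
  refine forall₂_congr fun t ht => ?_
  have h := h0 t ht
  change _ = 2 / (4 + deriv φ t ^ 2) * (1 / deriv φ t - Real.cos θ / rad θ (deriv φ t)) *
    deriv (deriv φ) t ↔ _
  generalize deriv φ t = r at h ⊢
  generalize deriv (deriv φ) t = r'
  have e : 1 - r * Real.cos θ / rad θ r = r * (1 / r - Real.cos θ / rad θ r) := by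
    field_simp
  rw [e]
  constructor
  · intro h1
    linear_combination (-r) * h1
  · intro h1
    apply mul_left_cancel₀ h
    linear_combination -h1

/-- The two scalar equations are ω' = r tan t multiplied by sin ω and by cos ω respectively. Since
sin ω never vanishes, the first one alone is equivalent to the second order equation. -/
lemma codazzi_tensor_iff {θ : ℝ} (hθ : θ ∈ Ioo 0 Real.pi) {φ : ℝ → ℝ}
    (hφ : ContDiffOn ℝ ∞ φ (Ioo (-(Real.pi / 2)) 0))
    (h0 : ∀ t ∈ Ioo (-(Real.pi / 2)) 0, deriv φ t ≠ 0) :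
    IsCodazzi hypGram (tensor θ φ) halfStrip ↔ SolvesODE θ φ := by
  rw [solvesODE_iff h0]
  have key : ∀ p ∈ halfStrip, (∀ k, covDeriv hypGram 0 (fun x => tensor θ φ x (frame 1)) p k
      = covDeriv hypGram 1 (fun x => tensor θ φ x (frame 0)) p k) ↔
      2 / (4 + deriv φ p.im ^ 2) * (1 - deriv φ p.im * Real.cos θ / rad θ (deriv φ p.im)) *
        deriv (deriv φ) p.im = -(deriv φ p.im * Real.tan p.im) := by
    intro p hp
    have hd := hasDerivAt_deriv_of_contDiffOn hφ (mem_halfStrip.1 hp)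
    have h1 : HasDerivAt (fun t => cosTwist θ (deriv φ t)) (sinTwist θ (deriv φ p.im) *
        (2 / (4 + deriv φ p.im ^ 2) * (1 - deriv φ p.im * Real.cos θ / rad θ (deriv φ p.im))) *
          deriv (deriv φ) p.im) p.im := (hasDerivAt_cosTwist hθ _).comp p.im hd
    have h2 : HasDerivAt (fun t => sinTwist θ (deriv φ t)) (-cosTwist θ (deriv φ p.im) *
        (2 / (4 + deriv φ p.im ^ 2) * (1 - deriv φ p.im * Real.cos θ / rad θ (deriv φ p.im))) *
          deriv (deriv φ) p.im) p.im := (hasDerivAt_sinTwist hθ _).comp p.im hd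
    have h3 : DifferentiableAt ℝ (fun t => -(deriv φ t * cosTwist θ (deriv φ t) +
        sinTwist θ (deriv φ t))) p.im := ((hd.fun_mul h1).fun_add h2).fun_neg.differentiableAt
    have h4 : DifferentiableAt ℝ (fun t => cosTwist θ (deriv φ t) -
        deriv φ t * sinTwist θ (deriv φ t)) p.im := (h1.fun_sub (hd.fun_mul h2)).differentiableAt
    have hb : ∀ᶠ w in 𝓝 p, tensor θ φ w = ofMat (cosTwist θ (deriv φ w.im))
        (-(deriv φ w.im * cosTwist θ (deriv φ w.im) + sinTwist θ (deriv φ w.im)))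
        (sinTwist θ (deriv φ w.im))
        (cosTwist θ (deriv φ w.im) - deriv φ w.im * sinTwist θ (deriv φ w.im)) :=
      Eventually.of_forall fun w => by rw [tensor_eq hθ φ w, twistTensor]
    refine (codazzi_of_im (b₁₁ := fun t => cosTwist θ (deriv φ t))
      (b₁₂ := fun t => -(deriv φ t * cosTwist θ (deriv φ t) + sinTwist θ (deriv φ t)))
      (b₂₁ := fun t => sinTwist θ (deriv φ t))
      (b₂₂ := fun t => cosTwist θ (deriv φ t) - deriv φ t * sinTwist θ (deriv φ t))
      hp hb h1 h2 h3 h4).trans ?_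
    clear h1 h2 h3 h4
    have hs := (sinTwist_pos hθ (deriv φ p.im)).ne'
    constructor
    · rintro ⟨h, -⟩
      apply mul_left_cancel₀ hs
      linear_combination h
    · intro h
      constructor
      · linear_combination sinTwist θ (deriv φ p.im) * h
      · linear_combination -cosTwist θ (deriv φ p.im) * h
  constructor
  · intro h t ht
    have hp : (t * Complex.I : ℂ) ∈ halfStrip := by simpa [mem_halfStrip] using ht
    simpa using (key _ hp).1 (h _ hp)
  · exact fun h p hp => (key p hp).2 (h _ hp)

/-- Pull-back, determinant, trace and sign hold for every slope, by construction of the angle; only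
the Codazzi equation is a constraint on φ. -/
lemma isLandslideTensor_iff {θ : ℝ} (hθ : θ ∈ Ioo 0 Real.pi) {φ : ℝ → ℝ}
    (hφ : ContDiffOn ℝ ∞ φ (Ioo (-(Real.pi / 2)) 0))
    (h0 : ∀ t ∈ Ioo (-(Real.pi / 2)) 0, deriv φ t ≠ 0) :
    IsLandslideTensor θ halfStrip (shear φ) (tensor θ φ) ↔ SolvesODE θ φ := by
  refine ⟨fun h => (codazzi_tensor_iff hθ hφ h0).1 h.codazzi, fun h => ?_⟩
  have hr : ContDiffOn ℝ ∞ (fun w : ℂ => deriv φ w.im) halfStrip :=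
    contDiffOn_comp_im (contDiffOn_deriv hφ)
  have hC := (contDiff_cosTwist hθ).comp_contDiffOn hr
  have hS := (contDiff_sinTwist hθ).comp_contDiffOn hr
  have hd : ∀ t ∈ Ioo (-(Real.pi / 2)) 0, DifferentiableAt ℝ φ t := fun t ht =>
    (hφ.differentiableOn (by simp)).differentiableAt (isOpen_Ioo.mem_nhds ht)
  refine ⟨?_, ?_, (codazzi_tensor_iff hθ hφ h0).2 h, ?_, ?_, ?_⟩
  · rw [funext (tensor_eq hθ φ)]
    exact contDiffOn_ofMat hC ((hr.mul hC).add hS).neg hS (hC.sub (hr.mul hS))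
  · rw [pullsBackBy_shear_iff hd fun w _ => tensor_eq hθ φ w]
    intro w _
    have := twist_sq θ (deriv φ w.im)
    refine ⟨this, ?_, ?_⟩
    · linear_combination (-deriv φ w.im) * this
    · linear_combination (1 + deriv φ w.im ^ 2) * this
  · intro w _
    rw [tensor_eq hθ, twistTensor, det_ofMat]
    linear_combination twist_sq θ (deriv φ w.im)
  · intro w _
    rw [tensor_eq hθ, twistTensor, trace_ofMat]
    linear_combination -two_cos_eq θ (deriv φ w.im)
  · intro w _
    rw [tensor_eq hθ, twistTensor, J_comp_ofMat, trace_ofMat]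
    have := rad_pos hθ (deriv φ w.im)
    rw [rad_eq] at this
    linarith

/-! ### The self-adjoint tensor of a landslide -/

/-- The self-adjoint morphism `m` such that `b = cos θ E + sin θ J m`. -/
def selfAdjointPart (θ r : ℝ) : ℂ →L[ℝ] ℂ :=
  ofMat (sinTwist θ r / Real.sin θ) ((Real.cos θ - cosTwist θ r) / Real.sin θ)
    ((Real.cos θ - cosTwist θ r) / Real.sin θ)
    ((r * cosTwist θ r + sinTwist θ r) / Real.sin θ)

lemma codazzi_selfAdjointPart_iff {θ : ℝ} (hθ : θ ∈ Ioo 0 Real.pi) {φ : ℝ → ℝ}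
    (hφ : ContDiffOn ℝ ∞ φ (Ioo (-(Real.pi / 2)) 0))
    (h0 : ∀ t ∈ Ioo (-(Real.pi / 2)) 0, deriv φ t ≠ 0) {m : ℂ → ℂ →L[ℝ] ℂ}
    (hm : ∀ w ∈ halfStrip, m w = selfAdjointPart θ (deriv φ w.im)) :
    IsCodazzi hypGram m halfStrip ↔ SolvesODE θ φ := by
  rw [solvesODE_iff h0]
  have hsin := (sin_pos_of_angle hθ).ne'
  have key : ∀ p ∈ halfStrip, (∀ k, covDeriv hypGram 0 (fun x => m x (frame 1)) p k
      = covDeriv hypGram 1 (fun x => m x (frame 0)) p k) ↔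
      2 / (4 + deriv φ p.im ^ 2) * (1 - deriv φ p.im * Real.cos θ / rad θ (deriv φ p.im)) *
        deriv (deriv φ) p.im = -(deriv φ p.im * Real.tan p.im) := by
    intro p hp
    have hd := hasDerivAt_deriv_of_contDiffOn hφ (mem_halfStrip.1 hp)
    have h1 : HasDerivAt (fun t => cosTwist θ (deriv φ t)) (sinTwist θ (deriv φ p.im) *
        (2 / (4 + deriv φ p.im ^ 2) * (1 - deriv φ p.im * Real.cos θ / rad θ (deriv φ p.im))) *
          deriv (deriv φ) p.im) p.im := (hasDerivAt_cosTwist hθ _).comp p.im hd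
    have h2 : HasDerivAt (fun t => sinTwist θ (deriv φ t)) (-cosTwist θ (deriv φ p.im) *
        (2 / (4 + deriv φ p.im ^ 2) * (1 - deriv φ p.im * Real.cos θ / rad θ (deriv φ p.im))) *
          deriv (deriv φ) p.im) p.im := (hasDerivAt_sinTwist hθ _).comp p.im hd
    have h3 := (h1.const_sub (Real.cos θ)).div_const (Real.sin θ)
    have h4 : DifferentiableAt ℝ (fun t => (deriv φ t * cosTwist θ (deriv φ t) +
        sinTwist θ (deriv φ t)) / Real.sin θ) p.im :=
      (((hd.fun_mul h1).fun_add h2).div_const _).differentiableAt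
    have hb : ∀ᶠ w in 𝓝 p, m w = ofMat (sinTwist θ (deriv φ w.im) / Real.sin θ)
        ((Real.cos θ - cosTwist θ (deriv φ w.im)) / Real.sin θ)
        ((Real.cos θ - cosTwist θ (deriv φ w.im)) / Real.sin θ)
        ((deriv φ w.im * cosTwist θ (deriv φ w.im) + sinTwist θ (deriv φ w.im)) /
          Real.sin θ) := by
      filter_upwards [isOpen_halfStrip.mem_nhds hp] with w hw
      rw [hm w hw, selfAdjointPart]
    refine (codazzi_of_im (b₁₁ := fun t => sinTwist θ (deriv φ t) / Real.sin θ)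
      (b₁₂ := fun t => (Real.cos θ - cosTwist θ (deriv φ t)) / Real.sin θ)
      (b₂₁ := fun t => (Real.cos θ - cosTwist θ (deriv φ t)) / Real.sin θ)
      (b₂₂ := fun t => (deriv φ t * cosTwist θ (deriv φ t) + sinTwist θ (deriv φ t)) / Real.sin θ)
      hp hb (h2.div_const (Real.sin θ)) h3 h3.differentiableAt h4).trans ?_
    clear h1 h2 h3 h4
    have hs := (sinTwist_pos hθ (deriv φ p.im)).ne'
    have h2c := two_cos_eq θ (deriv φ p.im)
    constructor
    -- Here the second equation carries the factor sin ω and the first one cos ω, which may vanish;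
    -- the trace identity replaces 2 (cos θ - cos ω) by -r sin ω.
    · rintro ⟨-, h⟩
      apply mul_left_cancel₀ hs
      generalize 2 / (4 + deriv φ p.im ^ 2) *
        (1 - deriv φ p.im * Real.cos θ / rad θ (deriv φ p.im)) = x at h ⊢
      generalize deriv (deriv φ) p.im = y at h ⊢
      field_simp at h
      linear_combination (-1) * h + Real.tan p.im * h2c
    · intro h
      constructor
      · field_simp at h ⊢
        linear_combination -cosTwist θ (deriv φ p.im) * h
      · linear_combination -sinTwist θ (deriv φ p.im) / Real.sin θ * h +
          Real.tan p.im / Real.sin θ * h2c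
  constructor
  · intro h t ht
    have hp : (t * Complex.I : ℂ) ∈ halfStrip := by simpa [mem_halfStrip] using ht
    simpa using (key _ hp).1 (h _ hp)
  · exact fun h p hp => (key p hp).2 (h _ hp)

/-- Adding the diagonal conditions gives the square of sin θ · tr m, and positivity of p and l
selects the root `rad θ r`. Once the trace is known, the remaining conditions are linear in p - l
and k, with determinant -(rad² + 4 cos² θ) = -(4 + r²) ≠ 0. -/
lemma eq_selfAdjointPart {θ r p k l : ℝ} (hθ : θ ∈ Ioo 0 Real.pi)
    (h1 : (Real.cos θ - Real.sin θ * k) ^ 2 + (Real.sin θ * p) ^ 2 = 1)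
    (h2 : (Real.cos θ - Real.sin θ * k) * -(Real.sin θ * l)
      + Real.sin θ * p * (Real.cos θ + Real.sin θ * k) = -r)
    (h3 : (-(Real.sin θ * l)) ^ 2 + (Real.cos θ + Real.sin θ * k) ^ 2 = 1 + r ^ 2)
    (hdet : p * l - k * k = 1) (hp : 0 < p) (hl : 0 < l) :
    ofMat p k k l = selfAdjointPart θ r := by
  have hs := sin_pos_of_angle hθ
  have hsq := Real.sin_sq_add_cos_sq θ
  have h4 : (4 + r ^ 2 : ℝ) ≠ 0 := by positivity
  have hsum : Real.sin θ * p + Real.sin θ * l = rad θ r := by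
    rw [← sq_eq_sq₀ (by positivity) (rad_pos hθ r).le, rad_sq]
    linear_combination h1 + h3 + 2 * Real.sin θ ^ 2 * hdet - 2 * hsq
  have e1 : Real.cos θ * (Real.sin θ * p - Real.sin θ * l) + rad θ r * (Real.sin θ * k) = -r := by
    rw [← hsum]; linear_combination h2
  have e2 : rad θ r * (Real.sin θ * p - Real.sin θ * l) - 4 * Real.cos θ * (Real.sin θ * k)
      = -r ^ 2 := by
    rw [← hsum]; linear_combination h1 - h3
  have hr := rad_sq' θ r
  have hk : Real.sin θ * k = Real.cos θ - cosTwist θ r := by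
    apply mul_left_cancel₀ h4
    rw [cosTwist]
    field_simp
    linear_combination rad θ r * e1 - Real.cos θ * e2 - Real.sin θ * k * hr
  have hdiff : Real.sin θ * p - Real.sin θ * l = -(r * cosTwist θ r) := by
    apply mul_left_cancel₀ h4
    rw [cosTwist]
    field_simp
    linear_combination 4 * Real.cos θ * e1 + rad θ r * e2 -
      (Real.sin θ * p - Real.sin θ * l) * hr
  have hre := rad_eq θ r
  have hp' : p = sinTwist θ r / Real.sin θ := by
    rw [eq_div_iff hs.ne']; linear_combination (hsum + hdiff + hre) / 2
  have hl' : l = (r * cosTwist θ r + sinTwist θ r) / Real.sin θ := by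
    rw [eq_div_iff hs.ne']; linear_combination (hsum - hdiff + hre) / 2
  have hk' : k = (Real.cos θ - cosTwist θ r) / Real.sin θ := by
    rw [eq_div_iff hs.ne']; linear_combination hk
  rw [selfAdjointPart, ← hp', ← hl', ← hk']

lemma isPosSelfAdjoint_iff {b : ℂ → ℂ →L[ℝ] ℂ} {b₁₁ b₁₂ b₂₁ b₂₂ : ℂ → ℝ}
    (hb : ∀ w ∈ halfStrip, b w = ofMat (b₁₁ w) (b₁₂ w) (b₂₁ w) (b₂₂ w)) :
    IsPosSelfAdjoint halfStrip b ↔ ∀ w ∈ halfStrip, b₁₂ w = b₂₁ w ∧ 0 < b₁₁ w ∧ 0 < b₂₂ w ∧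
      0 < b₁₁ w * b₂₂ w - b₁₂ w * b₂₁ w := by
  refine forall₂_congr fun w hw => ?_
  have hc : 0 < Real.cos w.im ^ 2 := pow_pos (cos_pos_of_mem hw) 2
  rw [hb w hw]
  simp only [hyp, div_left_inj' hc.ne', ofMat_apply_re, ofMat_apply_im, div_pos_iff_of_pos_right hc]
  generalize b₁₁ w = a
  generalize b₁₂ w = b
  generalize b₂₁ w = c
  generalize b₂₂ w = d
  constructor
  · rintro ⟨h1, h2⟩
    have h3 := h1 1 Complex.I
    have h4 := h2 1 one_ne_zero
    have h5 := h2 Complex.I Complex.I_ne_zero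
    -- The quadratic form of the symmetric matrix (a, b; b, d) takes the value a (ad - b²) at (b,
    -- -a), which yields the sign of the determinant.
    have h6 := h2 (b - a * Complex.I) fun h => by
      have := congrArg Complex.im h
      simp at this h4
      linarith
    simp at h3 h4 h5 h6
    subst h3
    refine ⟨rfl, h4, h5, ?_⟩
    have : 0 < a * (a * d - c * c) := by linarith
    exact pos_of_mul_pos_right this h4.le
  · rintro ⟨rfl, h1, h2, h3⟩
    refine ⟨fun u v => by ring, fun u hu => ?_⟩
    have hne : u.re ≠ 0 ∨ u.im ≠ 0 := by
      by_contra! h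
      exact hu (Complex.ext h.1 h.2)
    have : 0 < a * ((a * u.re + b * u.im) * u.re + (b * u.re + d * u.im) * u.im) := by
      have e : a * ((a * u.re + b * u.im) * u.re + (b * u.re + d * u.im) * u.im)
        = (a * u.re + b * u.im) ^ 2 + (a * d - b * b) * u.im ^ 2 := by ring
      rw [e]
      by_cases hi : u.im = 0
      · have hre : u.re ≠ 0 := by simpa [hi] using hne
        rw [hi]
        have : 0 < (a * u.re) ^ 2 := by positivity
        simpa using this
      · have : 0 < (a * d - b * b) * u.im ^ 2 := by positivity
        positivity
    exact pos_of_mul_pos_right this h1.le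

/-- A landslide tensor m is forced to be `selfAdjointPart` at each point, so its Codazzi equation is
the differential equation. Conversely cos θ E + sin θ J m is the tensor R_ρ b₀, whose pull-back
property is already known. -/
lemma isLandslide_iff {θ : ℝ} (hθ : θ ∈ Ioo 0 Real.pi) {φ : ℝ → ℝ}
    (hφ : ContDiffOn ℝ ∞ φ (Ioo (-(Real.pi / 2)) 0))
    (h0 : ∀ t ∈ Ioo (-(Real.pi / 2)) 0, deriv φ t ≠ 0) :
    IsLandslide θ halfStrip (shear φ) ↔ SolvesODE θ φ := by
  have hd : ∀ t ∈ Ioo (-(Real.pi / 2)) 0, DifferentiableAt ℝ φ t := fun t ht =>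
    (hφ.differentiableOn (by simp)).differentiableAt (isOpen_Ioo.mem_nhds ht)
  constructor
  · rintro ⟨-, m, -, hpull, hcod, hdet, hpos⟩
    have hm := fun w (_ : w ∈ halfStrip) => eq_ofMat (m w)
    rw [isPosSelfAdjoint_iff hm] at hpos
    refine (codazzi_selfAdjointPart_iff hθ hφ h0 fun w hw => ?_).1 hcod
    have hpw := (pullsBackBy_shear_iff hd fun w hw => by
      conv_lhs => rw [hm w hw, id_add_J_comp_ofMat]).1 hpull w hw
    have hdw := hdet w hw
    rw [hm w hw, det_ofMat] at hdw
    obtain ⟨hsym, hp, hl, -⟩ := hpos w hw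
    rw [hm w hw, ← hsym]
    rw [← hsym] at hpw hdw
    exact eq_selfAdjointPart hθ hpw.1 hpw.2.1 hpw.2.2 hdw hp hl
  · intro h
    have hr : ContDiffOn ℝ ∞ (fun w : ℂ => deriv φ w.im) halfStrip :=
      contDiffOn_comp_im (contDiffOn_deriv hφ)
    have hC := (contDiff_cosTwist hθ).comp_contDiffOn hr
    have hS := (contDiff_sinTwist hθ).comp_contDiffOn hr
    have hs := sin_pos_of_angle hθ
    have hO := (contDiffOn_const (c := Real.cos θ)).sub hC
    have hdet : ∀ r, sinTwist θ r / Real.sin θ * ((r * cosTwist θ r + sinTwist θ r) / Real.sin θ) -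
        (Real.cos θ - cosTwist θ r) / Real.sin θ * ((Real.cos θ - cosTwist θ r) / Real.sin θ)
        = 1 := by
      intro r
      field_simp
      linear_combination twist_sq θ r - Real.sin_sq_add_cos_sq θ + cosTwist θ r * two_cos_eq θ r
    refine ⟨isOrientedDiffeo_shear hφ, fun w => selfAdjointPart θ (deriv φ w.im),
      contDiffOn_ofMat (hS.div_const _) (hO.div_const _) (hO.div_const _)
        (((hr.mul hC).add hS).div_const _), ?_,
      (codazzi_selfAdjointPart_iff hθ hφ h0 fun w _ => rfl).2 h, fun w _ => ?_, ?_⟩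
    · have := ((isLandslideTensor_iff hθ hφ h0).2 h).pullback
      convert this using 2 with w
      simp only [selfAdjointPart]
      rw [tensor_eq hθ, id_add_J_comp_ofMat, twistTensor]
      congr 1
      · field_simp; ring
      · field_simp
      · field_simp
      · field_simp
        linear_combination two_cos_eq θ (deriv φ w.im)
    · simp only [selfAdjointPart]
      rw [det_ofMat, hdet]
    · simp only [selfAdjointPart]
      rw [isPosSelfAdjoint_iff fun w _ => rfl]
      intro w _
      have h1 := sinTwist_pos hθ (deriv φ w.im)
      have h2 : 0 < sinTwist θ (deriv φ w.im) / Real.sin θ := by positivity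
      have h3 := hdet (deriv φ w.im)
      refine ⟨rfl, h2, ?_, by rw [h3]; exact one_pos⟩
      refine pos_of_mul_pos_right (a := sinTwist θ (deriv φ w.im) / Real.sin θ) ?_ h2.le
      nlinarith [mul_self_nonneg ((Real.cos θ - cosTwist θ (deriv φ w.im)) / Real.sin θ)]

/-! ### The first integral -/

lemma rad_nonneg (θ r : ℝ) : 0 ≤ rad θ r := Real.sqrt_nonneg _

lemma rad_add_pos {θ : ℝ} (hθ : θ ∈ Ioo 0 Real.pi) (r : ℝ) : 0 < rad θ r + r * Real.cos θ := by
  linarith [(abs_lt.1 (mul_cos_lt_rad hθ r)).1]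

lemma rad_sub_pos {θ : ℝ} (hθ : θ ∈ Ioo 0 Real.pi) (r : ℝ) : 0 < rad θ r - r * Real.cos θ := by
  linarith [(abs_lt.1 (mul_cos_lt_rad hθ r)).2]

lemma one_add_cos_pos {θ : ℝ} (hθ : θ ∈ Ioo 0 Real.pi) : 0 < 1 + Real.cos θ := by
  have h1 := sin_pos_of_angle hθ
  have h2 := Real.sin_sq_add_cos_sq θ
  by_contra! h
  have h3 : Real.cos θ = -1 := le_antisymm (by linarith) (Real.neg_one_le_cos θ)
  rw [h3] at h2
  nlinarith

lemma one_sub_cos_pos {θ : ℝ} (hθ : θ ∈ Ioo 0 Real.pi) : 0 < 1 - Real.cos θ := by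
  have h1 := sin_pos_of_angle hθ
  have h2 := Real.sin_sq_add_cos_sq θ
  by_contra! h
  have h3 : Real.cos θ = 1 := le_antisymm (Real.cos_le_one θ) (by linarith)
  rw [h3] at h2
  nlinarith

lemma rad_add_mul_rad_sub (θ r : ℝ) : (rad θ r + r * Real.cos θ) * (rad θ r - r * Real.cos θ)
    = (1 + Real.cos θ) * (1 - Real.cos θ) * (4 + r ^ 2) := by
  linear_combination rad_sq' θ r

lemma integrand_eq (θ u : ℝ) : 1 / ((4 + u ^ 2) * √(4 * Real.sin θ ^ 2 + u ^ 2))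
    = 1 / ((4 + u ^ 2) * rad θ u) := rfl

/-- The derivative of log(rad + u cos θ) - log(rad - u cos θ) is 8 cos θ / ((4 + u²) rad), because
the product of the two arguments is sin² θ (4 + u²). -/
lemma F_eq {θ : ℝ} (hθ : θ ∈ Ioo 0 Real.pi) (r : ℝ) : F θ r =
    -(1 / 4) * (Real.log (rad θ r + r * Real.cos θ) - Real.log (rad θ r - r * Real.cos θ)) := by
  have hd : ∀ u, HasDerivAt (fun r => -(1 / 4) * (Real.log (rad θ r + r * Real.cos θ)
      - Real.log (rad θ r - r * Real.cos θ)))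
      (-2 * Real.cos θ * (1 / ((4 + u ^ 2) * rad θ u))) u := by
    intro u
    have h1 := hasDerivAt_rad hθ u
    have h2 : HasDerivAt (fun u : ℝ => u * Real.cos θ) (Real.cos θ) u := by
      simpa using (hasDerivAt_id u).mul_const (Real.cos θ)
    have hp := rad_add_pos hθ u
    have hm := rad_sub_pos hθ u
    refine ((((h1.fun_add h2).log hp.ne').fun_sub ((h1.fun_sub h2).log hm.ne')).const_mul
      (-(1 / 4))).congr_deriv ?_
    have hr := rad_pos hθ u
    have h4 : (0 : ℝ) < 4 + u ^ 2 := by positivity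
    have hc1 := one_add_cos_pos hθ
    have hc2 := one_sub_cos_pos hθ
    have e : (u / rad θ u + Real.cos θ) / (rad θ u + u * Real.cos θ) -
        (u / rad θ u - Real.cos θ) / (rad θ u - u * Real.cos θ)
        = 8 * Real.cos θ * (1 / ((4 + u ^ 2) * rad θ u)) := by
      rw [div_sub_div _ _ hp.ne' hm.ne', rad_add_mul_rad_sub]
      field_simp
      linear_combination (2 * Real.cos θ) * rad_sq' θ u
    rw [e]
    ring
  have hcont : Continuous fun u => -2 * Real.cos θ * (1 / ((4 + u ^ 2) * rad θ u)) := by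
    have := (contDiff_rad hθ).continuous
    refine continuous_const.mul (continuous_const.div (by fun_prop) fun u => ?_)
    have := rad_pos hθ u
    positivity
  rw [F, ← intervalIntegral.integral_const_mul]
  simp only [integrand_eq]
  rw [intervalIntegral.integral_eq_sub_of_hasDerivAt (fun u _ => hd u)
    (hcont.intervalIntegrable _ _)]
  simp

lemma tendsto_F_integral {θ : ℝ} (hθ : θ ∈ Ioo 0 Real.pi) : Tendsto (F θ) atTop (𝓝 (C θ)) := by
  refine Tendsto.const_mul _ (MeasureTheory.intervalIntegral_tendsto_integral_Ioi 0 ?_ tendsto_id)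
  have hs := sin_pos_of_angle hθ
  refine (MeasureTheory.Integrable.mono' (g := fun u : ℝ => 1 / (2 * Real.sin θ) * (1 + u ^ 2)⁻¹)
    (integrable_inv_one_add_sq.const_mul _) ?_ (Eventually.of_forall fun u => ?_)).integrableOn
  · have : Continuous fun u : ℝ => 1 / ((4 + u ^ 2) * √(4 * Real.sin θ ^ 2 + u ^ 2)) := by
      refine continuous_const.div (by fun_prop) fun u => ?_
      positivity
    exact this.aestronglyMeasurable
  · rw [Real.norm_of_nonneg (by positivity), ← one_div, one_div_mul_one_div]
    have h1 : 2 * Real.sin θ ≤ √(4 * Real.sin θ ^ 2 + u ^ 2) :=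
      Real.le_sqrt_of_sq_le (by nlinarith [sq_nonneg u])
    refine one_div_le_one_div_of_le (by positivity) ?_
    nlinarith [mul_le_mul (show 1 + u ^ 2 ≤ 4 + u ^ 2 by linarith) h1 (by positivity)
      (by positivity)]

lemma C_eq {θ : ℝ} (hθ : θ ∈ Ioo 0 Real.pi) :
    C θ = -(1 / 4) * (Real.log (1 + Real.cos θ) - Real.log (1 - Real.cos θ)) := by
  refine tendsto_nhds_unique (tendsto_F_integral hθ) ?_
  have h1 : Tendsto (fun r => √(4 * Real.sin θ ^ 2 * (r⁻¹) ^ 2 + 1)) atTop (𝓝 1) := by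
    have h : Tendsto (fun r : ℝ => 4 * Real.sin θ ^ 2 * (r⁻¹) ^ 2 + 1) atTop (𝓝 1) := by
      have h := (((tendsto_inv_atTop_zero (𝕜 := ℝ)).pow 2).const_mul
        (4 * Real.sin θ ^ 2)).add_const 1
      rwa [zero_pow two_ne_zero, mul_zero, zero_add] at h
    simpa using h.sqrt
  have h2 := ((h1.add_const (Real.cos θ)).log (one_add_cos_pos hθ).ne').sub
    ((h1.sub_const (Real.cos θ)).log (one_sub_cos_pos hθ).ne')
  refine (h2.const_mul (-(1 / 4))).congr' ?_
  filter_upwards [eventually_gt_atTop 0] with r hr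
  -- Factoring r out of both logarithms makes log r cancel and leaves functions with finite limits
  -- at infinity.
  have e : rad θ r = r * √(4 * Real.sin θ ^ 2 * (r⁻¹) ^ 2 + 1) := by
    rw [rad, ← Real.sqrt_sq hr.le, ← Real.sqrt_mul (sq_nonneg r), Real.sqrt_sq hr.le]
    congr 1
    field_simp
  have hp := rad_add_pos hθ r
  have hm := rad_sub_pos hθ r
  rw [F_eq hθ]
  rw [e] at hp hm ⊢
  generalize √(4 * Real.sin θ ^ 2 * (r⁻¹) ^ 2 + 1) = x at *
  rw [← mul_add] at hp ⊢
  rw [← mul_sub] at hm ⊢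
  rw [Real.log_mul hr.ne' (pos_of_mul_pos_right hp hr.le).ne',
    Real.log_mul hr.ne' (pos_of_mul_pos_right hm hr.le).ne']
  ring

/-- The identity (rad + r cos θ)(rad - r cos θ) = sin² θ (4 + r²) eliminates the factor rad - r cos
θ and produces the root √(r² + 4), which is exactly what cancels the power (r² + 4)^{1/4} of the
integrated equation after squaring. -/
lemma exp_F_sub_C {θ : ℝ} (hθ : θ ∈ Ioo 0 Real.pi) (r : ℝ) : Real.exp (F θ r - C θ) ^ 2
    = (1 + Real.cos θ) * √(r ^ 2 + 4) / (rad θ r + r * Real.cos θ) := by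
  have hp := rad_add_pos hθ r
  have hm := rad_sub_pos hθ r
  have h1 := one_add_cos_pos hθ
  have h2 := one_sub_cos_pos hθ
  have h4 : (0 : ℝ) < r ^ 2 + 4 := by positivity
  rw [← Real.exp_log (show 0 < (1 + Real.cos θ) * √(r ^ 2 + 4) / (rad θ r + r * Real.cos θ) by
    positivity), ← Real.exp_nat_mul]
  congr 1
  rw [Real.log_div (by positivity) hp.ne', Real.log_mul h1.ne' (by positivity),
    Real.log_sqrt h4.le, F_eq hθ, C_eq hθ]
  have h5 := congrArg Real.log (rad_add_mul_rad_sub θ r)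
  rw [Real.log_mul hp.ne' hm.ne', Real.log_mul (by positivity) (by positivity),
    Real.log_mul h1.ne' h2.ne', add_comm (4 : ℝ)] at h5
  push_cast
  linear_combination (1 / 2) * h5

/-- The left-hand side of the integrated equation, divided by `e^C`. -/
def cosOf (θ r : ℝ) : ℝ := r ^ (1 / 2 : ℝ) / (r ^ 2 + 4) ^ (1 / 4 : ℝ) * Real.exp (F θ r - C θ)

lemma cosOf_nonneg (θ : ℝ) {r : ℝ} (hr : 0 ≤ r) : 0 ≤ cosOf θ r := by
  rw [cosOf]; positivity

lemma cosOf_sq {θ : ℝ} (hθ : θ ∈ Ioo 0 Real.pi) {r : ℝ} (hr : 0 ≤ r) :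
    cosOf θ r ^ 2 = (1 + Real.cos θ) * r / (rad θ r + r * Real.cos θ) := by
  have h4 : (0 : ℝ) < r ^ 2 + 4 := by positivity
  have e1 : (r ^ (1 / 2 : ℝ)) ^ 2 = r := by
    rw [← Real.rpow_natCast, ← Real.rpow_mul hr]; norm_num
  have e2 : ((r ^ 2 + 4 : ℝ) ^ (1 / 4 : ℝ)) ^ 2 = √(r ^ 2 + 4) := by
    rw [← Real.rpow_natCast, ← Real.rpow_mul h4.le, Real.sqrt_eq_rpow]; norm_num
  have := Real.sqrt_pos.2 h4
  have := rad_add_pos hθ r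
  rw [cosOf, mul_pow, div_pow, e1, e2, exp_F_sub_C hθ]
  field_simp

lemma strictMonoOn_cosOf {θ : ℝ} (hθ : θ ∈ Ioo 0 Real.pi) : StrictMonoOn (cosOf θ) (Ici 0) := by
  intro x (hx : 0 ≤ x) y (hy : 0 ≤ y) hxy
  have hs := sin_pos_of_angle hθ
  rw [← sq_lt_sq₀ (cosOf_nonneg θ hx) (cosOf_nonneg θ hy), cosOf_sq hθ hx, cosOf_sq hθ hy,
    div_lt_div_iff₀ (rad_add_pos hθ x) (rad_add_pos hθ y)]
  -- The squared function is (1 + cos θ) / (rad/r + cos θ) for r > 0, so monotonicity amounts to r /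
  -- rad being increasing; the cross-multiplied form also covers r = 0.
  have h : x * rad θ y < y * rad θ x := by
    rw [← sq_lt_sq₀ (mul_nonneg hx (rad_nonneg θ y)) (mul_nonneg hy (rad_nonneg θ x)), mul_pow,
      mul_pow, rad_sq, rad_sq]
    nlinarith [mul_pos (mul_pos hs hs) (show 0 < y ^ 2 - x ^ 2 by nlinarith)]
  nlinarith [mul_pos (one_add_cos_pos hθ) (sub_pos.2 h)]

lemma cosOf_lt_one {θ : ℝ} (hθ : θ ∈ Ioo 0 Real.pi) {r : ℝ} (hr : 0 ≤ r) : cosOf θ r < 1 := by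
  rw [← sq_lt_one_iff₀ (cosOf_nonneg θ hr), cosOf_sq hθ hr, div_lt_one (rad_add_pos hθ r)]
  nlinarith [(le_abs_self r).trans_lt (abs_lt_rad hθ r)]

/-! ### The explicit slope of the profile -/

/-- The radical `√(1 - k² sin² t)`. -/
def radT (k t : ℝ) : ℝ := √(1 - k ^ 2 * Real.sin t ^ 2)

/-- The slope `φ'(t)` of the solutions of the integrated equation, with `k = sin (θ/2)`. -/
def slope (k t : ℝ) : ℝ := -(2 * k * Real.cos t ^ 2) / (Real.sin t * radT k t)

lemma half_angle {θ : ℝ} (hθ : θ ∈ Ioo 0 Real.pi) : 0 < Real.sin (θ / 2) ∧ 0 < Real.cos (θ / 2) ∧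
    Real.sin (θ / 2) ^ 2 + Real.cos (θ / 2) ^ 2 = 1 :=
  ⟨Real.sin_pos_of_mem_Ioo ⟨by linarith [hθ.1], by linarith [hθ.2, hθ.1]⟩,
    Real.cos_pos_of_mem_Ioo ⟨by linarith [hθ.1, Real.pi_pos], by linarith [hθ.2]⟩,
    Real.sin_sq_add_cos_sq _⟩

lemma cos_eq_half (θ : ℝ) : Real.cos θ = 1 - 2 * Real.sin (θ / 2) ^ 2 := by
  have h := Real.cos_two_mul (θ / 2)
  rw [mul_div_cancel₀ _ two_ne_zero] at h
  rw [h]; linarith [Real.sin_sq_add_cos_sq (θ / 2)]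

lemma sin_eq_half (θ : ℝ) : Real.sin θ = 2 * Real.sin (θ / 2) * Real.cos (θ / 2) := by
  have h := Real.sin_two_mul (θ / 2)
  rwa [mul_div_cancel₀ _ two_ne_zero] at h

lemma radT_arg_pos {k n : ℝ} (hn : 0 < n) (hkn : k ^ 2 + n ^ 2 = 1) (t : ℝ) :
    0 < 1 - k ^ 2 * Real.sin t ^ 2 := by
  nlinarith [Real.sin_sq_add_cos_sq t, sq_nonneg (k * Real.cos t), sq_nonneg (Real.cos t)]

lemma radT_sq {k n : ℝ} (hn : 0 < n) (hkn : k ^ 2 + n ^ 2 = 1) (t : ℝ) :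
    radT k t ^ 2 = 1 - k ^ 2 * Real.sin t ^ 2 := Real.sq_sqrt (radT_arg_pos hn hkn t).le

lemma radT_pos {k n : ℝ} (hn : 0 < n) (hkn : k ^ 2 + n ^ 2 = 1) (t : ℝ) : 0 < radT k t :=
  Real.sqrt_pos.2 (radT_arg_pos hn hkn t)

lemma slope_pos {k n : ℝ} (hk : 0 < k) (hn : 0 < n) (hkn : k ^ 2 + n ^ 2 = 1) {t : ℝ}
    (ht : t ∈ Ioo (-(Real.pi / 2)) 0) : 0 < slope k t := by
  have h1 := sin_neg_of_mem ht
  have h2 := cos_pos_of_mem ht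
  have h3 := radT_pos hn hkn t
  exact div_pos_of_neg_of_neg (by have : 0 < 2 * k * Real.cos t ^ 2 := by positivity
                                  linarith) (mul_neg_of_neg_of_pos h1 h3)

/-- The equation cos² t (rad + r cos θ) = (1 + cos θ) r, solved for the radical. Verifying it for
the explicit slope is what solves the integrated equation, and it eliminates the radical from every
later computation along the profile. -/
lemma rad_slope {θ : ℝ} (hθ : θ ∈ Ioo 0 Real.pi) {t : ℝ} (ht : t ∈ Ioo (-(Real.pi / 2)) 0) :
    rad θ (slope (Real.sin (θ / 2)) t) = slope (Real.sin (θ / 2)) t *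
      (1 + Real.cos θ - Real.cos θ * Real.cos t ^ 2) / Real.cos t ^ 2 := by
  obtain ⟨hk, hn, hkn⟩ := half_angle hθ
  have hs := slope_pos hk hn hkn ht
  have hc := cos_pos_of_mem ht
  have hsin := sin_neg_of_mem ht
  have h1 := one_add_cos_pos hθ
  have hx : Real.cos t ^ 2 ≤ 1 := Real.cos_sq_le_one t
  have hpos : 0 < 1 + Real.cos θ - Real.cos θ * Real.cos t ^ 2 := by
    nlinarith [sq_nonneg (Real.cos t), pow_pos hc 2]
  rw [← sq_eq_sq₀ (rad_nonneg _ _) (by positivity), rad_sq, sin_eq_half θ, cos_eq_half θ, slope]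
  have hq := radT_sq hn hkn t
  have hq0 := radT_pos hn hkn t
  generalize radT (Real.sin (θ / 2)) t = q at *
  generalize Real.sin (θ / 2) = k at *
  generalize Real.cos (θ / 2) = n at *
  have hst := Real.sin_sq_add_cos_sq t
  generalize Real.sin t = s at *
  generalize Real.cos t = x at *
  have hs0 : s ≠ 0 := hsin.ne
  field_simp
  have e : s ^ 2 = 1 - x ^ 2 := by linarith
  have en : n ^ 2 = 1 - k ^ 2 := by linarith
  rw [hq, e, en]
  ring

lemma cosOf_slope {θ : ℝ} (hθ : θ ∈ Ioo 0 Real.pi) {t : ℝ} (ht : t ∈ Ioo (-(Real.pi / 2)) 0) :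
    cosOf θ (slope (Real.sin (θ / 2)) t) = Real.cos t := by
  obtain ⟨hk, hn, hkn⟩ := half_angle hθ
  have hs := slope_pos hk hn hkn ht
  have hc := cos_pos_of_mem ht
  have h1 := one_add_cos_pos hθ
  rw [← sq_eq_sq₀ (cosOf_nonneg _ hs.le) hc.le, cosOf_sq hθ hs.le,
    div_eq_iff (rad_add_pos hθ _).ne', rad_slope hθ ht]
  field_simp
  ring

lemma G_eq (θ r : ℝ) : G θ r = -Real.arccos (cosOf θ r) := rfl

lemma G_slope {θ : ℝ} (hθ : θ ∈ Ioo 0 Real.pi) {t : ℝ} (ht : t ∈ Ioo (-(Real.pi / 2)) 0) :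
    G θ (slope (Real.sin (θ / 2)) t) = t := by
  rw [G_eq, cosOf_slope hθ ht, ← Real.cos_neg, Real.arccos_cos (by linarith [ht.2])
    (by linarith [ht.1, Real.pi_pos]), neg_neg]

lemma strictMonoOn_G {θ : ℝ} (hθ : θ ∈ Ioo 0 Real.pi) : StrictMonoOn (G θ) (Ici 0) := by
  intro x hx y hy hxy
  have h := strictMonoOn_cosOf hθ hx hy hxy
  have h0 := cosOf_nonneg θ hx
  have h1 := cosOf_lt_one hθ hy
  rw [G_eq, G_eq, neg_lt_neg_iff]
  exact Real.strictAntiOn_arccos ⟨by linarith, by linarith⟩ ⟨by linarith, h1.le⟩ h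

/-- Surjectivity needs no intermediate value argument: the explicit slope is a preimage of each
interior point, and r = 0 is sent to -π/2. -/
lemma image_G {θ : ℝ} (hθ : θ ∈ Ioo 0 Real.pi) : G θ '' Ici 0 = Ico (-(Real.pi / 2)) 0 := by
  ext t
  constructor
  · rintro ⟨r, hr, rfl⟩
    rw [G_eq]
    refine ⟨neg_le_neg (Real.arccos_le_pi_div_two.2 (cosOf_nonneg θ hr)), ?_⟩
    rw [neg_lt_zero]
    exact Real.arccos_pos.2 (cosOf_lt_one hθ hr)
  · rintro ⟨h1, h2⟩
    rcases h1.eq_or_lt with rfl | h1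
    · exact ⟨0, self_mem_Ici, by rw [G_eq, cosOf]; simp⟩
    · obtain ⟨hk, hn, hkn⟩ := half_angle hθ
      exact ⟨_, (slope_pos hk hn hkn ⟨h1, h2⟩).le, G_slope hθ ⟨h1, h2⟩⟩

lemma solvesIntegrated_iff {θ : ℝ} (hθ : θ ∈ Ioo 0 Real.pi) {φ : ℝ → ℝ} : SolvesIntegrated θ φ ↔
    ∀ t ∈ Ioo (-(Real.pi / 2)) 0, HasDerivAt φ (slope (Real.sin (θ / 2)) t) t := by
  refine forall₂_congr fun t ht => ?_
  have hc := cos_pos_of_mem ht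
  obtain ⟨hk, hn, hkn⟩ := half_angle hθ
  have hs := slope_pos hk hn hkn ht
  have key : ∀ r : ℝ, (r ^ (1 / 2 : ℝ) / (r ^ 2 + 4) ^ (1 / 4 : ℝ) * Real.exp (F θ r)
      = Real.exp (C θ) * Real.cos t) ↔ r = slope (Real.sin (θ / 2)) t := by
    intro r
    have e : r ^ (1 / 2 : ℝ) / (r ^ 2 + 4) ^ (1 / 4 : ℝ) * Real.exp (F θ r)
        = Real.exp (C θ) * cosOf θ r := by
      rw [cosOf, Real.exp_sub]
      field_simp
    rw [e, mul_right_inj' (Real.exp_pos _).ne']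
    constructor
    · intro h
      have hr : 0 ≤ r := by
        by_contra! hr
        -- The real power of a negative base carries a factor cos(π/2) = 0, so a negative slope
        -- would force cos t = 0.
        have : r ^ (1 / 2 : ℝ) = 0 := by
          rw [Real.rpow_def_of_neg hr, show 1 / 2 * Real.pi = Real.pi / 2 by ring,
            Real.cos_pi_div_two, mul_zero]
        rw [cosOf, this, zero_div, zero_mul] at h
        exact hc.ne h
      exact (strictMonoOn_cosOf hθ).injOn hr hs.le (h.trans (cosOf_slope hθ ht).symm)
    · rintro rfl
      exact cosOf_slope hθ ht
  rw [key]
  exact ⟨fun h => h.2 ▸ h.1.hasDerivAt, fun h => ⟨h.differentiableAt, h.deriv⟩⟩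

/-! ### The profile -/

/-- The parameter `η ∈ (0, ∞)` of the profile curve, with `sinh η = -cot t / n`. -/
def eta (n t : ℝ) : ℝ := Real.arsinh (-(Real.cos t / (n * Real.sin t)))

/-- The normalized solution `φ` of the integrated equation, with `k = sin (θ/2)` and
`n = cos (θ/2)`. -/
def profile (k n t : ℝ) : ℝ := 2 * k * eta n t - 2 * Real.arsinh (k * Real.cos t / n)

lemma sinh_eta (n t : ℝ) : Real.sinh (eta n t) = -(Real.cos t / (n * Real.sin t)) :=
  Real.sinh_arsinh _

lemma radT_sq' {k n : ℝ} (hn : 0 < n) (hkn : k ^ 2 + n ^ 2 = 1) (t : ℝ) :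
    radT k t ^ 2 = n ^ 2 + k ^ 2 * Real.cos t ^ 2 := by
  rw [radT_sq hn hkn, Real.sin_sq]; linarith

lemma radT_sq_eq_sin_cos {k n : ℝ} (hn : 0 < n) (hkn : k ^ 2 + n ^ 2 = 1) (t : ℝ) :
    radT k t ^ 2 = n ^ 2 * Real.sin t ^ 2 + Real.cos t ^ 2 := by
  rw [radT_sq' hn hkn, Real.sin_sq]; linear_combination (Real.cos t ^ 2) * hkn

lemma sqrt_eta_arg {k n : ℝ} (hn : 0 < n) (hkn : k ^ 2 + n ^ 2 = 1) {t : ℝ} (ht : Real.sin t < 0) :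
    √(1 + (-(Real.cos t / (n * Real.sin t))) ^ 2) = radT k t / (n * -Real.sin t) := by
  have hq := radT_pos hn hkn t
  have hs : 0 < -Real.sin t := by linarith
  have hs' : Real.sin t ≠ 0 := ht.ne
  rw [Real.sqrt_eq_iff_mul_self_eq (by positivity) (by positivity)]
  field_simp
  linear_combination -radT_sq_eq_sin_cos hn hkn t

lemma cosh_eta {k n : ℝ} (hn : 0 < n) (hkn : k ^ 2 + n ^ 2 = 1) {t : ℝ} (ht : Real.sin t < 0) :
    Real.cosh (eta n t) = radT k t / (n * -Real.sin t) := by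
  rw [eta, Real.cosh_arsinh, sqrt_eta_arg hn hkn ht]

lemma eta_pos {n : ℝ} (hn : 0 < n) {t : ℝ} (ht : t ∈ Ioo (-(Real.pi / 2)) 0) : 0 < eta n t := by
  have h1 := sin_neg_of_mem ht
  have h2 := cos_pos_of_mem ht
  rw [eta, Real.arsinh_pos_iff, neg_pos]
  exact div_neg_of_pos_of_neg h2 (mul_neg_of_pos_of_neg hn h1)

lemma hasDerivAt_eta {k n : ℝ} (hn : 0 < n) (hkn : k ^ 2 + n ^ 2 = 1) {t : ℝ}
    (ht : Real.sin t < 0) : HasDerivAt (eta n) (-(1 / (Real.sin t * radT k t))) t := by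
  have hq := radT_pos hn hkn t
  have h0 : n * Real.sin t ≠ 0 := mul_ne_zero hn.ne' ht.ne
  have h1 : HasDerivAt (fun t => -(Real.cos t / (n * Real.sin t))) (1 / (n * Real.sin t ^ 2)) t := by
    refine (((Real.hasDerivAt_cos t).fun_div ((Real.hasDerivAt_sin t).const_mul n) h0).fun_neg
      ).congr_deriv ?_
    have := ht.ne
    field_simp
    linear_combination Real.sin_sq_add_cos_sq t
  refine ((Real.hasDerivAt_arsinh _).comp t h1).congr_deriv ?_
  rw [sqrt_eta_arg hn hkn ht]
  have := ht.ne
  field_simp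

lemma sqrt_arsinh_arg {k n : ℝ} (hn : 0 < n) (hkn : k ^ 2 + n ^ 2 = 1) (t : ℝ) :
    √(1 + (k * Real.cos t / n) ^ 2) = radT k t / n := by
  have hq := radT_pos hn hkn t
  rw [Real.sqrt_eq_iff_mul_self_eq (by positivity) (by positivity)]
  field_simp
  linear_combination -radT_sq' hn hkn t

lemma hasDerivAt_profile {k n : ℝ} (hn : 0 < n) (hkn : k ^ 2 + n ^ 2 = 1) {t : ℝ}
    (ht : Real.sin t < 0) : HasDerivAt (profile k n) (slope k t) t := by
  have hq := radT_pos hn hkn t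
  have h1 : HasDerivAt (fun t => k * Real.cos t / n) (k * -Real.sin t / n) t :=
    ((Real.hasDerivAt_cos t).const_mul k).div_const n
  refine (((hasDerivAt_eta hn hkn ht).const_mul (2 * k)).fun_sub
    (((Real.hasDerivAt_arsinh _).comp t h1).const_mul 2)).congr_deriv ?_
  rw [sqrt_arsinh_arg hn hkn, slope]
  have := ht.ne
  field_simp
  linear_combination k * Real.sin_sq_add_cos_sq t

/-- Exponentiating φ/2 = kη - arsinh(k cos t / n) makes the inverse hyperbolic sine algebraic. This
is how e^{kη} and e^{φ/2} are exchanged in the lift of σ and in the asymptotics of φ. -/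
lemma exp_half_profile {k n : ℝ} (hn : 0 < n) (hkn : k ^ 2 + n ^ 2 = 1) (t : ℝ) :
    Real.exp (profile k n t / 2) * (k * Real.cos t + radT k t) = n * Real.exp (k * eta n t) := by
  have h : k * Real.cos t + radT k t = n * Real.exp (Real.arsinh (k * Real.cos t / n)) := by
    rw [Real.exp_arsinh, sqrt_arsinh_arg hn hkn]
    field_simp
  rw [h, mul_left_comm, ← Real.exp_add, profile]
  congr 2
  ring

lemma tendsto_sin_zero : Tendsto Real.sin (𝓝[<] 0) (𝓝 0) := by
  have := (Real.continuous_sin.tendsto 0).mono_left (nhdsWithin_le_nhds (s := Iio 0))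
  rwa [Real.sin_zero] at this

lemma tendsto_cos_zero : Tendsto Real.cos (𝓝[<] 0) (𝓝 1) := by
  have := (Real.continuous_cos.tendsto 0).mono_left (nhdsWithin_le_nhds (s := Iio 0))
  rwa [Real.cos_zero] at this

lemma mem_left : ∀ᶠ t : ℝ in 𝓝[<] 0, t ∈ Ioo (-(Real.pi / 2)) 0 :=
  Ioo_mem_nhdsLT (by linarith [Real.pi_pos])

lemma mem_right : ∀ᶠ t : ℝ in 𝓝[>] (-(Real.pi / 2)), t ∈ Ioo (-(Real.pi / 2)) 0 :=
  Ioo_mem_nhdsGT (by linarith [Real.pi_pos])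

lemma tendsto_id_div_sin : Tendsto (fun t => t / Real.sin t) (𝓝[<] 0) (𝓝 1) := by
  have h := (Real.hasDerivAt_sin 0).tendsto_slope_zero
  simp only [zero_add, Real.sin_zero, sub_zero, Real.cos_zero, smul_eq_mul] at h
  have h2 := (h.mono_left (nhdsWithin_mono 0 (show Iio (0 : ℝ) ⊆ {0}ᶜ from
    fun x hx => ne_of_lt hx))).inv₀ one_ne_zero
  rw [inv_one] at h2
  refine h2.congr fun t => ?_
  rw [mul_inv, inv_inv, div_eq_mul_inv]

lemma tendsto_radT_zero (k : ℝ) : Tendsto (radT k) (𝓝[<] 0) (𝓝 1) := by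
  have h : Continuous (radT k) := by unfold radT; fun_prop
  have := (h.tendsto 0).mono_left (nhdsWithin_le_nhds (s := Iio 0))
  rwa [radT, Real.sin_zero, zero_pow two_ne_zero, mul_zero, sub_zero, Real.sqrt_one] at this

lemma tendsto_eta_atTop {n : ℝ} (hn : 0 < n) : Tendsto (eta n) (𝓝[<] 0) atTop := by
  have h : Tendsto Real.arsinh atTop atTop :=
    Real.arsinh_strictMono.monotone.tendsto_atTop_atTop fun b =>
      ⟨Real.sinh b, (Real.arsinh_sinh b).ge⟩
  refine h.comp ?_
  have h1 : Tendsto (fun t => -(n * Real.sin t)) (𝓝[<] 0) (𝓝[>] 0) := by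
    refine tendsto_nhdsWithin_iff.2 ⟨by simpa using (tendsto_sin_zero.const_mul n).neg, ?_⟩
    filter_upwards [mem_left] with t ht
    simpa using mul_neg_of_pos_of_neg hn (sin_neg_of_mem ht)
  refine ((tendsto_inv_nhdsGT_zero.comp h1).atTop_mul_pos one_pos tendsto_cos_zero).congr ?_
  intro t
  simp only [Function.comp]
  rw [inv_neg]
  ring

lemma tendsto_mul_slope (k : ℝ) :
    Tendsto (fun t => t * slope k t) (𝓝[<] 0) (𝓝 (-(2 * k))) := by
  have h := tendsto_id_div_sin.mul ((((tendsto_cos_zero.pow 2).const_mul (2 * k)).neg).div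
    (tendsto_radT_zero k) one_ne_zero)
  simp only [one_pow, mul_one, div_one, one_mul] at h
  refine h.congr fun t => ?_
  simp only [slope, Pi.div_apply]
  rw [← mul_div_mul_comm, mul_div_assoc]

lemma tendsto_slope_atTop {k : ℝ} (hk : 0 < k) :
    Tendsto (slope k) (𝓝[<] 0) atTop := by
  have h1 : Tendsto (fun t : ℝ => -t⁻¹) (𝓝[<] 0) atTop :=
    tendsto_neg_atBot_atTop.comp tendsto_inv_nhdsLT_zero
  have h2 := (tendsto_mul_slope k).neg
  rw [neg_neg] at h2
  refine (h1.atTop_mul_pos (by positivity : (0 : ℝ) < 2 * k) h2).congr' ?_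
  filter_upwards [self_mem_nhdsWithin] with t ht
  have : t ≠ 0 := ne_of_lt ht
  field_simp

lemma continuousAt_slope {k n : ℝ} (hn : 0 < n) (hkn : k ^ 2 + n ^ 2 = 1) {t : ℝ}
    (ht : Real.sin t < 0) : ContinuousAt (slope k) t := by
  have h : Continuous (radT k) := by unfold radT; fun_prop
  exact ContinuousAt.div (by fun_prop) (by fun_prop) (mul_ne_zero ht.ne (radT_pos hn hkn t).ne')

lemma sin_left_end : Real.sin (-(Real.pi / 2)) < 0 := by
  rw [Real.sin_neg, Real.sin_pi_div_two]; norm_num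

lemma tendsto_slope_left {k n : ℝ} (hn : 0 < n) (hkn : k ^ 2 + n ^ 2 = 1) :
    Tendsto (slope k) (𝓝[>] (-(Real.pi / 2))) (𝓝 0) := by
  have := (continuousAt_slope hn hkn sin_left_end).tendsto.mono_left
    (nhdsWithin_le_nhds (s := Ioi (-(Real.pi / 2))))
  simpa [slope] using this

lemma contDiffOn_radT {k n : ℝ} (hn : 0 < n) (hkn : k ^ 2 + n ^ 2 = 1) : ContDiff ℝ ∞ (radT k) :=
  ContDiff.sqrt (by fun_prop) fun t => (radT_arg_pos hn hkn t).ne'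

lemma contDiffOn_slope {k n : ℝ} (hn : 0 < n) (hkn : k ^ 2 + n ^ 2 = 1) :
    ContDiffOn ℝ ∞ (slope k) (Ioo (-(Real.pi / 2)) 0) := by
  have h := (contDiffOn_radT hn hkn).contDiffOn (s := Ioo (-(Real.pi / 2)) 0)
  refine ContDiffOn.div (by fun_prop) (Real.contDiff_sin.contDiffOn.mul h) fun t ht => ?_
  exact mul_ne_zero (sin_neg_of_mem ht).ne (radT_pos hn hkn t).ne'

lemma contDiffOn_of_hasDerivAt_slope {k n : ℝ} (hn : 0 < n) (hkn : k ^ 2 + n ^ 2 = 1) {φ : ℝ → ℝ}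
    (h : ∀ t ∈ Ioo (-(Real.pi / 2)) 0, HasDerivAt φ (slope k t) t) :
    ContDiffOn ℝ ∞ φ (Ioo (-(Real.pi / 2)) 0) := by
  rw [contDiffOn_infty_iff_deriv_of_isOpen isOpen_Ioo]
  exact ⟨fun t ht => (h t ht).differentiableAt.differentiableWithinAt,
    (contDiffOn_slope hn hkn).congr fun t ht => (h t ht).deriv⟩

lemma eqOn_profile_add {k n : ℝ} (hn : 0 < n) (hkn : k ^ 2 + n ^ 2 = 1) {φ : ℝ → ℝ}
    (h : ∀ t ∈ Ioo (-(Real.pi / 2)) 0, HasDerivAt φ (slope k t) t) :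
    ∃ K, EqOn φ (fun t => profile k n t + K) (Ioo (-(Real.pi / 2)) 0) := by
  have hp := Real.pi_pos
  have hmem : -(Real.pi / 4) ∈ Ioo (-(Real.pi / 2)) 0 := ⟨by linarith, by linarith⟩
  refine ⟨φ (-(Real.pi / 4)) - profile k n (-(Real.pi / 4)), ?_⟩
  have hd : ∀ t ∈ Ioo (-(Real.pi / 2)) 0, HasDerivAt (fun t => profile k n t +
      (φ (-(Real.pi / 4)) - profile k n (-(Real.pi / 4)))) (slope k t) t := fun t ht =>
    (hasDerivAt_profile hn hkn (sin_neg_of_mem ht)).add_const _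
  refine isOpen_Ioo.eqOn_of_deriv_eq isPreconnected_Ioo
    (fun t ht => (h t ht).differentiableAt.differentiableWithinAt)
    (fun t ht => (hd t ht).differentiableAt.differentiableWithinAt)
    (fun t ht => by rw [(h t ht).deriv, (hd t ht).deriv]) hmem ?_
  ring

lemma tendsto_profile_left {k n : ℝ} (hn : 0 < n) (hkn : k ^ 2 + n ^ 2 = 1) :
    Tendsto (profile k n) (𝓝[>] (-(Real.pi / 2))) (𝓝 0) := by
  have := (hasDerivAt_profile hn hkn sin_left_end).continuousAt.tendsto.mono_left
    (nhdsWithin_le_nhds (s := Ioi (-(Real.pi / 2))))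
  simpa [profile, eta] using this

lemma tendsto_profile_atTop {k n : ℝ} (hk : 0 < k) (hn : 0 < n) :
    Tendsto (profile k n) (𝓝[<] 0) atTop := by
  have h : Tendsto (fun t => -(2 * Real.arsinh (k * Real.cos t / n))) (𝓝[<] 0)
      (𝓝 (-(2 * Real.arsinh (k * 1 / n)))) :=
    (((Real.continuous_arsinh.tendsto _).comp
      ((tendsto_cos_zero.const_mul k).div_const n)).const_mul 2).neg
  exact ((tendsto_eta_atTop hn).const_mul_atTop (by positivity : 0 < 2 * k)).atTop_add h

lemma tendsto_exp_div_sinh {k : ℝ} (hk : k < 1) :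
    Tendsto (fun x => Real.exp (k * x) / Real.sinh x) atTop (𝓝 0) := by
  have h1 : Tendsto (fun x : ℝ => Real.exp ((k - 1) * x)) atTop (𝓝 0) :=
    Real.tendsto_exp_atBot.comp (tendsto_id.const_mul_atTop_of_neg (by linarith))
  have h2 : Tendsto (fun x : ℝ => 1 - Real.exp (-2 * x)) atTop (𝓝 1) := by
    simpa using (Real.tendsto_exp_atBot.comp
      (tendsto_id.const_mul_atTop_of_neg (by norm_num : (-2 : ℝ) < 0))).const_sub 1
  have h3 := (h1.const_mul 2).div h2 one_ne_zero
  rw [mul_zero, zero_div] at h3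
  refine h3.congr' ?_
  filter_upwards [eventually_gt_atTop 0] with x hx
  have hx' : 0 < Real.sinh x := Real.sinh_pos_iff.2 hx
  have e1 : Real.exp ((k - 1) * x) = Real.exp (k * x) * Real.exp (-x) := by
    rw [← Real.exp_add]; ring_nf
  have e2 : 1 - Real.exp (-2 * x) = 2 * Real.sinh x * Real.exp (-x) := by
    rw [Real.sinh_eq, show (-2 * x) = -x + -x by ring, Real.exp_add, ]
    have : Real.exp x * Real.exp (-x) = 1 := by rw [← Real.exp_add]; simp
    linear_combination -this
  simp only [Pi.div_apply, e1, e2]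
  field_simp

/-- As t → 0, e^{φ/2} is comparable to e^{kη} and t is comparable to 1 / sinh η, so the product
behaves like e^{kη} / sinh η, which vanishes in the limit because k < 1. -/
lemma tendsto_mul_exp_profile {k n : ℝ} (hk : 0 < k) (hn : 0 < n) (hkn : k ^ 2 + n ^ 2 = 1) :
    Tendsto (fun t => t * Real.exp (profile k n t / 2)) (𝓝[<] 0) (𝓝 0) := by
  have hk1 : k < 1 := by nlinarith
  have h1 := (tendsto_exp_div_sinh hk1).comp (tendsto_eta_atTop hn)
  have h2 := (((tendsto_id_div_sin.mul tendsto_cos_zero).neg).div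
    ((tendsto_cos_zero.const_mul k).add (tendsto_radT_zero k)) (by positivity)).mul h1
  rw [mul_zero] at h2
  refine h2.congr' ?_
  filter_upwards [mem_left] with t ht
  have hs := (sin_neg_of_mem ht).ne
  have hc := cos_pos_of_mem ht
  have hq := radT_pos hn hkn t
  have he := exp_half_profile hn hkn t
  have hd : 0 < k * Real.cos t + radT k t := by positivity
  simp only [Function.comp, sinh_eta, Pi.div_apply]
  rw [← eq_div_iff hd.ne'] at he
  rw [he]
  field_simp

lemma sq_sub_pos {k n : ℝ} (hk : 0 < k) (hkn : k ^ 2 + n ^ 2 = 1) {t : ℝ}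
    (hc : Real.cos t ≠ 0) : 0 < n ^ 2 - (1 - 2 * k ^ 2) * Real.cos t ^ 2 := by
  have : n ^ 2 - (1 - 2 * k ^ 2) * Real.cos t ^ 2
      = n ^ 2 * (1 - Real.cos t ^ 2) + k ^ 2 * Real.cos t ^ 2 := by
    linear_combination (Real.cos t ^ 2) * hkn
  rw [this]
  have := mul_nonneg (sq_nonneg n) (sub_nonneg.2 (Real.cos_sq_le_one t))
  positivity

lemma four_add_slope_sq {k n : ℝ} (hn : 0 < n) (hkn : k ^ 2 + n ^ 2 = 1) {t : ℝ}
    (hs : Real.sin t ≠ 0) : 4 + slope k t ^ 2 =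
      4 * (n ^ 2 - (1 - 2 * k ^ 2) * Real.cos t ^ 2) / (Real.sin t ^ 2 * radT k t ^ 2) := by
  have hq := radT_pos hn hkn t
  rw [slope]
  field_simp
  rw [radT_sq' hn hkn, Real.sin_sq]
  linear_combination (-4 * Real.cos t ^ 2) * hkn

/-- With N = n² - cos θ cos² t, M = 1 + cos θ - cos θ cos² t and q = √(1 - k² sin² t), the three
factors are 4 + r² = 4N / (sin² t q²), 1 - r cos θ / rad = 2N / M and r'/r = -M / (cos t sin t q²).
In the product N, M and q cancel and only -r tan t remains. -/
lemma solvesODE_of_hasDerivAt {θ : ℝ} (hθ : θ ∈ Ioo 0 Real.pi) {φ : ℝ → ℝ}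
    (h : ∀ t ∈ Ioo (-(Real.pi / 2)) 0, HasDerivAt φ (slope (Real.sin (θ / 2)) t) t) :
    SolvesODE θ φ := by
  obtain ⟨hk, hn, hkn⟩ := half_angle hθ
  rw [solvesODE_iff fun t ht => by rw [(h t ht).deriv]; exact (slope_pos hk hn hkn ht).ne']
  intro t ht
  have hs := sin_neg_of_mem ht
  have hc := cos_pos_of_mem ht
  have hq := radT_pos hn hkn t
  have hq2 := radT_sq' hn hkn t
  have hr := rad_slope hθ ht
  have hr0 := slope_pos hk hn hkn ht
  have h2 : deriv (deriv φ) t = deriv (slope (Real.sin (θ / 2))) t := by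
    refine Filter.EventuallyEq.deriv_eq ?_
    filter_upwards [isOpen_Ioo.mem_nhds ht] with u hu using (h u hu).deriv
  have hqd : HasDerivAt (radT (Real.sin (θ / 2)))
      (-(Real.sin (θ / 2) ^ 2 * Real.sin t * Real.cos t) / radT (Real.sin (θ / 2)) t) t := by
    have h3 : HasDerivAt (fun t => 1 - Real.sin (θ / 2) ^ 2 * Real.sin t ^ 2)
        (-(Real.sin (θ / 2) ^ 2 * (2 * Real.sin t * Real.cos t))) t := by
      simpa using (((Real.hasDerivAt_sin t).fun_pow 2).const_mul (Real.sin (θ / 2) ^ 2)).const_sub 1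
    refine (h3.sqrt (radT_arg_pos hn hkn t).ne').congr_deriv ?_
    change _ / (2 * radT (Real.sin (θ / 2)) t) = _
    field_simp
  set k := Real.sin (θ / 2) with hk_def
  set n := Real.cos (θ / 2) with hn_def
  set q := radT k t with hq_def
  have hcc : Real.cos θ = 1 - 2 * k ^ 2 := cos_eq_half θ
  have hx := Real.cos_sq_le_one t
  have hN : 0 < n ^ 2 - Real.cos θ * Real.cos t ^ 2 := by
    rw [hcc]
    exact sq_sub_pos hk hkn hc.ne'
  have hM : 0 < 1 + Real.cos θ - Real.cos θ * Real.cos t ^ 2 := by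
    have : 1 + Real.cos θ - Real.cos θ * Real.cos t ^ 2
        = n ^ 2 + (n ^ 2 - Real.cos θ * Real.cos t ^ 2) := by
      linear_combination hcc - 2 * hkn
    rw [this]
    positivity
  have hs2 := Real.sin_sq t
  have e4 := four_add_slope_sq hn hkn hs.ne
  rw [← hcc, ← hq_def] at e4
  have e5 : deriv (slope k) t = slope k t * -((1 + Real.cos θ - Real.cos θ * Real.cos t ^ 2) /
      (Real.cos t * Real.sin t * q ^ 2)) := by
    refine (((((Real.hasDerivAt_cos t).fun_pow 2).const_mul (2 * k)).fun_neg).fun_div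
      ((Real.hasDerivAt_sin t).fun_mul hqd) (mul_ne_zero hs.ne hq.ne')).deriv.trans ?_
    rw [slope, ← hq_def]
    have := hs.ne
    field_simp
    norm_num
    rw [hq2, hs2, hcc]
    linear_combination (2 * Real.cos t - Real.cos t ^ 3) * hkn
  rw [h2, (h t ht).deriv, hr, Real.tan_eq_sin_div_cos, e4, e5]
  have e6 : slope k t * Real.cos θ / (slope k t * (1 + Real.cos θ - Real.cos θ * Real.cos t ^ 2) /
      Real.cos t ^ 2) = Real.cos θ * Real.cos t ^ 2 /
        (1 + Real.cos θ - Real.cos θ * Real.cos t ^ 2) := by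
    field_simp
  have e7 : 1 - Real.cos θ * Real.cos t ^ 2 / (1 + Real.cos θ - Real.cos θ * Real.cos t ^ 2)
      = 2 * (n ^ 2 - Real.cos θ * Real.cos t ^ 2) /
        (1 + Real.cos θ - Real.cos θ * Real.cos t ^ 2) := by
    field_simp
    linear_combination hcc - 2 * hkn
  rw [e6, e7]
  generalize 1 + Real.cos θ - Real.cos θ * Real.cos t ^ 2 = M at *
  generalize n ^ 2 - Real.cos θ * Real.cos t ^ 2 = N at *
  have := hs.ne
  field_simp
  norm_num

/-- The properties of all the solutions of the integrated equation. -/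
lemma solvesIntegrated_properties {θ : ℝ} (hθ : θ ∈ Ioo 0 Real.pi) {φ : ℝ → ℝ}
    (hφ : SolvesIntegrated θ φ) :
    ContDiffOn ℝ ∞ φ (Ioo (-(Real.pi / 2)) 0) ∧
      (∀ t ∈ Ioo (-(Real.pi / 2)) 0, 0 < deriv φ t ∧ G θ (deriv φ t) = t) ∧
      SolvesODE θ φ ∧
      Tendsto (deriv φ) (𝓝[>] (-(Real.pi / 2))) (𝓝 0) ∧
      Tendsto (deriv φ) (𝓝[<] 0) atTop ∧
      Tendsto (fun t => t * deriv φ t) (𝓝[<] 0) (𝓝 (-√(2 * (1 - Real.cos θ)))) ∧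
      Tendsto φ (𝓝[<] 0) atTop ∧
      Tendsto (fun t => t * Real.exp (φ t / 2)) (𝓝[<] 0) (𝓝 0) := by
  obtain ⟨hk, hn, hkn⟩ := half_angle hθ
  have h := (solvesIntegrated_iff hθ).1 hφ
  have hd : ∀ t ∈ Ioo (-(Real.pi / 2)) 0, slope (Real.sin (θ / 2)) t = deriv φ t :=
    fun t ht => (h t ht).deriv.symm
  obtain ⟨K, hK⟩ := eqOn_profile_add hn hkn h
  refine ⟨contDiffOn_of_hasDerivAt_slope hn hkn h, fun t ht => ?_, solvesODE_of_hasDerivAt hθ h,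
    (tendsto_slope_left hn hkn).congr' (mem_right.mono hd),
    (tendsto_slope_atTop hk).congr' (mem_left.mono hd), ?_, ?_, ?_⟩
  · rw [← hd t ht]
    exact ⟨slope_pos hk hn hkn ht, G_slope hθ ht⟩
  · have e : √(2 * (1 - Real.cos θ)) = 2 * Real.sin (θ / 2) := by
      rw [Real.sqrt_eq_iff_mul_self_eq (by linarith [one_sub_cos_pos hθ]) (by positivity),
        cos_eq_half θ]
      ring
    rw [e]
    refine (tendsto_mul_slope _).congr' (mem_left.mono fun t ht => ?_)
    rw [hd t ht]
  · exact (tendsto_atTop_add_const_right _ K (tendsto_profile_atTop hk hn)).congr'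
      (mem_left.mono fun t ht => (hK ht).symm)
  · have h1 := (tendsto_mul_exp_profile hk hn hkn).mul_const (Real.exp (K / 2))
    rw [zero_mul] at h1
    refine h1.congr' (mem_left.mono fun t ht => ?_)
    have e : φ t = profile (Real.sin (θ / 2)) (Real.cos (θ / 2)) t + K := hK ht
    simp only [e, add_div, Real.exp_add, mul_assoc]

lemma isProfile_profile {θ : ℝ} (hθ : θ ∈ Ioo 0 Real.pi) :
    IsProfile θ (profile (Real.sin (θ / 2)) (Real.cos (θ / 2))) := by
  obtain ⟨hk, hn, hkn⟩ := half_angle hθ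
  exact ⟨(solvesIntegrated_iff hθ).2 fun t ht => hasDerivAt_profile hn hkn (sin_neg_of_mem ht),
    tendsto_profile_left hn hkn⟩

/-- Two solutions have the same explicit slope, hence differ by a constant, and the limit at -π/2
makes this constant zero. -/
lemma IsProfile.eqOn {θ : ℝ} (hθ : θ ∈ Ioo 0 Real.pi) {φ : ℝ → ℝ} (hφ : IsProfile θ φ) :
    EqOn φ (profile (Real.sin (θ / 2)) (Real.cos (θ / 2))) (Ioo (-(Real.pi / 2)) 0) := by
  obtain ⟨hk, hn, hkn⟩ := half_angle hθ
  obtain ⟨K, hK⟩ := eqOn_profile_add hn hkn ((solvesIntegrated_iff hθ).1 hφ.1)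
  have h1 := ((tendsto_profile_left hn hkn).add_const K).congr'
    (mem_right.mono fun t ht => (hK ht).symm)
  have h2 := tendsto_nhds_unique h1 hφ.2
  rw [zero_add] at h2
  intro t ht
  have e : φ t = profile (Real.sin (θ / 2)) (Real.cos (θ / 2)) t + K := hK ht
  rw [e, h2, add_zero]

/-! ### Lifts to `SL(2, ℝ)` -/

/-- The matrix `M` lies in `SL(2, ℝ)` and represents `γ`. -/
def IsLift (M : M2) (γ : AdS) : Prop :=
  ∃ g : Matrix.SpecialLinearGroup (Fin 2) ℝ, (g : M2) = M ∧ cls g = γ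

lemma isLift_cls (g : Matrix.SpecialLinearGroup (Fin 2) ℝ) : IsLift g (cls g) := ⟨g, rfl, rfl⟩

lemma exists_isLift (γ : AdS) : ∃ M, IsLift M γ := by
  obtain ⟨g, rfl⟩ := QuotientGroup.mk_surjective γ
  exact ⟨_, isLift_cls g⟩

lemma exists_isLift_of_det {M : M2} (h : M.det = 1) : ∃ γ, IsLift M γ := ⟨cls ⟨M, h⟩, ⟨M, h⟩, rfl, rfl⟩

lemma IsLift.det_eq {M : M2} {γ : AdS} (h : IsLift M γ) : M.det = 1 := by
  obtain ⟨g, rfl, -⟩ := h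
  exact g.2

lemma IsLift.det_eq' {M : M2} {γ : AdS} (h : IsLift M γ) : M 0 0 * M 1 1 - M 0 1 * M 1 0 = 1 := by
  rw [← Matrix.det_fin_two, h.det_eq]

lemma cls_eq_iff {g h : Matrix.SpecialLinearGroup (Fin 2) ℝ} :
    cls g = cls h ↔ (h : M2) = g ∨ (h : M2) = -g := by
  rw [cls, cls, QuotientGroup.eq, Matrix.SpecialLinearGroup.mem_center_iff]
  have key : ∀ r : ℝ, Matrix.scalar (Fin 2) r = ((g⁻¹ * h : Matrix.SpecialLinearGroup (Fin 2) ℝ) : M2)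
      ↔ (h : M2) = r • (g : M2) := by
    intro r
    rw [Matrix.SpecialLinearGroup.coe_mul]
    have h1 : (g : M2) * ((g⁻¹ : Matrix.SpecialLinearGroup (Fin 2) ℝ) : M2) = 1 := by
      rw [← Matrix.SpecialLinearGroup.coe_mul, mul_inv_cancel, Matrix.SpecialLinearGroup.coe_one]
    have h2 : ((g⁻¹ : Matrix.SpecialLinearGroup (Fin 2) ℝ) : M2) * (g : M2) = 1 := by
      rw [← Matrix.SpecialLinearGroup.coe_mul, inv_mul_cancel, Matrix.SpecialLinearGroup.coe_one]
    have hsc : Matrix.scalar (Fin 2) r = r • (1 : M2) := by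
      rw [Matrix.scalar_apply, Matrix.smul_one_eq_diagonal]
    rw [hsc]
    constructor
    · intro e
      have := congrArg ((g : M2) * ·) e
      simp only [← mul_assoc, h1, one_mul] at this
      rw [← this, Matrix.mul_smul, mul_one]
    · intro e
      rw [e, Matrix.mul_smul, h2]
  simp only [key, Fintype.card_fin]
  constructor
  · rintro ⟨r, hr, e⟩
    rcases mul_self_eq_one_iff.1 (show r * r = 1 by rw [← sq, hr]) with rfl | rfl
    · left; simpa using e
    · right; simpa using e
  · rintro (e | e)
    · exact ⟨1, by norm_num, by simpa using e⟩
    · exact ⟨-1, by norm_num, by simpa using e⟩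

lemma IsLift.neg {M : M2} {γ : AdS} (h : IsLift M γ) : IsLift (-M) γ := by
  obtain ⟨g, rfl, rfl⟩ := h
  refine ⟨-g, by simp, ?_⟩
  rw [cls_eq_iff]
  right; simp

lemma IsLift.eq_or_neg {M N : M2} {γ : AdS} (h : IsLift M γ) (h' : IsLift N γ) :
    N = M ∨ N = -M := by
  obtain ⟨g, rfl, rfl⟩ := h
  obtain ⟨g', rfl, h'⟩ := h'
  exact cls_eq_iff.1 h'.symm

lemma IsLift.unique {M : M2} {γ γ' : AdS} (h : IsLift M γ) (h' : IsLift M γ') : γ = γ' := by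
  obtain ⟨g, rfl, rfl⟩ := h
  obtain ⟨g', e, rfl⟩ := h'
  rw [cls_eq_iff]
  exact Or.inl e

lemma IsLift.mul {M N : M2} {γ δ : AdS} (h : IsLift M γ) (h' : IsLift N δ) :
    IsLift (M * N) (γ * δ) := by
  obtain ⟨g, rfl, rfl⟩ := h
  obtain ⟨g', rfl, rfl⟩ := h'
  exact ⟨g * g', by simp, rfl⟩

lemma IsLift.inv {M : M2} {γ : AdS} (h : IsLift M γ) : IsLift M.adjugate γ⁻¹ := by
  obtain ⟨g, rfl, rfl⟩ := h
  exact ⟨g⁻¹, by simp, rfl⟩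

lemma isLift_ofEntries (a b c d : ℝ) (h : a * d - b * c = 1) :
    IsLift !![a, b; c, d] (ofEntries a b c d h) := ⟨_, coe_slOf a b c d h, rfl⟩

/-- The denominator of a Möbius transformation does not vanish. -/
lemma IsLift.denom_ne_zero {M : M2} {γ : AdS} (h : IsLift M γ) {z : ℂ} (hz : 0 < z.im) :
    ((M 1 0 : ℝ) : ℂ) * z + (M 1 1 : ℝ) ≠ 0 := by
  intro e
  have h1 := congrArg Complex.im e
  have h2 := congrArg Complex.re e
  simp at h1 h2
  have h3 := h.det_eq'
  rcases h1 with h1 | h1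
  · rw [h1] at h2 h3
    simp at h2
    rw [h2] at h3
    simp at h3
  · exact hz.ne' h1

lemma IsLift.coe_act {M : M2} {γ : AdS} (h : IsLift M γ) (z : ℍ) : ((act γ z : ℍ) : ℂ) =
    (((M 0 0 : ℝ) : ℂ) * z + (M 0 1 : ℝ)) / (((M 1 0 : ℝ) : ℂ) * z + (M 1 1 : ℝ)) := by
  obtain ⟨g, rfl, rfl⟩ := h
  exact coe_smul g z

lemma isOpenQuotientMap_cls : IsOpenQuotientMap cls := QuotientGroup.isOpenQuotientMap_mk

lemma continuous_cls : Continuous cls := isOpenQuotientMap_cls.continuous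

lemma tendsto_of_isLift {α : Type*} {l : Filter α} {f : α → AdS} {M : α → M2} {γ : AdS} {N : M2}
    (hf : ∀ᶠ x in l, IsLift (M x) (f x)) (hγ : IsLift N γ)
    (h : ∀ i j, Tendsto (fun x => M x i j) l (𝓝 (N i j))) : Tendsto f l (𝓝 γ) := by
  classical
  obtain ⟨g, rfl, rfl⟩ := hγ
  let G : α → Matrix.SpecialLinearGroup (Fin 2) ℝ := fun x =>
    if hx : (M x).det = 1 then ⟨M x, hx⟩ else g
  have hG : ∀ᶠ x in l, (G x : M2) = M x := by
    filter_upwards [hf] with x hx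
    have e : G x = ⟨M x, hx.det_eq⟩ := dif_pos hx.det_eq
    rw [e]
  have hG' : Tendsto G l (𝓝 g) := by
    refine Matrix.SpecialLinearGroup.isClosedEmbedding_val.isEmbedding.tendsto_nhds_iff.2 ?_
    refine (tendsto_pi_nhds.2 fun i => tendsto_pi_nhds.2 fun j => h i j).congr' ?_
    filter_upwards [hG] with x hx
    exact hx.symm
  refine ((continuous_cls.tendsto g).comp hG').congr' ?_
  filter_upwards [hf, hG] with x hx hx'
  have h1 := isLift_cls (G x)
  rw [hx'] at h1
  exact h1.unique hx

/-- The product of two entries of a lift. -/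
def entryProd (i j k l : Fin 2) (γ : AdS) : ℝ :=
  Quotient.liftOn γ (fun g : Matrix.SpecialLinearGroup (Fin 2) ℝ => g i j * g k l) fun g h hgh => by
    rcases cls_eq_iff.1 (Quotient.sound hgh : cls g = cls h) with e | e
    · have := fun i j => congrFun (congrFun e i) j
      simp only [this]
    · have := fun i j => congrFun (congrFun e i) j
      simp only [this, Matrix.neg_apply, neg_mul_neg]

lemma IsLift.entryProd_eq {M : M2} {γ : AdS} (h : IsLift M γ) (i j k l : Fin 2) :
    entryProd i j k l γ = M i j * M k l := by
  obtain ⟨g, rfl, rfl⟩ := h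
  rfl

lemma continuous_entryProd (i j k l : Fin 2) : Continuous (entryProd i j k l) := by
  rw [isOpenQuotientMap_cls.isQuotientMap.continuous_iff]
  change Continuous fun g : Matrix.SpecialLinearGroup (Fin 2) ℝ => g i j * g k l
  fun_prop

/-! ### The isometries `σ(w)` -/

lemma zmap_im_pos {w : ℂ} (hw : w ∈ halfStrip) : 0 < (zmap w).im := by
  rw [zmap_im]
  exact mul_pos (Real.exp_pos _) (cos_pos_of_mem hw)

lemma shear_mem {φ : ℝ → ℝ} {w : ℂ} (hw : w ∈ halfStrip) : shear φ w ∈ halfStrip := by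
  rw [mem_halfStrip, shear_im]; exact hw

lemma coe_toH' {w : ℂ} (hw : w ∈ halfStrip) : ((toH w : ℍ) : ℂ) = zmap w :=
  coe_toH hw.1 (by linarith [hw.2, Real.pi_pos])

lemma zmap_ne_zero (w : ℂ) : zmap w ≠ 0 := mul_ne_zero Complex.I_ne_zero (Complex.exp_ne_zero _)

lemma zmap_shear (φ : ℝ → ℝ) (w : ℂ) : zmap w = Complex.exp (φ w.im) * zmap (shear φ w) := by
  rw [zmap, zmap, shear, mul_left_comm, ← Complex.exp_add]
  congr 2
  ring

lemma fderiv_zmap (w : ℂ) : fderiv ℝ zmap w = zmap w • (1 : ℂ →L[ℝ] ℂ) :=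
  ((Complex.hasDerivAt_exp w).const_mul Complex.I).complexToReal_fderiv.fderiv

lemma IsLift.fderiv_act {M : M2} {γ : AdS} (h : IsLift M γ) {z : ℂ} (hz : 0 < z.im) :
    fderiv ℝ (fun z : ℂ => ((act γ (UpperHalfPlane.ofComplex z) : ℍ) : ℂ)) z
      = (1 / (((M 1 0 : ℝ) : ℂ) * z + (M 1 1 : ℝ)) ^ 2) • (1 : ℂ →L[ℝ] ℂ) := by
  have hd := h.denom_ne_zero hz
  have h1 : (fun z : ℂ => ((act γ (UpperHalfPlane.ofComplex z) : ℍ) : ℂ)) =ᶠ[𝓝 z] fun z =>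
      (((M 0 0 : ℝ) : ℂ) * z + (M 0 1 : ℝ)) / (((M 1 0 : ℝ) : ℂ) * z + (M 1 1 : ℝ)) := by
    filter_upwards [(isOpen_lt continuous_const Complex.continuous_im).mem_nhds hz] with x hx
    rw [h.coe_act, UpperHalfPlane.ofComplex_apply_of_im_pos hx]
  rw [h1.fderiv_eq]
  have h2 : ∀ a b : ℝ, HasDerivAt (fun z : ℂ => (a : ℂ) * z + b) (a : ℂ) z := fun a b => by
    simpa using ((hasDerivAt_id z).const_mul (a : ℂ)).add_const (b : ℂ)
  have h3 := ((h2 (M 0 0) (M 0 1)).fun_div (h2 (M 1 0) (M 1 1)) hd).complexToReal_fderiv.fderiv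
  rw [h3]
  congr 2
  have h4 : ((M 0 0 : ℝ) : ℂ) * (M 1 1 : ℝ) - (M 0 1 : ℝ) * (M 1 0 : ℝ) = 1 := by
    exact_mod_cast h.det_eq'
  linear_combination h4

lemma twistTensor_eq (θ r : ℝ) : twistTensor θ r =
    ((cosTwist θ r : ℂ) + sinTwist θ r * Complex.I) • ofMat 1 (-r) 0 1 := by
  ext v
  apply Complex.ext <;> simp [twistTensor] <;> ring

/-- The conditions defining `σ(w)`, in terms of a lift. -/
lemma isSigmaAt_iff {θ : ℝ} (hθ : θ ∈ Ioo 0 Real.pi) {φ : ℝ → ℝ} {w : ℂ} (hw : w ∈ halfStrip)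
    (hφ : DifferentiableAt ℝ φ w.im) {M : M2} {γ : AdS} (h : IsLift M γ) :
    IsSigmaAt (shear φ) (tensor θ φ) w γ ↔
      ((M 0 0 : ℝ) : ℂ) * zmap (shear φ w) + (M 0 1 : ℝ)
        = zmap w * (((M 1 0 : ℝ) : ℂ) * zmap (shear φ w) + (M 1 1 : ℝ)) ∧
      (((M 1 0 : ℝ) : ℂ) * zmap (shear φ w) + (M 1 1 : ℝ)) ^ 2 = -(Complex.exp (-φ w.im) *
        (cosTwist θ (deriv φ w.im) - sinTwist θ (deriv φ w.im) * Complex.I)) := by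
  have hz := zmap_im_pos (shear_mem (φ := φ) hw)
  have hd := h.denom_ne_zero hz
  rw [IsSigmaAt]
  refine and_congr ?_ ?_
  · rw [UpperHalfPlane.ext_iff, h.coe_act, coe_toH' hw, coe_toH' (shear_mem hw),
      div_eq_iff hd]
  · rw [h.fderiv_act hz, fderiv_zmap, fderiv_zmap, fderiv_shear hφ, tensor_eq hθ, twistTensor_eq]
    set j := ((M 1 0 : ℝ) : ℂ) * zmap (shear φ w) + (M 1 1 : ℝ)
    set r := deriv φ w.im
    have hz0 := zmap_ne_zero (shear φ w)
    have hexp := Complex.exp_ne_zero (φ w.im : ℂ)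
    have hcs : ((cosTwist θ r : ℂ) + sinTwist θ r * Complex.I) *
        (cosTwist θ r - sinTwist θ r * Complex.I) = 1 := by
      have : (cosTwist θ r : ℂ) ^ 2 + (sinTwist θ r : ℂ) ^ 2 = 1 := by exact_mod_cast twist_sq θ r
      linear_combination this - (sinTwist θ r : ℂ) ^ 2 * Complex.I_sq
    have e1 : (((1 / j ^ 2) • (1 : ℂ →L[ℝ] ℂ)).comp (zmap (shear φ w) • (1 : ℂ →L[ℝ] ℂ))).comp (ofMat 1 (-r) 0 1)
        = (1 / j ^ 2 * zmap (shear φ w)) • ofMat 1 (-r) 0 1 := by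
      ext v; simp [mul_assoc]
    have e2 : -(zmap w • (1 : ℂ →L[ℝ] ℂ)).comp
        (((cosTwist θ r : ℂ) + sinTwist θ r * Complex.I) • ofMat 1 (-r) 0 1)
        = (-(zmap w * ((cosTwist θ r : ℂ) + sinTwist θ r * Complex.I))) • ofMat 1 (-r) 0 1 := by
      ext v; simp [mul_assoc]
    -- Both sides of the differential condition are complex multiples of dΦ, which sends 1 to 1.
    -- Hence dΦ drops out and a scalar equation for the square of the Möbius denominator remains.
    have e3 : ∀ x y : ℂ, x • ofMat 1 (-r) 0 1 = y • ofMat 1 (-r) 0 1 ↔ x = y := by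
      refine fun x y => ⟨fun e => ?_, fun e => by rw [e]⟩
      have e1 : ofMat 1 (-r) 0 1 1 = 1 := by apply Complex.ext <;> simp
      simpa [e1] using DFunLike.congr_fun e 1
    rw [e1, e2, e3, zmap_shear φ w, Complex.exp_neg]
    generalize (cosTwist θ r : ℂ) + sinTwist θ r * Complex.I = u at hcs ⊢
    generalize (cosTwist θ r : ℂ) - sinTwist θ r * Complex.I = v at hcs ⊢
    generalize Complex.exp (φ w.im : ℂ) = E at hexp ⊢
    generalize zmap (shear φ w) = z₀ at hz0
    clear_value j
    constructor
    · intro e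
      field_simp at e ⊢
      linear_combination v * e - (j ^ 2 * E) * hcs
    · intro e
      field_simp at e ⊢
      linear_combination u * e - hcs

/-- With `sinTwist_slope`, this says e^{iω} = (q - i k sin t)² where q = √(1 - k² sin² t). The
denominator of σ, whose square is -e^{-φ} e^{-iω}, is then ± i e^{-φ/2} (q + i k sin t). -/
lemma cosTwist_slope {θ : ℝ} (hθ : θ ∈ Ioo 0 Real.pi) {t : ℝ} (ht : t ∈ Ioo (-(Real.pi / 2)) 0) :
    cosTwist θ (slope (Real.sin (θ / 2)) t) = 1 - 2 * Real.sin (θ / 2) ^ 2 * Real.sin t ^ 2 := by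
  obtain ⟨hk, hn, hkn⟩ := half_angle hθ
  have hx := cos_pos_of_mem ht
  have hs := sin_neg_of_mem ht
  have hq := radT_arg_pos hn hkn t
  have hr : slope (Real.sin (θ / 2)) t ^ 2 = 4 * Real.sin (θ / 2) ^ 2 * (1 - Real.sin t ^ 2) ^ 2 /
      (Real.sin t ^ 2 * (1 - Real.sin (θ / 2) ^ 2 * Real.sin t ^ 2)) := by
    rw [slope, div_pow, mul_pow, radT_sq hn hkn, ← Real.cos_sq']
    ring
  rw [cosTwist, rad_slope hθ ht, div_eq_iff (by positivity), Real.cos_sq', cos_eq_half θ]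
  have hx2 : 1 - Real.sin t ^ 2 ≠ 0 := by rw [← Real.cos_sq']; positivity
  generalize slope (Real.sin (θ / 2)) t = r at hr ⊢
  generalize Real.sin (θ / 2) = k at *
  generalize Real.sin t = s at *
  have hs0 := hs.ne
  have hq0 := hq.ne'
  trans 4 * (1 - 2 * k ^ 2) + r ^ 2 *
    (1 + (1 - 2 * k ^ 2) - (1 - 2 * k ^ 2) * (1 - s ^ 2)) / (1 - s ^ 2)
  · ring
  rw [hr]
  field_simp
  ring

lemma sinTwist_slope {θ : ℝ} (hθ : θ ∈ Ioo 0 Real.pi) {t : ℝ} (ht : t ∈ Ioo (-(Real.pi / 2)) 0) :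
    sinTwist θ (slope (Real.sin (θ / 2)) t)
      = -2 * Real.sin (θ / 2) * Real.sin t * radT (Real.sin (θ / 2)) t := by
  obtain ⟨hk, hn, hkn⟩ := half_angle hθ
  have hx := cos_pos_of_mem ht
  have hs := (sin_neg_of_mem ht).ne
  have hq := radT_pos hn hkn t
  rw [sinTwist, rad_slope hθ ht, div_eq_iff (by positivity), four_add_slope_sq hn hkn hs, slope]
  have e : Real.cos (θ / 2) ^ 2 = 1 - Real.sin (θ / 2) ^ 2 := by linarith
  rw [e, cos_eq_half θ]
  field_simp
  ring

/-- The surface `σ(ℍ²₊)`, lifted to `SL(2, ℝ)`. -/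
def curveMat (k η u : ℝ) : M2 :=
  !![Real.exp (k * η) / Real.sinh η, -(Real.exp u * Real.cosh η / Real.sinh η);
    Real.exp (-u) * Real.cosh η / Real.sinh η, -(Real.exp (-(k * η)) / Real.sinh η)]

lemma det_curveMat (k u : ℝ) {η : ℝ} (hη : 0 < η) : (curveMat k η u).det = 1 := by
  have h := Real.sinh_pos_iff.2 hη
  rw [curveMat, Matrix.det_fin_two_of, Real.exp_neg, Real.exp_neg]
  field_simp
  linear_combination Real.cosh_sq η

/-- The same lift without η: the entries become algebraic in sin t, cos t, the radical, e^s and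
e^{φ/2}, the form in which the conditions on σ can be checked. -/
lemma curveMat_eta {k n : ℝ} (hn : 0 < n) (hkn : k ^ 2 + n ^ 2 = 1) {t : ℝ}
    (ht : t ∈ Ioo (-(Real.pi / 2)) 0) (s : ℝ) :
    curveMat k (eta n t) (s - profile k n t / 2) =
      !![-(Real.exp (profile k n t / 2) * Real.sin t * (k * Real.cos t + radT k t) / Real.cos t),
        -(Real.exp s / Real.exp (profile k n t / 2) * radT k t / Real.cos t);
        Real.exp (profile k n t / 2) / Real.exp s * radT k t / Real.cos t,
        Real.sin t * (radT k t - k * Real.cos t) / Real.cos t / Real.exp (profile k n t / 2)] := by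
  have hx := cos_pos_of_mem ht
  have hs := sin_neg_of_mem ht
  have hs0 := hs.ne
  have hq := radT_pos hn hkn t
  have h1 := exp_half_profile hn hkn t
  have hE := Real.exp_pos (profile k n t / 2)
  have hS := Real.exp_pos s
  have h2 : Real.exp (k * eta n t) =
      Real.exp (profile k n t / 2) * (k * Real.cos t + radT k t) / n := by
    rw [h1]; field_simp
  have h3 : radT k t ^ 2 - k ^ 2 * Real.cos t ^ 2 = n ^ 2 := by rw [radT_sq' hn hkn]; ring
  have h4 : k * Real.cos t + radT k t ≠ 0 := by
    intro h; rw [h, mul_zero] at h1; have := Real.exp_pos (k * eta n t); nlinarith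
  have h5 : Real.exp (-(k * eta n t)) =
      (radT k t - k * Real.cos t) / n / Real.exp (profile k n t / 2) := by
    rw [Real.exp_neg, h2]
    field_simp
    linear_combination -h3
  rw [curveMat, cosh_eta hn hkn hs, sinh_eta, h5, h2, neg_sub, Real.exp_sub, Real.exp_sub]
  congr 2
  all_goals field_simp

/-- The isometry `σ(w)` in closed form. -/
lemma isSigmaAt_of_isLift {θ : ℝ} (hθ : θ ∈ Ioo 0 Real.pi) {φ : ℝ → ℝ} (hφ : IsProfile θ φ) {w : ℂ}
    (hw : w ∈ halfStrip) {γ : AdS} (h : IsLift (curveMat (Real.sin (θ / 2))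
      (eta (Real.cos (θ / 2)) w.im) (w.re - φ w.im / 2)) γ) :
    IsSigmaAt (shear φ) (tensor θ φ) w γ := by
  obtain ⟨hk, hn, hkn⟩ := half_angle hθ
  have hd := (solvesIntegrated_iff hθ).1 hφ.1 _ hw
  rw [isSigmaAt_iff hθ hw hd.differentiableAt h, hd.deriv, cosTwist_slope hθ hw, sinTwist_slope hθ hw]
  have hx := (cos_pos_of_mem hw).ne'
  have hq := radT_sq hn hkn w.im
  have hxs := Real.sin_sq_add_cos_sq w.im
  have e1 := Real.exp_ne_zero (φ w.im / 2)
  have e2 := Real.exp_ne_zero w.re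
  have hz : zmap (shear φ w) = ((Real.exp w.re / Real.exp (φ w.im / 2) ^ 2 : ℝ) : ℂ) *
      (-(Real.sin w.im : ℝ) + (Real.cos w.im : ℝ) * Complex.I) := by
    have e : Real.exp (w.re - φ w.im) = Real.exp w.re / Real.exp (φ w.im / 2) ^ 2 := by
      rw [Real.exp_sub, ← Real.exp_nat_mul]
      congr 2
      push_cast; ring
    apply Complex.ext
    · rw [zmap_re, shear_im, shear_re, e, Complex.re_ofReal_mul]; simp [-Complex.ofReal_sin, -Complex.ofReal_cos]
    · rw [zmap_im, shear_im, shear_re, e, Complex.im_ofReal_mul]; simp [-Complex.ofReal_sin, -Complex.ofReal_cos]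
  have hz1 : zmap w = ((Real.exp w.re : ℝ) : ℂ) *
      (-(Real.sin w.im : ℝ) + (Real.cos w.im : ℝ) * Complex.I) := by
    apply Complex.ext
    · rw [zmap_re, Complex.re_ofReal_mul]; simp [-Complex.ofReal_sin, -Complex.ofReal_cos]
    · rw [zmap_im, Complex.im_ofReal_mul]; simp [-Complex.ofReal_sin, -Complex.ofReal_cos]
  have hE : Complex.exp (-φ w.im) = ((1 / Real.exp (φ w.im / 2) ^ 2 : ℝ) : ℂ) := by
    rw [← Complex.ofReal_neg, ← Complex.ofReal_exp]
    congr 1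
    rw [← Real.exp_nat_mul, Real.exp_neg, one_div]
    congr 2
    push_cast; ring
  rw [hφ.eqOn hθ hw, curveMat_eta hn hkn hw, ← hφ.eqOn hθ hw, hz, hz1, hE]
  generalize Real.exp (φ w.im / 2) = E at *
  generalize Real.exp w.re = S at *
  generalize radT (Real.sin (θ / 2)) w.im = q at *
  generalize Real.sin (θ / 2) = k at *
  generalize Real.sin w.im = s at *
  generalize Real.cos w.im = x at *
  constructor <;> apply Complex.ext <;>
    simp [sq, -Complex.ofReal_div, -Complex.ofReal_mul, -Complex.ofReal_pow, -Complex.ofReal_inv]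
  all_goals field_simp
  · linear_combination q * hxs
  · ring
  · linear_combination (-x ^ 2) * hq
  · ring

/-- The square of the denominator is prescribed, so the denominator is known up to the sign of the
lift. As Φ(w) is not real, it determines the two real coefficients of the second row; the numerator
is then prescribed and determines the first row. -/
lemma isSigmaAt_unique {θ : ℝ} (hθ : θ ∈ Ioo 0 Real.pi) {φ : ℝ → ℝ} {w : ℂ} (hw : w ∈ halfStrip)
    (hφ : DifferentiableAt ℝ φ w.im) {γ γ' : AdS} (h : IsSigmaAt (shear φ) (tensor θ φ) w γ)
    (h' : IsSigmaAt (shear φ) (tensor θ φ) w γ') : γ = γ' := by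
  obtain ⟨M, hM⟩ := exists_isLift γ
  obtain ⟨N, hN, hMN⟩ : ∃ N, IsLift N γ' ∧ ((N 1 0 : ℝ) : ℂ) * zmap (shear φ w) + (N 1 1 : ℝ) =
      ((M 1 0 : ℝ) : ℂ) * zmap (shear φ w) + (M 1 1 : ℝ) := by
    obtain ⟨N, hN⟩ := exists_isLift γ'
    have e1 := ((isSigmaAt_iff hθ hw hφ hM).1 h).2
    have e2 := ((isSigmaAt_iff hθ hw hφ hN).1 h').2
    rcases sq_eq_sq_iff_eq_or_eq_neg.1 (e2.trans e1.symm) with e | e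
    · exact ⟨N, hN, e⟩
    · refine ⟨-N, hN.neg, ?_⟩
      simp only [Matrix.neg_apply]
      push_cast
      linear_combination -e
  have hz := zmap_im_pos (shear_mem (φ := φ) hw)
  have key : ∀ a b a' b' : ℝ, (a : ℂ) * zmap (shear φ w) + b = a' * zmap (shear φ w) + b' →
      a = a' ∧ b = b' := by
    intro a b a' b' e
    have e1 := congrArg Complex.im e
    have e2 := congrArg Complex.re e
    simp only [Complex.add_im, Complex.add_re, Complex.im_ofReal_mul, Complex.re_ofReal_mul,
      Complex.ofReal_im, Complex.ofReal_re, add_zero] at e1 e2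
    obtain rfl := mul_right_cancel₀ hz.ne' e1
    exact ⟨rfl, add_left_cancel e2⟩
  have e1 := ((isSigmaAt_iff hθ hw hφ hM).1 h).1
  have e2 := ((isSigmaAt_iff hθ hw hφ hN).1 h').1
  rw [hMN, ← e1] at e2
  obtain ⟨h1, h2⟩ := key _ _ _ _ hMN
  obtain ⟨h3, h4⟩ := key _ _ _ _ e2
  have e : N = M := by
    ext i j
    fin_cases i <;> fin_cases j <;> assumption
  rw [e] at hN
  exact hM.unique hN

lemma existsUnique_isSigmaAt {θ : ℝ} (hθ : θ ∈ Ioo 0 Real.pi) {φ : ℝ → ℝ} (hφ : IsProfile θ φ)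
    {w : ℂ} (hw : w ∈ halfStrip) : ∃! γ, IsSigmaAt (shear φ) (tensor θ φ) w γ := by
  obtain ⟨hk, hn, hkn⟩ := half_angle hθ
  obtain ⟨γ, hγ⟩ := exists_isLift_of_det (det_curveMat (Real.sin (θ / 2)) (w.re - φ w.im / 2)
    (eta_pos hn hw))
  exact ⟨γ, isSigmaAt_of_isLift hθ hφ hw hγ, fun γ' h => isSigmaAt_unique hθ hw (hφ.1 _ hw).1 h
    (isSigmaAt_of_isLift hθ hφ hw hγ)⟩

lemma isLift_of_isSigmaAt {θ : ℝ} (hθ : θ ∈ Ioo 0 Real.pi) {φ : ℝ → ℝ} (hφ : IsProfile θ φ)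
    {w : ℂ} (hw : w ∈ halfStrip) {γ : AdS} (h : IsSigmaAt (shear φ) (tensor θ φ) w γ) :
    IsLift (curveMat (Real.sin (θ / 2)) (eta (Real.cos (θ / 2)) w.im) (w.re - φ w.im / 2)) γ := by
  obtain ⟨hk, hn, hkn⟩ := half_angle hθ
  obtain ⟨γ', hγ⟩ := exists_isLift_of_det (det_curveMat (Real.sin (θ / 2)) (w.re - φ w.im / 2)
    (eta_pos hn hw))
  rwa [isSigmaAt_unique hθ hw (hφ.1 _ hw).1 h (isSigmaAt_of_isLift hθ hφ hw hγ)]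

lemma isLift_translation (a : ℝ) :
    IsLift !![Real.exp (a / 2), 0; 0, Real.exp (-(a / 2))] (translation a) :=
  isLift_ofEntries _ _ _ _ _

lemma isLift_conj_translation {k η u : ℝ} {γ : AdS} (h : IsLift (curveMat k η u) γ) (a : ℝ) :
    IsLift (curveMat k η (u + a)) (translation a * γ * (translation a)⁻¹) := by
  have e : curveMat k η (u + a) = !![Real.exp (a / 2), 0; 0, Real.exp (-(a / 2))] *
      curveMat k η u * (!![Real.exp (a / 2), 0; 0, Real.exp (-(a / 2))] : M2).adjugate := by
    have h1 : Real.exp (u + a) = Real.exp u * (Real.exp (a / 2) * Real.exp (a / 2)) := by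
      rw [← Real.exp_add, ← Real.exp_add]; congr 1; ring
    have h2 : Real.exp (-(u + a)) = Real.exp (-u) * (Real.exp (-(a / 2)) * Real.exp (-(a / 2))) := by
      rw [← Real.exp_add, ← Real.exp_add]; congr 1; ring
    have h3 : Real.exp (a / 2) * Real.exp (-(a / 2)) = 1 := by rw [← Real.exp_add]; simp
    rw [curveMat, curveMat, h1, h2, Matrix.adjugate_fin_two_of]
    ext i j
    fin_cases i <;> fin_cases j <;> simp [Matrix.mul_apply, Fin.sum_univ_two]
    · linear_combination (-(Real.exp (k * η) / Real.sinh η)) * h3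
    · ring
    · ring
    · linear_combination (-(Real.exp (-(k * η)) / Real.sinh η)) * h3
  rw [e]
  exact ((isLift_translation a).mul h).mul (isLift_translation a).inv

/-- The surface `σ(ℍ²₊)`. -/
def surf (k : ℝ) : Set AdS := {γ | ∃ η > 0, ∃ u, IsLift (curveMat k η u) γ}

lemma exists_eta_eq {n : ℝ} (hn : 0 < n) {η : ℝ} (hη : 0 < η) :
    ∃ t ∈ Ioo (-(Real.pi / 2)) 0, eta n t = η := by
  have h := Real.sinh_pos_iff.2 hη
  have hz : 0 < n * Real.sinh η := mul_pos hn h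
  have hm := Real.arctan_mem_Ioo (-(n * Real.sinh η)⁻¹)
  refine ⟨Real.arctan (-(n * Real.sinh η)⁻¹), ⟨hm.1, ?_⟩, ?_⟩
  · rw [← Real.arctan_zero]
    exact Real.arctan_strictMono (neg_neg_of_pos (inv_pos.2 hz))
  · rw [← Real.sinh_inj, sinh_eta]
    have e : ∀ t, -(Real.cos t / (n * Real.sin t)) = -((Real.tan t)⁻¹ / n) := fun t => by
      rw [Real.tan_eq_sin_div_cos, inv_div]; field_simp
    rw [e, Real.tan_arctan]
    field_simp

lemma image_eq_surf {θ : ℝ} (hθ : θ ∈ Ioo 0 Real.pi) {φ : ℝ → ℝ} (hφ : IsProfile θ φ)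
    {σ : ℂ → AdS} (hσ : ∀ w ∈ halfStrip, IsSigmaAt (shear φ) (tensor θ φ) w (σ w)) :
    σ '' halfStrip = surf (Real.sin (θ / 2)) := by
  obtain ⟨hk, hn, hkn⟩ := half_angle hθ
  apply Subset.antisymm
  · rintro _ ⟨w, hw, rfl⟩
    exact ⟨_, eta_pos hn hw, _, isLift_of_isSigmaAt hθ hφ hw (hσ w hw)⟩
  · rintro γ ⟨η, hη, u, h⟩
    obtain ⟨t, ht, rfl⟩ := exists_eta_eq hn hη
    have hw : (⟨u + φ t / 2, t⟩ : ℂ) ∈ halfStrip := ht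
    refine ⟨_, hw, ?_⟩
    have := isLift_of_isSigmaAt hθ hφ hw (hσ _ hw)
    simp only [add_sub_cancel_right] at this
    exact this.unique h

/-! ### Smoothness and curvature of `σ` -/

lemma contDiffOn_curveMat {n : ℝ} (hn : 0 < n) (k : ℝ) {φ : ℝ → ℝ}
    (hφ : ContDiffOn ℝ ∞ φ (Ioo (-(Real.pi / 2)) 0)) (i j : Fin 2) :
    ContDiffOn ℝ ∞ (fun w : ℂ => curveMat k (eta n w.im) (w.re - φ w.im / 2) i j) halfStrip := by
  have h1 : ContDiffOn ℝ ∞ (eta n) (Ioo (-(Real.pi / 2)) 0) := by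
    refine Real.contDiff_arsinh.comp_contDiffOn (ContDiffOn.neg (ContDiffOn.div ?_ ?_ fun t ht => ?_))
    · exact Real.contDiff_cos.contDiffOn
    · exact contDiffOn_const.mul Real.contDiff_sin.contDiffOn
    · exact mul_ne_zero hn.ne' (sin_neg_of_mem ht).ne
  have h2 := contDiffOn_comp_im h1
  have h3 : ContDiffOn ℝ ∞ (fun w : ℂ => w.re - φ w.im / 2) halfStrip :=
    Complex.reCLM.contDiff.contDiffOn.sub ((contDiffOn_comp_im hφ).div_const 2)
  have h0 : ∀ w ∈ halfStrip, Real.sinh (eta n w.im) ≠ 0 := fun w hw =>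
    (Real.sinh_pos_iff.2 (eta_pos hn hw)).ne'
  have hs : ContDiffOn ℝ ∞ (fun w : ℂ => Real.sinh (eta n w.im)) halfStrip :=
    Real.contDiff_sinh.comp_contDiffOn h2
  have hc : ContDiffOn ℝ ∞ (fun w : ℂ => Real.cosh (eta n w.im)) halfStrip :=
    Real.contDiff_cosh.comp_contDiffOn h2
  have he : ∀ f : ℂ → ℝ, ContDiffOn ℝ ∞ f halfStrip →
      ContDiffOn ℝ ∞ (fun w => Real.exp (f w)) halfStrip := fun f hf =>
    Real.contDiff_exp.comp_contDiffOn hf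
  fin_cases i <;> fin_cases j <;> simp only [curveMat]
  · exact (he _ (contDiffOn_const.mul h2)).div hs h0
  · exact (((he _ h3).mul hc).div hs h0).neg
  · exact ((he _ h3.neg).mul hc).div hs h0
  · exact ((he _ (contDiffOn_const.mul h2).neg).div hs h0).neg

/-- Each entry of the lift has the form e^{εs} h(t) with ε equal to 0, 1 or -1. -/
lemma pd_exp_mul {f : ℂ → ℝ} {h : ℝ → ℝ} {h' ε : ℝ} {p : ℂ} (hh : HasDerivAt h h' p.im)
    (hf : ∀ x, f x = Real.exp (ε * x.re) * h x.im) :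
    pd 0 f p = ε * f p ∧ pd 1 f p = Real.exp (ε * p.re) * h' := by
  have h1 : HasFDerivAt (fun x : ℂ => Real.exp (ε * x.re))
      (Real.exp (ε * p.re) • (ε • Complex.reCLM)) p :=
    (Complex.reCLM.hasFDerivAt.const_mul ε).exp
  have h2 := hh.hasFDerivAt.comp p Complex.imCLM.hasFDerivAt
  have h3 := (h1.mul h2).fderiv
  have e : f = fun x => Real.exp (ε * x.re) * h x.im := funext hf
  constructor
  · rw [pd, e]
    refine (congrArg (fun L : ℂ →L[ℝ] ℝ => L (frame 0)) h3).trans ?_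
    simp [frame]; ring
  · rw [pd, e]
    refine (congrArg (fun L : ℂ →L[ℝ] ℝ => L (frame 1)) h3).trans ?_
    simp [frame]

lemma adsForm_eq (X Y : M2) : adsForm X Y =
    -(1 / 2) * (X 0 0 * Y 1 1 - X 0 1 * Y 1 0 - X 1 0 * Y 0 1 + X 1 1 * Y 0 0) := by
  rw [adsForm, Matrix.adjugate_fin_two, Matrix.trace_fin_two, Matrix.mul_apply, Matrix.mul_apply]
  simp
  ring

/-- The first fundamental form of `σ`. -/
lemma firstForm_curveMat {k n : ℝ} (hn : 0 < n) (hkn : k ^ 2 + n ^ 2 = 1) {φ : ℝ → ℝ} {p : ℂ}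
    (hp : p ∈ halfStrip) (hφ : HasDerivAt φ (slope k p.im) p.im) :
    firstForm (fun w => curveMat k (eta n w.im) (w.re - φ w.im / 2)) p =
      !![1 + n ^ 2 * Real.tan p.im ^ 2, -(slope k p.im * (1 + n ^ 2 * Real.tan p.im ^ 2) / 2);
        -(slope k p.im * (1 + n ^ 2 * Real.tan p.im ^ 2) / 2),
        n ^ 4 / (Real.cos p.im ^ 4 * (1 + n ^ 2 * Real.tan p.im ^ 2)) +
          slope k p.im ^ 2 * (1 + n ^ 2 * Real.tan p.im ^ 2) / 4] := by
  have hs := sin_neg_of_mem hp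
  have hx := cos_pos_of_mem hp
  have hq := radT_pos hn hkn p.im
  have hsh := Real.sinh_pos_iff.2 (eta_pos hn hp)
  have dη := hasDerivAt_eta hn hkn hs
  have dsh := dη.sinh
  have dK := dη.cosh.fun_div dsh hsh.ne'
  obtain ⟨a0, a1⟩ := pd_exp_mul (ε := 0)
    (f := fun w => curveMat k (eta n w.im) (w.re - φ w.im / 2) 0 0)
    ((dη.const_mul k).exp.fun_div dsh hsh.ne') (fun x => by simp [curveMat])
  obtain ⟨d0, d1⟩ := pd_exp_mul (ε := 0)
    (f := fun w => curveMat k (eta n w.im) (w.re - φ w.im / 2) 1 1)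
    ((dη.const_mul k).fun_neg.exp.fun_div dsh hsh.ne').fun_neg (fun x => by simp [curveMat])
  obtain ⟨b0, b1⟩ := pd_exp_mul (ε := 1)
    (f := fun w => curveMat k (eta n w.im) (w.re - φ w.im / 2) 0 1)
    ((hφ.div_const 2).fun_neg.exp.fun_mul dK).fun_neg (fun x => by
      simp [curveMat, sub_eq_add_neg, Real.exp_add, mul_assoc, mul_div_assoc])
  obtain ⟨c0, c1⟩ := pd_exp_mul (ε := -1)
    (f := fun w => curveMat k (eta n w.im) (w.re - φ w.im / 2) 1 0)
    ((hφ.div_const 2).exp.fun_mul dK) (fun x => by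
      simp [curveMat, sub_eq_add_neg, Real.exp_add, mul_assoc, mul_div_assoc]; ring)
  have hch := cosh_eta hn hkn hs
  have hsh2 := sinh_eta n p.im
  have e2 := radT_sq_eq_sin_cos hn hkn p.im
  have e3 : Real.exp (-p.re) = (Real.exp p.re)⁻¹ := Real.exp_neg _
  have e4 : Real.exp (-(φ p.im / 2)) = (Real.exp (φ p.im / 2))⁻¹ := Real.exp_neg _
  have e5 : Real.exp (-(k * eta n p.im)) = (Real.exp (k * eta n p.im))⁻¹ := Real.exp_neg _
  have e6 : Real.exp (p.re - φ p.im / 2) = Real.exp p.re / Real.exp (φ p.im / 2) := Real.exp_sub _ _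
  have e7 : Real.exp (-(p.re - φ p.im / 2)) = Real.exp (φ p.im / 2) / Real.exp p.re := by
    rw [neg_sub, Real.exp_sub]
  simp only [zero_mul, one_mul, neg_mul, Real.exp_zero, hch, hsh2, e3, e4, e5] at a1 b1 c1 d1
  have p1 := Real.exp_pos p.re
  have p2 := Real.exp_pos (φ p.im / 2)
  have p3 := Real.exp_pos (k * eta n p.im)
  have hP : 1 + n ^ 2 * Real.tan p.im ^ 2 = radT k p.im ^ 2 / Real.cos p.im ^ 2 := by
    rw [e2, Real.tan_eq_sin_div_cos]; field_simp; ring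
  rw [hP, slope]
  have hk2 : k ^ 2 = 1 - n ^ 2 := by linarith
  have hx2 : Real.cos p.im ^ 2 = radT k p.im ^ 2 - n ^ 2 * Real.sin p.im ^ 2 := by linarith
  ext i j
  fin_cases i <;> fin_cases j <;>
    simp only [firstForm, Matrix.of_apply, adsForm_eq, Fin.zero_eta, Fin.mk_one, Fin.isValue,
      Matrix.cons_val', Matrix.cons_val_zero, Matrix.cons_val_one, Matrix.cons_val_fin_one,
      a0, a1, b0, b1, c0, c1, d0, d1, slope] <;>
    (try simp only [curveMat, Matrix.of_apply, Matrix.cons_val', Matrix.cons_val_zero,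
      Matrix.cons_val_one, Matrix.cons_val_fin_one, hch, hsh2, e6, e7]) <;>
    generalize Real.exp p.re = S at * <;>
    generalize Real.exp (φ p.im / 2) = E at * <;>
    generalize Real.exp (k * eta n p.im) = H at * <;>
    generalize radT k p.im = q at * <;>
    generalize Real.sin p.im = s at * <;>
    generalize Real.cos p.im = x at * <;>
    have hs0 := hs.ne <;>
    field_simp
  · ring
  · ring
  · ring
  · linear_combination (8 * s ^ 2 * n ^ 2 - 8 * (q ^ 2 - x ^ 2 + n ^ 2 * s ^ 2)) * e2
      - 8 * s ^ 2 * n ^ 2 * x ^ 2 * hk2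

/-- Completing the square gives P (v₀ - r v₁ / 2)² + h v₁²; for the surface this is the metric
written with du = ds - φ' dt / 2. -/
lemma posDef_of_sq {P r h : ℝ} (hP : 0 < P) (hh : 0 < h) :
    (!![P, -(r * P / 2); -(r * P / 2), h + r ^ 2 * P / 4] : M2).PosDef := by
  refine Matrix.PosDef.of_dotProduct_mulVec_pos ?_ fun v hv => ?_
  · ext i j
    fin_cases i <;> fin_cases j <;> simp
  · have e : star v ⬝ᵥ (!![P, -(r * P / 2); -(r * P / 2), h + r ^ 2 * P / 4] : M2).mulVec v =
        P * (v 0 - r / 2 * v 1) ^ 2 + h * v 1 ^ 2 := by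
      simp [Matrix.mulVec, dotProduct, Fin.sum_univ_two]
      ring
    rw [e]
    rcases eq_or_ne (v 1) 0 with h1 | h1
    · have h0 : v 0 ≠ 0 := fun h0 => hv (by ext i; fin_cases i <;> assumption)
      rw [h1]
      simp only [mul_zero, sub_zero]
      positivity
    · positivity

/-- The metric is P du² + h dt² with P = 1 + n² tan² t and determinant n⁴ / cos⁴ t. The formula for
metrics depending on t only involves P, its derivatives, the determinant and the derivative of the
determinant, so φ' and φ'' disappear from the curvature. -/
lemma isSpacelikeOfCurvature_curveMat {k n : ℝ} (hn : 0 < n) (hkn : k ^ 2 + n ^ 2 = 1)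
    {φ : ℝ → ℝ} (hφ : ContDiffOn ℝ ∞ φ (Ioo (-(Real.pi / 2)) 0))
    (hφ' : ∀ t ∈ Ioo (-(Real.pi / 2)) 0, HasDerivAt φ (slope k t) t) {σ : ℂ → AdS}
    (hσ : ∀ w ∈ halfStrip, IsLift (curveMat k (eta n w.im) (w.re - φ w.im / 2)) (σ w)) :
    IsSpacelikeOfCurvature σ halfStrip (-1 / n ^ 2) := by
  intro w hw
  refine ⟨halfStrip, isOpen_halfStrip, hw, Subset.rfl, _, contDiffOn_curveMat hn k hφ, hσ,
    fun p hp => ?_⟩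
  have hx := cos_pos_of_mem hp
  constructor
  · rw [firstForm_curveMat hn hkn hp (hφ' _ hp)]
    exact posDef_of_sq (by positivity) (by positivity)
  · set P : ℝ → ℝ := fun t => 1 + n ^ 2 * Real.tan t ^ 2 with hPdef
    set P₁ : ℝ → ℝ := fun t => 2 * n ^ 2 * Real.sin t / Real.cos t ^ 3 with hP₁def
    have hnear : ∀ᶠ t in 𝓝 p.im, t ∈ Ioo (-(Real.pi / 2)) 0 := Ioo_mem_nhds hp.1 hp.2
    have dP : ∀ t ∈ Ioo (-(Real.pi / 2)) 0, HasDerivAt P (P₁ t) t := fun t ht => by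
      have hc := (cos_pos_of_mem ht).ne'
      refine ((((Real.hasDerivAt_tan hc).fun_pow 2).const_mul (n ^ 2)).const_add 1).congr_deriv ?_
      simp only [hP₁def, Real.tan_eq_sin_div_cos]
      field_simp
      norm_num
      field_simp
    have dr : ∀ t ∈ Ioo (-(Real.pi / 2)) 0, HasDerivAt (slope k) (deriv (slope k) t) t :=
      fun t ht => (((contDiffOn_slope hn hkn).differentiableOn (by norm_num)).differentiableAt
        (Ioo_mem_nhds ht.1 ht.2)).hasDerivAt
    have dh : ∀ t ∈ Ioo (-(Real.pi / 2)) 0, HasDerivAt (fun t => n ^ 4 / (Real.cos t ^ 4 * P t))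
        (-(n ^ 4 * (4 * Real.cos t ^ 3 * -Real.sin t * P t + Real.cos t ^ 4 * P₁ t)) /
          (Real.cos t ^ 4 * P t) ^ 2) t := fun t ht => by
      have hc := cos_pos_of_mem ht
      have hPt : 0 < P t := by positivity
      refine ((hasDerivAt_const t (n ^ 4)).fun_div
        (((Real.hasDerivAt_cos t).fun_pow 4).fun_mul (dP t ht)) (by positivity)).congr_deriv ?_
      simp
    have dP₁ : HasDerivAt P₁ (2 * n ^ 2 * (Real.cos p.im ^ 2 + 3 * Real.sin p.im ^ 2) /
        Real.cos p.im ^ 4) p.im := by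
      refine (((Real.hasDerivAt_sin p.im).const_mul (2 * n ^ 2)).fun_div
        ((Real.hasDerivAt_cos p.im).fun_pow 3) (by positivity)).congr_deriv ?_
      field_simp
      norm_num
      ring
    have hPp : 0 < P p.im := by positivity
    rw [gaussCurvature_of_im (P := P) (Q := fun t => -(slope k t * P t / 2))
      (R := fun t => n ^ 4 / (Real.cos t ^ 4 * P t) + slope k t ^ 2 * P t / 4) (P₁ := P₁)
      (Q₁ := fun t => -((deriv (slope k) t * P t + slope k t * P₁ t) / 2))
      (R₁ := fun t => -(n ^ 4 * (4 * Real.cos t ^ 3 * -Real.sin t * P t + Real.cos t ^ 4 * P₁ t)) /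
          (Real.cos t ^ 4 * P t) ^ 2 + (2 * slope k t * deriv (slope k) t * P t +
          slope k t ^ 2 * P₁ t) / 4) (Δ := n ^ 4 / Real.cos p.im ^ 4) ?_ ?_ ?_ ?_ dP₁ ?_ ?_]
    · have hs2 := Real.sin_sq_add_cos_sq p.im
      trans -(2 * n ^ 2 * (Real.cos p.im ^ 2 + 3 * Real.sin p.im ^ 2) / Real.cos p.im ^ 4) /
          (2 * (n ^ 4 / Real.cos p.im ^ 4)) + P₁ p.im * (4 * n ^ 4 * Real.sin p.im / Real.cos p.im ^ 5) /
          (4 * (n ^ 4 / Real.cos p.im ^ 4) ^ 2)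
      · congr 3
        generalize P p.im = A at *
        generalize P₁ p.im = B
        field_simp
        ring
      · simp only [hP₁def]
        field_simp
        linear_combination (-1) * hs2
    · filter_upwards [isOpen_halfStrip.mem_nhds hp] with x hx
      exact firstForm_curveMat hn hkn hx (hφ' _ hx)
    · filter_upwards [hnear] with t ht using dP t ht
    · filter_upwards [hnear] with t ht using (((dr t ht).fun_mul (dP t ht)).div_const 2).fun_neg
    · filter_upwards [hnear] with t ht
      refine ((dh t ht).fun_add ((((dr t ht).fun_pow 2).fun_mul (dP t ht)).div_const 4)).congr_deriv ?_
      simp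
    · field_simp
      ring
    · positivity

/-! ### `σ` is an embedding -/

/-- A left inverse, continuous at the points of the image, is built from products of two entries,
which do not depend on the lift. Minus the product of the diagonal entries is 1 / sinh² η = n² tan²
t and gives t; the ratio of the off-diagonal entries is -e^{2u} and gives u = s - φ/2. -/
lemma isEmbedding_of_isLift {k n : ℝ} (hn : 0 < n) {φ : ℝ → ℝ}
    (hφ : ContDiffOn ℝ ∞ φ (Ioo (-(Real.pi / 2)) 0)) {σ : ℂ → AdS}
    (hσ : ∀ w ∈ halfStrip, IsLift (curveMat k (eta n w.im) (w.re - φ w.im / 2)) (σ w)) :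
    IsEmbedding (fun w : halfStrip => σ w) := by
  let T : AdS → ℝ := fun γ => -Real.arctan (√(-entryProd 0 0 1 1 γ) / n)
  let U : AdS → ℝ := fun γ => Real.log (-entryProd 0 1 1 0 γ / entryProd 1 0 1 0 γ) / 2
  let L : AdS → ℂ := fun γ => ((U γ + φ (T γ) / 2 : ℝ) : ℂ) + (T γ : ℂ) * Complex.I
  have hsh : ∀ w ∈ halfStrip, 0 < Real.sinh (eta n w.im) := fun w hw =>
    Real.sinh_pos_iff.2 (eta_pos hn hw)
  have hT : ∀ w ∈ halfStrip, T (σ w) = w.im := by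
    intro w hw
    have hs := hsh w hw
    have e : √(-entryProd 0 0 1 1 (σ w)) = -(n * Real.tan w.im) := by
      rw [(hσ w hw).entryProd_eq]
      have ht : n * Real.tan w.im ≤ 0 := by
        rw [Real.tan_eq_sin_div_cos]
        exact mul_nonpos_of_nonneg_of_nonpos hn.le (div_nonpos_of_nonpos_of_nonneg
          (sin_neg_of_mem hw).le (cos_pos_of_mem hw).le)
      rw [← Real.sqrt_sq (neg_nonneg.2 ht)]
      congr 1
      have hc := cos_pos_of_mem hw
      have hs' := (sin_neg_of_mem hw).ne
      simp only [curveMat, Matrix.of_apply, Matrix.cons_val', Matrix.cons_val_zero,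
        Matrix.cons_val_one, Matrix.cons_val_fin_one, Real.exp_neg, sinh_eta,
        Real.tan_eq_sin_div_cos]
      field_simp
    simp only [T, e]
    rw [neg_div, mul_div_cancel_left₀ _ hn.ne', Real.arctan_neg, neg_neg,
      Real.arctan_tan hw.1 (by linarith [hw.2, Real.pi_pos])]
  have hpos : ∀ w ∈ halfStrip, 0 < entryProd 1 0 1 0 (σ w) ∧ -entryProd 0 1 1 0 (σ w) /
      entryProd 1 0 1 0 (σ w) = Real.exp (2 * (w.re - φ w.im / 2)) := by
    intro w hw
    have hs := hsh w hw
    have hc := Real.cosh_pos (eta n w.im)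
    rw [(hσ w hw).entryProd_eq, (hσ w hw).entryProd_eq]
    have e : Real.exp (2 * (w.re - φ w.im / 2)) = Real.exp (w.re - φ w.im / 2) ^ 2 := by
      rw [← Real.exp_nat_mul]; norm_num
    simp only [curveMat, Matrix.of_apply, Matrix.cons_val', Matrix.cons_val_zero,
        Matrix.cons_val_one, Matrix.cons_val_fin_one, e, Real.exp_neg]
    constructor
    · positivity
    · field_simp
  have hL : ∀ w ∈ halfStrip, L (σ w) = w := by
    intro w hw
    have hU : U (σ w) = w.re - φ w.im / 2 := by
      simp only [U, (hpos w hw).2, Real.log_exp]; ring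
    simp only [L, hU, hT w hw, sub_add_cancel]
    exact Complex.re_add_im w
  have hLc : ∀ w ∈ halfStrip, ContinuousAt L (σ w) := by
    intro w hw
    have hTc : ContinuousAt T (σ w) :=
      (Real.continuous_arctan.comp ((Real.continuous_sqrt.comp
        (continuous_entryProd 0 0 1 1).neg).div_const n)).neg.continuousAt
    have hUc : ContinuousAt U (σ w) := by
      refine (ContinuousAt.log ((continuous_entryProd 0 1 1 0).neg.continuousAt.div
        (continuous_entryProd 1 0 1 0).continuousAt (hpos w hw).1.ne') ?_).div_const 2
      rw [Pi.div_apply, Pi.neg_apply, (hpos w hw).2]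
      exact (Real.exp_pos _).ne'
    have hφc : ContinuousAt φ (T (σ w)) := by
      rw [hT w hw]
      exact hφ.continuousOn.continuousAt (Ioo_mem_nhds hw.1 hw.2)
    have h1 := hUc.add ((ContinuousAt.comp (f := T) (g := φ) hφc hTc).div_const 2)
    exact (Complex.continuous_ofReal.continuousAt.comp h1).add
      ((Complex.continuous_ofReal.continuousAt.comp hTc).mul continuousAt_const)
  have hinj : Function.Injective (fun w : halfStrip => σ w) := fun w w' h => by
    apply Subtype.ext
    rw [← hL w w.2, ← hL w' w'.2]
    exact congrArg L h
  refine ⟨isInducing_iff_nhds.2 fun w => le_antisymm ?_ ?_, hinj⟩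
  · refine map_le_iff_le_comap.1 ?_
    refine tendsto_of_isLift (M := fun x : halfStrip => curveMat k (eta n x.1.im)
      (x.1.re - φ x.1.im / 2)) (Eventually.of_forall fun x => hσ x x.2) (hσ w w.2) fun i j => ?_
    exact (continuousOn_iff_continuous_domRestrict.1
      (contDiffOn_curveMat hn k hφ i j).continuousOn).tendsto w
  · rw [nhds_subtype, ← map_le_iff_le_comap]
    have h : Tendsto (L ∘ fun w : halfStrip => σ w) (comap (fun w : halfStrip => σ w) (𝓝 (σ w)))
        (𝓝 (L (σ w))) := (hLc w w.2).tendsto.comp tendsto_comap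
    rw [hL w w.2] at h
    exact h.congr fun x => hL x x.2

/-! ### Limits of isometries -/

/-- The image of the singular matrix `N` is the line `p`. -/
def IdealImage (N : M2) (p : OnePoint ℝ) : Prop :=
  (p = OnePoint.infty ∧ N 1 0 = 0 ∧ N 1 1 = 0) ∨
    ∃ x : ℝ, p = x ∧ (N 1 0 ≠ 0 ∨ N 1 1 ≠ 0) ∧ N 0 0 = x * N 1 0 ∧ N 0 1 = x * N 1 1

lemma exists_idealImage {N : M2} (h : N.det = 0) : ∃ p, IdealImage N p := by
  rw [Matrix.det_fin_two] at h
  by_cases h0 : N 1 0 = 0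
  · by_cases h1 : N 1 1 = 0
    · exact ⟨_, Or.inl ⟨rfl, h0, h1⟩⟩
    · refine ⟨_, Or.inr ⟨N 0 1 / N 1 1, rfl, Or.inr h1, ?_, by field_simp⟩⟩
      rw [h0, mul_zero, sub_zero] at h
      rw [h0, mul_zero]
      exact (mul_eq_zero.1 h).resolve_right h1
  · refine ⟨_, Or.inr ⟨N 0 0 / N 1 0, rfl, Or.inl h0, by field_simp, ?_⟩⟩
    field_simp
    linarith

lemma denom_ne_zero_of_ne {a b : ℝ} (h : a ≠ 0 ∨ b ≠ 0) (x : ℍ) : (a : ℂ) * x + b ≠ 0 := by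
  intro e
  have h1 := congrArg Complex.im e
  have h2 := congrArg Complex.re e
  simp at h1 h2
  rcases h1 with rfl | h1
  · simp at h2
    exact h.elim (fun h => h rfl) fun h => h h2
  · exact x.im_pos.ne' h1

lemma tendsto_linear {α : Type*} {l : Filter α} {f g : α → ℝ} {a b : ℝ} (hf : Tendsto f l (𝓝 a))
    (hg : Tendsto g l (𝓝 b)) (x : ℂ) :
    Tendsto (fun n => (f n : ℂ) * x + g n) l (𝓝 ((a : ℂ) * x + b)) :=
  (((Complex.continuous_ofReal.tendsto a).comp hf).mul_const x).add
    ((Complex.continuous_ofReal.tendsto b).comp hg)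

lemma IsLift.coe_act_smul {M : M2} {γ : AdS} (h : IsLift M γ) {r : ℝ} (hr : r ≠ 0) (x : ℍ) :
    ((act γ x : ℍ) : ℂ) = (((r * M 0 0 : ℝ) : ℂ) * x + (r * M 0 1 : ℝ)) /
      (((r * M 1 0 : ℝ) : ℂ) * x + (r * M 1 1 : ℝ)) := by
  have hr' : (r : ℂ) ≠ 0 := by exact_mod_cast hr
  rw [h.coe_act, ← mul_div_mul_left _ _ hr']
  push_cast
  congr 1 <;> ring

/-- Convergence of isometries to a matrix, up to scaling. -/
def ScaledLimit {α : Type*} (l : Filter α) (γ : α → AdS) (N : M2) : Prop :=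
  ∃ (M : α → M2) (r : α → ℝ), (∀ᶠ n in l, IsLift (M n) (γ n) ∧ r n ≠ 0) ∧
    ∀ i j, Tendsto (fun n => r n * M n i j) l (𝓝 (N i j))

/-- In determinant one the inverse is the adjugate, which is linear in the entries and so commutes
with scaled limits. -/
lemma ScaledLimit.inv {α : Type*} {l : Filter α} {γ : α → AdS} {N : M2} (h : ScaledLimit l γ N) :
    ScaledLimit l (fun n => (γ n)⁻¹) N.adjugate := by
  obtain ⟨M, r, h1, h2⟩ := h
  refine ⟨fun n => (M n).adjugate, r, h1.mono fun n hn => ⟨hn.1.inv, hn.2⟩, fun i j => ?_⟩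
  simp only [Matrix.adjugate_fin_two]
  fin_cases i <;> fin_cases j <;> simp only [Fin.zero_eta, Fin.mk_one, Fin.isValue,
    Matrix.of_apply, Matrix.cons_val', Matrix.cons_val_zero, Matrix.cons_val_one,
    Matrix.cons_val_fin_one, mul_neg]
  · exact h2 1 1
  · exact (h2 0 1).neg
  · exact (h2 1 0).neg
  · exact h2 0 0

lemma ScaledLimit.tendsto_act {α : Type*} {l : Filter α} {γ : α → AdS} {N : M2}
    (h : ScaledLimit l γ N) (hN : N 1 0 ≠ 0 ∨ N 1 1 ≠ 0) (x : ℍ) :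
    Tendsto (fun n => ((act (γ n) x : ℍ) : ℂ)) l
      (𝓝 ((((N 0 0 : ℝ) : ℂ) * x + (N 0 1 : ℝ)) / (((N 1 0 : ℝ) : ℂ) * x + (N 1 1 : ℝ)))) := by
  obtain ⟨M, r, h1, h2⟩ := h
  refine ((tendsto_linear (h2 0 0) (h2 0 1) x).div (tendsto_linear (h2 1 0) (h2 1 1) x)
    (denom_ne_zero_of_ne hN x)).congr' (h1.mono fun n hn => (hn.1.coe_act_smul hn.2 x).symm)

lemma ScaledLimit.tendsto_act_ofReal {α : Type*} {l : Filter α} {γ : α → AdS} {N : M2}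
    (h : ScaledLimit l γ N) (hN : N 1 0 ≠ 0 ∨ N 1 1 ≠ 0) {p : ℝ} (h0 : N 0 0 = p * N 1 0)
    (h1 : N 0 1 = p * N 1 1) (x : ℍ) :
    Tendsto (fun n => ((act (γ n) x : ℍ) : ℂ)) l (𝓝 (p : ℂ)) := by
  have e := h.tendsto_act hN x
  rwa [h0, h1, show (((p * N 1 0 : ℝ) : ℂ) * x + (p * N 1 1 : ℝ)) =
    (p : ℂ) * (((N 1 0 : ℝ) : ℂ) * x + (N 1 1 : ℝ)) by push_cast; ring,
    mul_div_cancel_right₀ _ (denom_ne_zero_of_ne hN x)] at e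

/-- A nonzero matrix whose image is a real line sends (x, 1), with x not real, to a nonzero vector
of that line. The limit is therefore the same ideal point for every base point x. At infinity, the
reciprocals are shown to tend to zero through nonzero values. -/
lemma ScaledLimit.tendsto_act_idealPt {α : Type*} {l : Filter α} {γ : α → AdS} {N : M2}
    (h : ScaledLimit l γ N) (hN : N ≠ 0) {p : OnePoint ℝ} (hp : IdealImage N p) (x : ℍ) :
    Tendsto (fun n => (((act (γ n) x : ℍ) : ℂ) : OnePoint ℂ)) l (𝓝 (idealPt p)) := by
  rcases hp with ⟨rfl, h0, h1⟩ | ⟨y, rfl, hy, h0, h1⟩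
  · obtain ⟨M, r, h2, h3⟩ := h
    have hN' : N 0 0 ≠ 0 ∨ N 0 1 ≠ 0 := by
      by_contra! hc
      exact hN (by ext i j; fin_cases i <;> fin_cases j <;> simp [hc.1, hc.2, h0, h1])
    have hc : Tendsto (fun n => ((act (γ n) x : ℍ) : ℂ)) l (Bornology.cobounded ℂ) := by
      have h4 := (tendsto_linear (h3 1 0) (h3 1 1) x).div (tendsto_linear (h3 0 0) (h3 0 1) x)
        (denom_ne_zero_of_ne hN' x)
      rw [h0, h1] at h4
      simp only [Complex.ofReal_zero, zero_mul, add_zero, zero_div] at h4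
      have h6 := (tendsto_linear (h3 0 0) (h3 0 1) x).eventually_ne (denom_ne_zero_of_ne hN' x)
      have h5 := tendsto_nhdsWithin_of_tendsto_nhds_of_eventually_within (s := {0}ᶜ) _ h4 <| by
        filter_upwards [h2, h6] with n hn h6
        refine div_ne_zero ?_ h6
        have := hn.1.denom_ne_zero x.im_pos
        have hr : (r n : ℂ) ≠ 0 := by exact_mod_cast hn.2
        have e := mul_ne_zero hr this
        push_cast
        rwa [mul_assoc, ← mul_add]
      refine (Filter.tendsto_inv₀_nhdsNE_zero.comp h5).congr' (h2.mono fun n hn => ?_)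
      refine Eq.trans ?_ (hn.1.coe_act_smul hn.2 x).symm
      exact inv_div _ _
    rw [Metric.cobounded_eq_cocompact, ← Filter.coclosedCompact_eq_cocompact] at hc
    exact OnePoint.tendsto_coe_infty.comp hc
  · exact (OnePoint.continuous_coe.tendsto _).comp (h.tendsto_act_ofReal hy h0 h1 x)

lemma adjugate_ne_zero {N : M2} (hN : N ≠ 0) : N.adjugate ≠ 0 := fun e => hN (by
  have h := Matrix.adjugate_adjugate' N
  rw [e] at h
  simpa using h.symm)

lemma ScaledLimit.tendstoIdeal {γ : ℕ → AdS} {N : M2} (h : ScaledLimit atTop γ N) (hN : N ≠ 0)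
    {p q : OnePoint ℝ} (hp : IdealImage N p) (hq : IdealImage N.adjugate q) :
    TendstoIdeal γ p q := by
  have hN' := adjugate_ne_zero hN
  exact ⟨UpperHalfPlane.I, h.tendsto_act_idealPt hN hp _, h.inv.tendsto_act_idealPt hN' hq _⟩

lemma idealPt_injective : Function.Injective idealPt :=
  Option.map_injective Complex.ofReal_injective

lemma idealPt_ne_coe (p : OnePoint ℝ) {z : ℂ} (hz : 0 < z.im) : idealPt p ≠ (z : OnePoint ℂ) := by
  induction p using OnePoint.rec with
  | infty => exact OnePoint.infty_ne_coe z
  | coe x =>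
    intro e
    have : (x : ℂ) = z := OnePoint.coe_injective e
    rw [← this] at hz
    simp at hz

/-- A sequence of isometries converging to an ideal point subconverges, up to scaling, to a
singular matrix. -/
lemma TendstoIdeal.exists_scaledLimit {γ : ℕ → AdS} {p q : OnePoint ℝ} (h : TendstoIdeal γ p q)
    {M : ℕ → M2} (hM : ∀ n, IsLift (M n) (γ n)) : ∃ (ψ : ℕ → ℕ) (r : ℕ → ℝ) (N : M2),
      N ≠ 0 ∧ N.det = 0 ∧ IdealImage N p ∧ IdealImage N.adjugate q ∧ (∀ n, 0 < r n) ∧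
      Tendsto r atTop (𝓝 0) ∧ ∀ i j, Tendsto (fun n => r n * M (ψ n) i j) atTop (𝓝 (N i j)) := by
  obtain ⟨x, hp, hq⟩ := h
  let f : ℕ → Fin 2 → Fin 2 → ℝ := fun n i j => M n i j
  have hf : ∀ n, f n ≠ 0 := fun n e => by
    have := (hM n).det_eq'
    have e' : ∀ i j, M n i j = 0 := fun i j => congrFun (congrFun e i) j
    simp [e'] at this
  -- Lifts divided by their norms lie on the unit sphere, which is compact, and so subconverge to a
  -- nonzero matrix.
  obtain ⟨N, hN, ψ, hψ, hlim⟩ := (isCompact_sphere (0 : Fin 2 → Fin 2 → ℝ) 1).tendsto_subseq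
    (x := fun n => ‖f n‖⁻¹ • f n) fun n => by
      rw [mem_sphere_zero_iff_norm, norm_smul, norm_inv, norm_norm,
        inv_mul_cancel₀ (norm_ne_zero_iff.2 (hf n))]
  have hlim' : ∀ i j, Tendsto (fun n => ‖f (ψ n)‖⁻¹ * M (ψ n) i j) atTop (𝓝 (N i j)) :=
    fun i j => tendsto_pi_nhds.1 (tendsto_pi_nhds.1 hlim i) j
  have hr : ∀ n, 0 < ‖f (ψ n)‖⁻¹ := fun n => inv_pos.2 (norm_pos_iff.2 (hf _))
  let N' : M2 := Matrix.of N
  have hN0 : N' ≠ 0 := fun e => by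
    have : N = 0 := by ext i j; exact congrFun (congrFun e i) j
    rw [this] at hN
    simp at hN
  have hS : ScaledLimit atTop (fun n => γ (ψ n)) N' :=
    ⟨fun n => M (ψ n), _, Eventually.of_forall fun n => ⟨hM _, (hr n).ne'⟩, hlim'⟩
  have hdet : Tendsto (fun n => ‖f (ψ n)‖⁻¹ ^ 2) atTop (𝓝 N'.det) := by
    rw [Matrix.det_fin_two]
    refine (((hlim' 0 0).mul (hlim' 1 1)).sub ((hlim' 0 1).mul (hlim' 1 0))).congr fun n => ?_
    linear_combination (‖f (ψ n)‖⁻¹ ^ 2) * (hM (ψ n)).det_eq'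
  -- The determinant of the limit is the limit of the squared scaling factors, hence non-negative.
  -- If it were positive, the orbit of x would converge to a point of the upper half-plane instead
  -- of an ideal point. Its vanishing also forces the scaling factors to tend to zero.
  have hdet0 : N'.det = 0 := by
    by_contra hd
    have hd' : 0 < N'.det := lt_of_le_of_ne
      (ge_of_tendsto' hdet fun n => by positivity) (Ne.symm hd)
    have h10 : N' 1 0 ≠ 0 ∨ N' 1 1 ≠ 0 := by
      by_contra! hc
      rw [Matrix.det_fin_two, hc.1, hc.2] at hd
      simp at hd
    have h1 := (OnePoint.continuous_coe.tendsto _).comp (hS.tendsto_act h10 x)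
    refine idealPt_ne_coe p ?_ (tendsto_nhds_unique (hp.comp hψ.tendsto_atTop) h1)
    have hz := Complex.normSq_pos.2 (denom_ne_zero_of_ne h10 x)
    rw [Complex.div_im, ← sub_div]
    refine div_pos ?_ hz
    have e := mul_pos hd' x.im_pos
    rw [Matrix.det_fin_two] at e
    simp
    linarith
  refine ⟨ψ, fun n => ‖f (ψ n)‖⁻¹, N', hN0, hdet0, ?_, ?_, hr, ?_, hlim'⟩
  · obtain ⟨p', hp'⟩ := exists_idealImage hdet0
    have := tendsto_nhds_unique (hp.comp hψ.tendsto_atTop) (hS.tendsto_act_idealPt hN0 hp' x)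
    rwa [idealPt_injective this]
  · obtain ⟨q', hq'⟩ := exists_idealImage (N := N'.adjugate) (by
      rw [Matrix.det_adjugate, hdet0]; simp)
    have hN0' := adjugate_ne_zero hN0
    have := tendsto_nhds_unique (hq.comp hψ.tendsto_atTop) (hS.inv.tendsto_act_idealPt hN0' hq' x)
    rwa [idealPt_injective this]
  · rw [hdet0] at hdet
    have := hdet.sqrt
    simpa [Real.sqrt_sq (norm_nonneg _)] using this

/-! ### Ideal boundaries -/

lemma idealBoundary_union (S T : Set AdS) :
    idealBoundary (S ∪ T) = idealBoundary S ∪ idealBoundary T := by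
  apply Subset.antisymm
  · rintro x ⟨γ, hγ, y, hp, hq⟩
    have key : ∀ R : Set AdS, (∃ᶠ n in atTop, γ n ∈ R) → x ∈ idealBoundary R := fun R hR => by
      obtain ⟨ψ, hψ, h⟩ := extraction_of_frequently_atTop hR
      exact ⟨fun n => γ (ψ n), h, y, hp.comp hψ.tendsto_atTop, hq.comp hψ.tendsto_atTop⟩
    by_cases h : ∃ᶠ n in atTop, γ n ∈ S
    · exact Or.inl (key S h)
    · refine Or.inr (key T (Eventually.frequently ?_))
      filter_upwards [not_frequently.1 h] with n hn using (hγ n).resolve_left hn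
  · rintro x (⟨γ, hγ, h⟩ | ⟨γ, hγ, h⟩)
    · exact ⟨γ, fun n => Or.inl (hγ n), h⟩
    · exact ⟨γ, fun n => Or.inr (hγ n), h⟩

/-- Trace and determinant zero give adj N = -N, so N and its adjugate have the same image; its slope
is N₀₀ / N₁₀, or infinity, and the signs place it in [0, ∞]. -/
lemma mem_posArc_of_nilpotent {N : M2} (h0 : N.det = 0) (htr : N 1 1 = -N 0 0)
    (h00 : 0 ≤ N 0 0) (h10 : 0 ≤ N 1 0) {p q : OnePoint ℝ} (hp : IdealImage N p)
    (hq : IdealImage N.adjugate q) : p ∈ posArc ∧ q = p := by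
  have e : N.adjugate = -N := by
    rw [Matrix.adjugate_fin_two]
    ext i j
    fin_cases i <;> fin_cases j <;> simp [htr]
  rw [e] at hq
  rw [Matrix.det_fin_two, htr] at h0
  simp only [IdealImage, Matrix.neg_apply, neg_eq_zero, htr] at hp hq
  have hne : N 1 0 = 0 → N 0 0 = 0 := fun h => by rw [h] at h0; nlinarith
  rcases hp with ⟨rfl, h1, h2⟩ | ⟨x, rfl, h1, h2, h3⟩
  · refine ⟨mem_insert _ _, ?_⟩
    rcases hq with ⟨rfl, -, -⟩ | ⟨y, rfl, hy, -, -⟩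
    · rfl
    · simp [h1, h2] at hy
  · have h4 : N 1 0 ≠ 0 := fun h => by simp [h, hne h] at h1
    have h5 : 0 < N 1 0 := lt_of_le_of_ne h10 (Ne.symm h4)
    have hx : 0 ≤ x := by
      by_contra! hx
      nlinarith [mul_pos (neg_pos.2 hx) h5]
    refine ⟨Or.inr ⟨x, hx, rfl⟩, ?_⟩
    rcases hq with ⟨rfl, h, -⟩ | ⟨y, rfl, hy, h6, h7⟩
    · exact absurd h h4
    · congr 1
      have : y * N 1 0 = x * N 1 0 := by linarith
      exact mul_right_cancel₀ h4 this

/-- A set of isometries with lifts `(a, -b; c, -d)`, where `a, c ≥ 0` and `a - d` is bounded. -/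
lemma idealBoundary_subset_diagonal {S : Set AdS} {B : ℝ} (hS : ∀ γ ∈ S, ∃ M, IsLift M γ ∧
    0 ≤ M 0 0 ∧ 0 ≤ M 1 0 ∧ |M 0 0 + M 1 1| ≤ B) :
    idealBoundary S ⊆ (fun p => (p, p)) '' posArc := by
  rintro ⟨p, q⟩ ⟨γ, hγ, h⟩
  choose M hM h00 h10 hB using fun n => hS _ (hγ n)
  obtain ⟨ψ, r, N, hN, hdet, hp, hq, hr, hr0, hlim⟩ := h.exists_scaledLimit hM
  have htr : N 0 0 + N 1 1 = 0 := by
    refine tendsto_nhds_unique ((hlim 0 0).add (hlim 1 1)) ?_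
    have h1 : Tendsto (fun n => r n * B) atTop (𝓝 0) := by simpa using hr0.mul_const B
    refine squeeze_zero_norm (fun n => ?_) h1
    rw [← mul_add, norm_mul, Real.norm_of_nonneg (hr n).le, Real.norm_eq_abs]
    exact mul_le_mul_of_nonneg_left (hB _) (hr n).le
  obtain ⟨h1, h2⟩ := mem_posArc_of_nilpotent hdet (by linarith)
    (ge_of_tendsto' (hlim 0 0) fun n => mul_nonneg (hr n).le (h00 _))
    (ge_of_tendsto' (hlim 1 0) fun n => mul_nonneg (hr n).le (h10 _)) hp hq
  exact ⟨p, h1, Prod.ext rfl h2.symm⟩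

lemma mem_idealBoundary {S : Set AdS} {γ : ℕ → AdS} (hγ : ∀ n, γ n ∈ S) {M : ℕ → M2} {r : ℕ → ℝ}
    (hM : ∀ n, IsLift (M n) (γ n) ∧ r n ≠ 0) {a b c d : ℝ}
    (h00 : Tendsto (fun n => r n * M n 0 0) atTop (𝓝 a))
    (h01 : Tendsto (fun n => r n * M n 0 1) atTop (𝓝 b))
    (h10 : Tendsto (fun n => r n * M n 1 0) atTop (𝓝 c))
    (h11 : Tendsto (fun n => r n * M n 1 1) atTop (𝓝 d)) (hN : !![a, b; c, d] ≠ (0 : M2))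
    {p q : OnePoint ℝ} (hp : IdealImage !![a, b; c, d] p)
    (hq : IdealImage (!![a, b; c, d] : M2).adjugate q) : (p, q) ∈ idealBoundary S := by
  refine ⟨γ, hγ, ScaledLimit.tendstoIdeal ⟨M, r, Eventually.of_forall hM, fun i j => ?_⟩ hN hp hq⟩
  fin_cases i <;> fin_cases j <;> assumption

lemma isLift_halfTurn (z : ℍ) : IsLift !![z.re / z.im, -(z.re ^ 2 + z.im ^ 2) / z.im;
    1 / z.im, -z.re / z.im] (halfTurn z) := isLift_ofEntries _ _ _ _ _

/-- The explicit sequences below have entries that are continuous functions of ε = 1/(n+1) after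
rescaling; their limits are the values at ε = 0. -/
lemma tendsto_of_eq_comp {f : ℕ → ℝ} {g : ℝ → ℝ} {a : ℝ} (hg : Continuous g)
    (h : ∀ n : ℕ, f n = g (1 / ((n : ℝ) + 1))) (ha : g 0 = a) : Tendsto f atTop (𝓝 a) := by
  rw [← ha]
  exact ((hg.tendsto 0).comp tendsto_one_div_add_atTop_nhds_zero_nat).congr fun n => (h n).symm

lemma idealBoundary_halfPlane : idealBoundary halfPlane = (fun p => (p, p)) '' posArc := by
  apply Subset.antisymm
  · refine idealBoundary_subset_diagonal (B := 0) ?_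
    rintro _ ⟨z, hz, rfl⟩
    have hz : 0 < z.re := hz
    have hi := z.im_pos
    refine ⟨_, isLift_halfTurn z, ?_, ?_, ?_⟩
    · simp; positivity
    · simp; positivity
    · simp; ring
  · rintro _ ⟨p, rfl | ⟨x, hx, rfl⟩, rfl⟩
    -- Infinity is approached vertically along Re z = 1, and below a finite point x ≥ 0 along x + ε
    -- + iε; the shift in the real part keeps the centre in the open half-plane even when x = 0.
    · let z : ℕ → ℍ := fun n => ⟨⟨1, (n : ℝ) + 1⟩, by positivity⟩
      have hre : ∀ n, (z n).re = 1 := fun n => rfl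
      have him : ∀ n, (z n).im = (n : ℝ) + 1 := fun n => rfl
      refine mem_idealBoundary (S := halfPlane) (γ := fun n => halfTurn (z n))
        (r := fun n => 1 / ((n : ℝ) + 1)) (M := fun n => _) (a := 0) (b := -1) (c := 0) (d := 0)
        (fun n => ⟨z n, show 0 < (z n).re from (hre n).symm ▸ one_pos, rfl⟩) (fun n => ⟨isLift_halfTurn _, by positivity⟩)
        (tendsto_of_eq_comp (g := fun e => e ^ 2) (by fun_prop) (fun n => ?_) (by simp))
        (tendsto_of_eq_comp (g := fun e => -(e ^ 2) - 1) (by fun_prop) (fun n => ?_) (by simp))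
        (tendsto_of_eq_comp (g := fun e => e ^ 2) (by fun_prop) (fun n => ?_) (by simp))
        (tendsto_of_eq_comp (g := fun e => -e ^ 2) (by fun_prop) (fun n => ?_) (by simp)) ?_ ?_ ?_
      any_goals
        simp only [Matrix.of_apply, Matrix.cons_val', Matrix.cons_val_zero, Matrix.cons_val_one,
          Matrix.cons_val_fin_one, hre, him]
        try field_simp
      · ring
      · intro e
        simpa using congrFun (congrFun e 0) 1
      · simp [IdealImage]
      · simp [IdealImage]
    · have hx : 0 ≤ x := hx
      let z : ℕ → ℍ := fun n => ⟨⟨x + 1 / ((n : ℝ) + 1), 1 / ((n : ℝ) + 1)⟩, by positivity⟩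
      have hre : ∀ n, (z n).re = x + 1 / ((n : ℝ) + 1) := fun n => rfl
      have him : ∀ n, (z n).im = 1 / ((n : ℝ) + 1) := fun n => rfl
      refine mem_idealBoundary (S := halfPlane) (γ := fun n => halfTurn (z n))
        (r := fun n => 1 / ((n : ℝ) + 1)) (M := fun n => _) (a := x) (b := -x ^ 2) (c := 1)
        (d := -x) (fun n => ⟨z n, ?_, rfl⟩) (fun n => ⟨isLift_halfTurn _, by positivity⟩)
        (tendsto_of_eq_comp (g := fun e => x + e) (by fun_prop) (fun n => ?_) (by simp))
        (tendsto_of_eq_comp (g := fun e => -((x + e) ^ 2 + e ^ 2)) (by fun_prop) (fun n => ?_)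
          (by simp))
        (tendsto_of_eq_comp (g := fun e => 1) (by fun_prop) (fun n => ?_) (by simp))
        (tendsto_of_eq_comp (g := fun e => -(x + e)) (by fun_prop) (fun n => ?_) (by simp)) ?_ ?_ ?_
      · change 0 < (z n).re
        rw [hre]
        positivity
      any_goals
        simp only [Matrix.of_apply, Matrix.cons_val', Matrix.cons_val_zero, Matrix.cons_val_one,
          Matrix.cons_val_fin_one, hre, him]
        try field_simp
      · intro e
        simpa using congrFun (congrFun e 1) 0
      · exact Or.inr ⟨x, by simp [sq]⟩
      · exact Or.inr ⟨x, by simp [sq]⟩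

lemma idealBoundary_surf {k : ℝ} (hk : 0 < k) (hk1 : k < 1) :
    idealBoundary (surf k) = (fun p => (p, p)) '' posArc := by
  have mem : ∀ {η : ℝ} (u : ℝ), 0 < η → ∃ γ ∈ surf k, IsLift (curveMat k η u) γ := fun u hη => by
    obtain ⟨γ, hγ⟩ := exists_isLift_of_det (det_curveMat k u hη)
    exact ⟨γ, ⟨_, hη, u, hγ⟩, hγ⟩
  have hs1 : 0 < Real.sinh 1 := Real.sinh_pos_iff.2 one_pos
  have hc1 : 0 < Real.cosh 1 := Real.cosh_pos 1
  apply Subset.antisymm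
  -- The trace of the lift is 2 sinh(kη) / sinh η, which is at most 2 because k < 1.
  · refine idealBoundary_subset_diagonal (B := 2) ?_
    rintro γ ⟨η, hη, u, h⟩
    have hs := Real.sinh_pos_iff.2 hη
    have hc := Real.cosh_pos η
    refine ⟨_, h, ?_, ?_, ?_⟩
    · simp only [curveMat, Matrix.of_apply, Matrix.cons_val', Matrix.cons_val_zero,
        Matrix.cons_val_fin_one]
      positivity
    · simp only [curveMat, Matrix.of_apply, Matrix.cons_val', Matrix.cons_val_zero,
        Matrix.cons_val_one, Matrix.cons_val_fin_one]
      positivity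
    · have e : curveMat k η u 0 0 + curveMat k η u 1 1 = 2 * Real.sinh (k * η) / Real.sinh η := by
        simp [curveMat, Real.sinh_eq (k * η)]
        ring
      have h1 : 0 < Real.sinh (k * η) := Real.sinh_pos_iff.2 (by positivity)
      rw [e, abs_of_pos (by positivity), div_le_iff₀ hs]
      have := Real.sinh_le_sinh.2 (show k * η ≤ η by nlinarith)
      linarith
  · rintro _ ⟨p, rfl | ⟨x, hx, rfl⟩, rfl⟩
    -- The ends ∞ and 0 of the arc are reached by translation at fixed η, with u → +∞ and u → -∞; a
    -- point x > 0 in between is reached by letting η → 0 with e^u = x.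
    · choose γ hγ hM using fun n : ℕ => mem (η := 1) (Real.log ((n : ℝ) + 1)) one_pos
      have he : ∀ n : ℕ, Real.exp (Real.log ((n : ℝ) + 1)) = (n : ℝ) + 1 := fun n =>
        Real.exp_log (by positivity)
      refine mem_idealBoundary (r := fun n => 1 / ((n : ℝ) + 1))
        (a := 0) (b := -(Real.cosh 1 / Real.sinh 1)) (c := 0) (d := 0) hγ
        (fun n => ⟨hM n, by positivity⟩)
        (tendsto_of_eq_comp (g := fun e => e * (Real.exp (k * 1) / Real.sinh 1)) (by fun_prop)
          (fun n => ?_) (by simp))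
        (tendsto_of_eq_comp (g := fun e => -(Real.cosh 1 / Real.sinh 1)) (by fun_prop)
          (fun n => ?_) (by simp))
        (tendsto_of_eq_comp (g := fun e => e ^ 2 * (Real.cosh 1 / Real.sinh 1)) (by fun_prop)
          (fun n => ?_) (by simp))
        (tendsto_of_eq_comp (g := fun e => -(e * (Real.exp (-(k * 1)) / Real.sinh 1)))
          (by fun_prop) (fun n => ?_) (by simp)) ?_ ?_ ?_
      any_goals
        simp only [curveMat, Matrix.of_apply, Matrix.cons_val', Matrix.cons_val_zero,
          Matrix.cons_val_one, Matrix.cons_val_fin_one, Real.exp_neg (Real.log _), he]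
        try field_simp
      · intro e
        have := congrFun (congrFun e 0) 1
        simp [hs1.ne', hc1.ne'] at this
      · simp [IdealImage]
      · simp [IdealImage]
    · rcases eq_or_lt_of_le (show 0 ≤ x from hx) with rfl | hx
      · choose γ hγ hM using fun n : ℕ => mem (η := 1) (-Real.log ((n : ℝ) + 1)) one_pos
        have he : ∀ n : ℕ, Real.exp (Real.log ((n : ℝ) + 1)) = (n : ℝ) + 1 := fun n =>
          Real.exp_log (by positivity)
        refine mem_idealBoundary (r := fun n => 1 / ((n : ℝ) + 1))
          (a := 0) (c := Real.cosh 1 / Real.sinh 1) (b := 0) (d := 0) hγ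
          (fun n => ⟨hM n, by positivity⟩)
          (tendsto_of_eq_comp (g := fun e => e * (Real.exp (k * 1) / Real.sinh 1)) (by fun_prop)
            (fun n => ?_) (by simp))
          (tendsto_of_eq_comp (g := fun e => -(e ^ 2 * (Real.cosh 1 / Real.sinh 1))) (by fun_prop)
            (fun n => ?_) (by simp))
          (tendsto_of_eq_comp (g := fun e => Real.cosh 1 / Real.sinh 1) (by fun_prop)
            (fun n => ?_) (by simp))
          (tendsto_of_eq_comp (g := fun e => -(e * (Real.exp (-(k * 1)) / Real.sinh 1)))
            (by fun_prop) (fun n => ?_) (by simp)) ?_ ?_ ?_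
        any_goals
          simp only [curveMat, Matrix.of_apply, Matrix.cons_val', Matrix.cons_val_zero,
            Matrix.cons_val_one, Matrix.cons_val_fin_one, neg_neg, Real.exp_neg (Real.log _), he]
          try field_simp
        · intro e
          have := congrFun (congrFun e 1) 0
          simp [hs1.ne', hc1.ne'] at this
        · exact Or.inr ⟨0, by simp [hs1.ne', hc1.ne']⟩
        · exact Or.inr ⟨0, by simp [hs1.ne', hc1.ne']⟩
      · have hη : ∀ n : ℕ, 0 < 1 / ((n : ℝ) + 1) := fun n => by positivity
        choose γ hγ hM using fun n : ℕ => mem (Real.log x) (hη n)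
        have hs : ∀ n : ℕ, Real.sinh (1 / ((n : ℝ) + 1)) ≠ 0 := fun n =>
          (Real.sinh_pos_iff.2 (hη n)).ne'
        have he := Real.exp_log hx
        refine mem_idealBoundary (r := fun n => Real.sinh (1 / ((n : ℝ) + 1)))
          (a := 1) (b := -x) (c := x⁻¹) (d := -1) hγ (fun n => ⟨hM n, hs n⟩)
          (tendsto_of_eq_comp (g := fun e => Real.exp (k * e)) (by fun_prop)
            (fun n => ?_) (by simp))
          (tendsto_of_eq_comp (g := fun e => -(x * Real.cosh e)) (by fun_prop)
            (fun n => ?_) (by simp))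
          (tendsto_of_eq_comp (g := fun e => x⁻¹ * Real.cosh e) (by fun_prop)
            (fun n => ?_) (by simp))
          (tendsto_of_eq_comp (g := fun e => -Real.exp (-(k * e))) (by fun_prop)
            (fun n => ?_) (by simp)) ?_ ?_ ?_
        any_goals
          simp only [curveMat, Matrix.of_apply, Matrix.cons_val', Matrix.cons_val_zero,
            Matrix.cons_val_one, Matrix.cons_val_fin_one, Real.exp_neg (Real.log _), he]
          try field_simp
        · intro e
          have := congrFun (congrFun e 0) 0
          simp at this
        · exact Or.inr ⟨x, by simp [hx.ne']⟩
        · exact Or.inr ⟨x, by simp [hx.ne']⟩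

/-! ### The ideal boundary of the lightlike triangle -/

lemma mem_triangle_iff {γ : AdS} :
    γ ∈ triangle ↔ ∃ M, IsLift M γ ∧ M 1 1 = 0 ∧ M 0 0 / M 1 0 ≤ 0 :=
  ⟨fun ⟨g, h, h1, h2⟩ => ⟨g, ⟨g, rfl, h⟩, h1, h2⟩, fun ⟨_, ⟨g, hg, h⟩, h1, h2⟩ =>
    ⟨g, h, by rw [hg]; exact h1, by rw [hg]; exact h2⟩⟩

lemma idealBoundary_triangle : idealBoundary triangle = sawtooth := by
  apply Subset.antisymm
  · rintro ⟨p, q⟩ ⟨γ, hγ, h⟩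
    choose M hM h11 hM0 using fun n => mem_triangle_iff.1 (hγ n)
    obtain ⟨ψ, r, N, -, hdet, hp, hq, -, -, hlim⟩ := h.exists_scaledLimit hM
    have hd : ∀ n, M n 0 1 * M n 1 0 = -1 := fun n => by
      have := (hM n).det_eq'
      rw [h11] at this
      linarith
    have e11 : N 1 1 = 0 := tendsto_nhds_unique (hlim 1 1) (by simp [h11])
    have hne : ∀ n, M n 1 0 ≠ 0 := fun n e => by have := hd n; simp [e] at this
    have hs : ∀ n, M n 0 0 * M n 1 0 ≤ 0 := fun n => by
      have e : M n 0 0 * M n 1 0 = M n 0 0 / M n 1 0 * M n 1 0 ^ 2 := by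
        have := hne n; field_simp
      rw [e]
      exact mul_nonpos_of_nonpos_of_nonneg (hM0 n) (sq_nonneg _)
    -- The constraint on γ(∞) passes to the limit as signs of products of two entries, which do not
    -- depend on the choice of lift. Here it places p in the negative arc, and `e2` does the same
    -- for q.
    have e1 : N 0 0 * N 1 0 ≤ 0 := le_of_tendsto' ((hlim 0 0).mul (hlim 1 0)) fun n => by
      have := hs (ψ n)
      nlinarith [sq_nonneg (r n)]
    have e2 : 0 ≤ N 0 0 * N 0 1 := ge_of_tendsto' ((hlim 0 0).mul (hlim 0 1)) fun n => by
      have h1 := hd (ψ n)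
      have h2 := hM0 (ψ n)
      have h3 : M (ψ n) 0 1 = -(M (ψ n) 1 0)⁻¹ := by
        have := hne (ψ n)
        field_simp
        linarith
      have h4 : r n * M (ψ n) 0 0 * (r n * M (ψ n) 0 1) =
          r n ^ 2 * -(M (ψ n) 0 0 / M (ψ n) 1 0) := by rw [h3]; ring
      rw [h4]
      exact mul_nonneg (sq_nonneg _) (by linarith)
    rw [Matrix.det_fin_two, e11, mul_zero, zero_sub, neg_eq_zero] at hdet
    rw [IdealImage, Matrix.adjugate_fin_two] at hq
    simp [e11] at hq
    rcases hp with ⟨rfl, h1, -⟩ | ⟨x, rfl, hx, h2, -⟩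
    · refine Or.inl ⟨rfl, ?_⟩
      rcases hq with ⟨rfl, -, -⟩ | ⟨y, rfl, hy, -, hy'⟩
      · exact mem_insert _ _
      · refine Or.inr ⟨y, ?_, rfl⟩
        have h3 : N 0 0 ≠ 0 := hy.resolve_left fun h => h h1
        by_contra! hc
        have hc : 0 < y := not_le.1 hc
        have : 0 < N 0 0 ^ 2 := by positivity
        rw [show N 0 1 = -(y * N 0 0) by linarith] at e2
        nlinarith [mul_pos hc this]
    · have h10 : N 1 0 ≠ 0 := hx.resolve_right fun h => h e11
      refine Or.inr ⟨Or.inr ⟨x, ?_, rfl⟩, ?_⟩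
      · by_contra! hc
        have hc : 0 < x := not_le.1 hc
        have : 0 < N 1 0 ^ 2 := by positivity
        rw [h2] at e1
        nlinarith [mul_pos hc this]
      · rcases hq with ⟨rfl, h, -⟩ | ⟨y, rfl, -, hy, -⟩
        · exact absurd h h10
        · rw [hy.resolve_right h10]
          rfl
  · have key : ∀ (a c : ℕ → ℝ), (∀ n, 0 < c n) → (∀ n, 0 ≤ a n) → ∃ γ : ℕ → AdS,
        (∀ n, γ n ∈ triangle) ∧ ∀ n, IsLift !![-a n, -(c n)⁻¹; c n, 0] (γ n) := by
      intro a c hc ha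
      choose γ hγ using fun n => exists_isLift_of_det (M := !![-a n, -(c n)⁻¹; c n, 0]) (by
        rw [Matrix.det_fin_two_of]
        have := (hc n).ne'
        field_simp
        ring)
      refine ⟨γ, fun n => mem_triangle_iff.2 ⟨_, hγ n, by simp, ?_⟩, hγ⟩
      simp only [Matrix.of_apply, Matrix.cons_val', Matrix.cons_val_zero,
          Matrix.cons_val_one, Matrix.cons_val_fin_one]
      exact div_nonpos_of_nonpos_of_nonneg (neg_nonpos.2 (ha n)) (hc n).le
    have neg_case : ∀ y : ℝ, y ≤ 0 →
        (OnePoint.infty, ((y : ℝ) : OnePoint ℝ)) ∈ idealBoundary triangle := by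
      intro y hy
      -- After division by n + 1 the first row tends to (-1, y). The summand 1 keeps the inverse
      -- meaningful when y = 0.
      obtain ⟨γ, h1, h2⟩ := key (fun n => (n : ℝ) + 1) (fun n => ((n + 1 : ℝ) * -y + 1)⁻¹)
        (fun n => by have : 0 ≤ -y := by linarith
                     positivity)
        fun n => by positivity
      refine mem_idealBoundary (r := fun n => 1 / ((n : ℝ) + 1))
          (a := -1) (b := y) (c := 0) (d := 0) h1 (fun n => ⟨h2 n, by positivity⟩)
          (tendsto_of_eq_comp (g := fun e => -1) (by fun_prop) (fun n => ?_) (by simp))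
          (tendsto_of_eq_comp (g := fun e => y - e) (by fun_prop) (fun n => ?_) (by simp))
          ?_
          (tendsto_of_eq_comp (g := fun e => 0) (by fun_prop) (fun n => ?_) (by simp)) ?_ ?_ ?_
      any_goals
        simp only [Matrix.of_apply, Matrix.cons_val', Matrix.cons_val_zero, Matrix.cons_val_one,
          Matrix.cons_val_fin_one, inv_inv]
      · field_simp
      · field_simp
        ring
      · refine squeeze_zero (fun n => ?_) (fun n => ?_) tendsto_one_div_add_atTop_nhds_zero_nat
        · have : 0 ≤ -y := by linarith
          positivity
        · have h3 : 0 ≤ -y := by linarith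
          refine mul_le_of_le_one_right (by positivity) (inv_le_one_of_one_le₀ ?_)
          have : 0 ≤ ((n : ℝ) + 1) * -y := by positivity
          linarith
      · simp
      · intro e
        simpa using congrFun (congrFun e 0) 0
      · simp [IdealImage]
      · exact Or.inr ⟨y, by simp⟩
    rintro ⟨p, q⟩ (⟨rfl, rfl | ⟨y, hy, rfl⟩⟩ | ⟨rfl | ⟨x, hx, rfl⟩, rfl⟩)
    · obtain ⟨γ, h1, h2⟩ := key (fun _ => 0) (fun n => 1 / ((n : ℝ) + 1)) (fun n => by positivity)
        fun n => le_rfl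
      refine mem_idealBoundary (r := fun n => 1 / ((n : ℝ) + 1))
          (a := 0) (b := -1) (c := 0) (d := 0) h1 (fun n => ⟨h2 n, by positivity⟩)
          (tendsto_of_eq_comp (g := fun e => 0) (by fun_prop) (fun n => ?_) (by simp))
          (tendsto_of_eq_comp (g := fun e => -1) (by fun_prop) (fun n => ?_) (by simp))
          (tendsto_of_eq_comp (g := fun e => e ^ 2) (by fun_prop) (fun n => ?_) (by simp))
          (tendsto_of_eq_comp (g := fun e => 0) (by fun_prop) (fun n => ?_) (by simp)) ?_ ?_ ?_
      any_goals
        simp only [Matrix.of_apply, Matrix.cons_val', Matrix.cons_val_zero, Matrix.cons_val_one,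
          Matrix.cons_val_fin_one]
        try field_simp
      · simp
      · simp
      · intro e
        simpa using congrFun (congrFun e 0) 1
      · simp [IdealImage]
      · simp [IdealImage]
    · exact neg_case y hy
    · exact neg_case 0 le_rfl
    · have hx : x ≤ 0 := hx
      obtain ⟨γ, h1, h2⟩ := key (fun n => (n + 1 : ℝ) * -x) (fun n => (n : ℝ) + 1)
        (fun n => by positivity) fun n => by
          have : 0 ≤ -x := by linarith
          positivity
      refine mem_idealBoundary (r := fun n => 1 / ((n : ℝ) + 1))
          (a := x) (b := 0) (c := 1) (d := 0) h1 (fun n => ⟨h2 n, by positivity⟩)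
          (tendsto_of_eq_comp (g := fun e => x) (by fun_prop) (fun n => ?_) (by simp))
          (tendsto_of_eq_comp (g := fun e => -e ^ 2) (by fun_prop) (fun n => ?_) (by simp))
          (tendsto_of_eq_comp (g := fun e => 1) (by fun_prop) (fun n => ?_) (by simp))
          (tendsto_of_eq_comp (g := fun e => 0) (by fun_prop) (fun n => ?_) (by simp)) ?_ ?_ ?_
      any_goals
        simp only [Matrix.of_apply, Matrix.cons_val', Matrix.cons_val_zero, Matrix.cons_val_one,
          Matrix.cons_val_fin_one]
        try field_simp
      · simp
      · intro e
        simpa using congrFun (congrFun e 1) 0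
      · exact Or.inr ⟨x, by simp⟩
      · exact Or.inr ⟨0, by simp⟩

/-! ### Asymptotics of `σ` along the orthogonal geodesics -/

/-- Since |k| < 1, the diagonal entries e^{±kη} / sinh η vanish in the limit while cosh η / sinh η
tends to 1, leaving the half-turn around i e^u. -/
lemma tendsto_curveMat_atTop {k : ℝ} (hk : |k| < 1) (u : ℝ) (i j : Fin 2) :
    Tendsto (fun η => curveMat k η u i j) atTop
      (𝓝 ((!![0, -Real.exp u; Real.exp (-u), 0] : M2) i j)) := by
  have h1 := tendsto_exp_div_sinh (abs_lt.1 hk).2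
  have h2 := tendsto_exp_div_sinh (k := -k) (by linarith [(abs_lt.1 hk).1])
  have h3 : Tendsto (fun η => Real.cosh η / Real.sinh η) atTop (𝓝 1) := by
    have h4 := (tendsto_exp_div_sinh (k := -1) (by norm_num)).const_add 1
    rw [add_zero] at h4
    refine h4.congr' ?_
    filter_upwards [eventually_gt_atTop 0] with η hη
    have := (Real.sinh_pos_iff.2 hη).ne'
    field_simp
    rw [← Real.cosh_sub_sinh]
    ring
  fin_cases i <;> fin_cases j <;> simp only [curveMat, Fin.zero_eta, Fin.mk_one, Fin.isValue,
    Matrix.of_apply, Matrix.cons_val', Matrix.cons_val_zero, Matrix.cons_val_one,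
    Matrix.cons_val_fin_one]
  · exact h1
  · simpa [mul_div_assoc] using (h3.const_mul (Real.exp u)).neg
  · simpa [mul_div_assoc] using h3.const_mul (Real.exp (-u))
  · simpa using h2.neg

lemma isLift_halfTurn_toH (s : ℝ) :
    IsLift !![0, -Real.exp s; Real.exp (-s), 0] (halfTurn (toH s)) := by
  have h : ((toH s : ℍ) : ℂ) = zmap s := coe_toH (by simp; positivity) (by simp; positivity)
  have hre : (toH s : ℍ).re = 0 := by
    change ((toH s : ℍ) : ℂ).re = 0
    rw [h, zmap_re]; simp
  have him : (toH s : ℍ).im = Real.exp s := by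
    change ((toH s : ℍ) : ℂ).im = Real.exp s
    rw [h, zmap_im]; simp
  have := isLift_halfTurn (toH s)
  rw [hre, him] at this
  convert this using 2
  have he := Real.exp_ne_zero s
  rw [Real.exp_neg]
  congr 2
  · simp
  · simp
    field_simp
  · congr 1
    · simp
    · simp

lemma tendsto_halfTurn {k n : ℝ} (hk : |k| < 1) (hn : 0 < n) {f : ℝ → AdS} {s : ℝ}
    (hf : ∀ t ∈ Ioo (-(Real.pi / 2)) 0, IsLift (curveMat k (eta n t) s) (f t)) :
    Tendsto f (𝓝[<] 0) (𝓝 (halfTurn (toH s))) :=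
  tendsto_of_isLift (mem_left.mono hf) (isLift_halfTurn_toH s) fun i j =>
    (tendsto_curveMat_atTop hk s i j).comp (tendsto_eta_atTop hn)

/-- At t = -π/2 the parameter η is zero and the lift blows up like 1 / sinh η. Multiplying by sinh η
leaves a nilpotent matrix whose image, like that of its adjugate, is the ideal point e^s. -/
lemma scaledLimit_left {k n : ℝ} (hn : 0 < n) {f : ℝ → AdS} {s : ℝ}
    (hf : ∀ t ∈ Ioo (-(Real.pi / 2)) 0, IsLift (curveMat k (eta n t) s) (f t)) :
    ScaledLimit (𝓝[>] (-(Real.pi / 2))) f !![1, -Real.exp s; Real.exp (-s), -1] := by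
  have hη : Tendsto (eta n) (𝓝[>] (-(Real.pi / 2))) (𝓝 0) := by
    have h : ContinuousAt (eta n) (-(Real.pi / 2)) := by
      refine Real.continuous_arsinh.continuousAt.comp (f := fun t => -(Real.cos t / (n * Real.sin t)))
        (ContinuousAt.neg (Real.continuous_cos.continuousAt.div
          (continuousAt_const.mul Real.continuous_sin.continuousAt) ?_))
      exact mul_ne_zero hn.ne' sin_left_end.ne
    have := h.tendsto.mono_left (nhdsWithin_le_nhds (s := Ioi (-(Real.pi / 2))))
    simpa [eta] using this
  refine ⟨fun t => curveMat k (eta n t) s, fun t => Real.sinh (eta n t), ?_, fun i j => ?_⟩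
  · filter_upwards [mem_right] with t ht
    exact ⟨hf t ht, (Real.sinh_pos_iff.2 (eta_pos hn ht)).ne'⟩
  · have key : ∀ g : ℝ → ℝ, Continuous g → ∀ a, g 0 = a → (∀ η > 0, Real.sinh η *
        curveMat k η s i j = g η) →
        Tendsto (fun t => Real.sinh (eta n t) * curveMat k (eta n t) s i j)
          (𝓝[>] (-(Real.pi / 2))) (𝓝 a) := by
      intro g hg a ha h
      rw [← ha]
      refine ((hg.tendsto 0).comp hη).congr' ?_
      filter_upwards [mem_right] with t ht using (h _ (eta_pos hn ht)).symm
    have hs : ∀ η : ℝ, 0 < η → Real.sinh η ≠ 0 := fun η h => (Real.sinh_pos_iff.2 h).ne'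
    fin_cases i <;> fin_cases j
    · refine key (fun η => Real.exp (k * η)) (by fun_prop) _ (by simp) fun η h => ?_
      have := hs η h
      simp [curveMat]; field_simp
    · refine key (fun η => -(Real.exp s * Real.cosh η)) (by fun_prop) _ (by simp) fun η h => ?_
      have := hs η h
      simp [curveMat]; field_simp
    · refine key (fun η => Real.exp (-s) * Real.cosh η) (by fun_prop) _ (by simp) fun η h => ?_
      have := hs η h
      simp [curveMat]; field_simp
    · refine key (fun η => -Real.exp (-(k * η))) (by fun_prop) _ (by simp) fun η h => ?_
      have := hs η h
      simp [curveMat]; field_simp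

lemma tendsto_act_left {k n : ℝ} (hn : 0 < n) {f : ℝ → AdS} {s : ℝ}
    (hf : ∀ t ∈ Ioo (-(Real.pi / 2)) 0, IsLift (curveMat k (eta n t) s) (f t)) (x : ℍ) :
    Tendsto (fun t => ((act (f t) x : ℍ) : ℂ)) (𝓝[>] (-(Real.pi / 2))) (𝓝 (Real.exp s : ℂ)) ∧
    Tendsto (fun t => ((act (f t)⁻¹ x : ℍ) : ℂ)) (𝓝[>] (-(Real.pi / 2))) (𝓝 (Real.exp s : ℂ)) := by
  have h := scaledLimit_left hn hf
  have e : Real.exp s * Real.exp (-s) = 1 := by rw [← Real.exp_add]; simp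
  constructor
  · exact h.tendsto_act_ofReal (by simp) (by simp [e]) (by simp) x
  · exact h.inv.tendsto_act_ofReal (by simp) (by simp [e]) (by simp) x

/-! ### Surfaces as graphs -/

/-- The isometries with a lift `(a, -b; c, -d)` such that `c > 0` and `(a, d) ∈ X`. -/
def graphSet (X : Set (ℝ × ℝ)) : Set AdS :=
  {γ | ∃ M, IsLift M γ ∧ 0 < M 1 0 ∧ (M 0 0, -M 1 1) ∈ X}

lemma IsLift.ext_of_pos {M N : M2} (hM : M.det = 1) (hN : N.det = 1) (h00 : M 0 0 = N 0 0)
    (h10 : M 1 0 = N 1 0) (h11 : M 1 1 = N 1 1) (h : M 1 0 ≠ 0) : M = N := by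
  rw [Matrix.det_fin_two] at hM hN
  have h01 : M 0 1 = N 0 1 := by
    apply mul_right_cancel₀ h
    rw [← h00, ← h10, ← h11] at hN
    linarith
  ext i j
  fin_cases i <;> fin_cases j <;> assumption

lemma IsLift.eq_of_pos {M N : M2} {γ : AdS} (hM : IsLift M γ) (hN : IsLift N γ) (h : 0 < M 1 0)
    (h' : 0 < N 1 0) : M = N := by
  rcases hM.eq_or_neg hN with e | e
  · exact e.symm
  · rw [e, Matrix.neg_apply] at h'
    linarith

lemma graphSet_union (X Y : Set (ℝ × ℝ)) : graphSet (X ∪ Y) = graphSet X ∪ graphSet Y := by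
  apply Subset.antisymm
  · rintro γ ⟨M, h, hc, hX | hX⟩
    · exact Or.inl ⟨M, h, hc, hX⟩
    · exact Or.inr ⟨M, h, hc, hX⟩
  · rintro γ (⟨M, h, hc, hX⟩ | ⟨M, h, hc, hX⟩)
    · exact ⟨M, h, hc, Or.inl hX⟩
    · exact ⟨M, h, hc, Or.inr hX⟩

lemma graphSet_mono {X Y : Set (ℝ × ℝ)} (h : X ⊆ Y) : graphSet X ⊆ graphSet Y :=
  fun _ ⟨M, hM, hc, hX⟩ => ⟨M, hM, hc, h hX⟩

lemma disjoint_graphSet {X Y : Set (ℝ × ℝ)} (h : Disjoint X Y) :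
    Disjoint (graphSet X) (graphSet Y) := by
  rw [Set.disjoint_left] at h ⊢
  rintro γ ⟨M, hM, hc, hX⟩ ⟨N, hN, hc', hY⟩
  rw [← hM.eq_of_pos hN hc hc'] at hY
  exact h hX hY

/-- The matrix `(a, -b; c, -d)` of determinant one. -/
def graphMat (a d c : ℝ) : M2 := !![a, -((1 + a * d) / c); c, -d]

lemma det_graphMat (a d : ℝ) {c : ℝ} (hc : c ≠ 0) : (graphMat a d c).det = 1 := by
  rw [graphMat, Matrix.det_fin_two_of]
  field_simp
  ring

lemma IsLift.eq_graphMat {M : M2} {γ : AdS} (h : IsLift M γ) (hc : M 1 0 ≠ 0) :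
    M = graphMat (M 0 0) (-M 1 1) (M 1 0) :=
  IsLift.ext_of_pos h.det_eq (det_graphMat _ _ hc) (by simp [graphMat]) (by simp [graphMat])
    (by simp [graphMat]) hc

/-- The isometry with lift `graphMat a d c`. -/
def graphPt (x : (ℝ × ℝ) × ℝ) : AdS :=
  if h : x.2 ≠ 0 then cls ⟨graphMat x.1.1 x.1.2 x.2, det_graphMat _ _ h⟩ else 1

lemma isLift_graphPt {x : (ℝ × ℝ) × ℝ} (h : x.2 ≠ 0) :
    IsLift (graphMat x.1.1 x.1.2 x.2) (graphPt x) := by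
  rw [graphPt, dif_pos h]
  exact ⟨_, rfl, rfl⟩

lemma continuousOn_graphPt : ContinuousOn graphPt (univ ×ˢ Ioi 0) := by
  intro x hx
  have hx : 0 < x.2 := hx.2
  refine ContinuousAt.continuousWithinAt ?_
  have h1 : ∀ᶠ y : (ℝ × ℝ) × ℝ in 𝓝 x, y.2 ≠ 0 :=
    continuous_snd.continuousAt.eventually_ne hx.ne'
  refine tendsto_of_isLift (h1.mono fun y hy => isLift_graphPt hy) (isLift_graphPt hx.ne')
    fun i j => ?_
  have h2 : Tendsto (fun y : (ℝ × ℝ) × ℝ => y.1.1) (𝓝 x) (𝓝 x.1.1) := Continuous.tendsto (by fun_prop) x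
  have h3 : Tendsto (fun y : (ℝ × ℝ) × ℝ => y.1.2) (𝓝 x) (𝓝 x.1.2) := Continuous.tendsto (by fun_prop) x
  have h4 : Tendsto (fun y : (ℝ × ℝ) × ℝ => y.2) (𝓝 x) (𝓝 x.2) := Continuous.tendsto (by fun_prop) x
  fin_cases i <;> fin_cases j <;> simp only [graphMat, Fin.zero_eta, Fin.mk_one, Fin.isValue,
    Matrix.of_apply, Matrix.cons_val', Matrix.cons_val_zero, Matrix.cons_val_one,
    Matrix.cons_val_fin_one]
  · exact h2
  · exact (((h2.mul h3).const_add 1).div h4 hx.ne').neg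
  · exact h4
  · exact h3.neg

/-- The pair (a, d) and the entry c > 0 determine the lift, since bc = 1 + ad. Conjugation by
translations fixes (a, d) and rescales c, so a translation-invariant set becomes a product with a
half-line. -/
lemma graphSet_eq_image (X : Set (ℝ × ℝ)) : graphSet X = graphPt '' (X ×ˢ Ioi 0) := by
  apply Subset.antisymm
  · rintro γ ⟨M, hM, hc, hX⟩
    refine ⟨((M 0 0, -M 1 1), M 1 0), ⟨hX, hc⟩, ?_⟩
    have h := isLift_graphPt (x := ((M 0 0, -M 1 1), M 1 0)) hc.ne'
    rw [← hM.eq_graphMat hc.ne'] at h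
    exact h.unique hM
  · rintro _ ⟨x, ⟨hx, hc⟩, rfl⟩
    have hc : 0 < x.2 := hc
    exact ⟨_, isLift_graphPt hc.ne', by simpa [graphMat] using hc, by simpa [graphMat] using hx⟩

lemma isConnected_graphSet {X : Set (ℝ × ℝ)} (h : IsConnected X) : IsConnected (graphSet X) := by
  rw [graphSet_eq_image]
  exact (h.prod isConnected_Ioi).image _ (continuousOn_graphPt.mono (prod_mono_left (subset_univ X)))

/-- When ad ≥ 0, bc = 1 + ad ≥ 1, and this closed condition keeps c away from zero in the limit. The
strict condition c > 0 can thus be replaced by c ≥ 0 on each of the two lifts. -/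
lemma isClosed_graphSet {X : Set (ℝ × ℝ)} (hX : IsClosed X) (h : ∀ x ∈ X, 0 ≤ x.1 * x.2) :
    IsClosed (graphSet X) := by
  rw [← isOpenQuotientMap_cls.isQuotientMap.isClosed_preimage]
  have e : cls ⁻¹' graphSet X = {g | g 0 1 * g 1 0 ≤ -1 ∧ ((0 ≤ g 1 0 ∧ (g 0 0, -g 1 1) ∈ X) ∨
      (g 1 0 ≤ 0 ∧ (-g 0 0, g 1 1) ∈ X))} := by
    ext g
    have hd := (isLift_cls g).det_eq'
    constructor
    · rintro ⟨M, hM, hc, hx⟩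
      have hd' := hM.det_eq'
      have h1 := h _ hx
      simp only at h1
      rcases (isLift_cls g).eq_or_neg hM with rfl | rfl
      · exact ⟨by nlinarith, Or.inl ⟨hc.le, hx⟩⟩
      · simp only [Matrix.neg_apply, neg_neg] at *
        exact ⟨by nlinarith, Or.inr ⟨by linarith, hx⟩⟩
    · rintro ⟨h1, ⟨h2, h3⟩ | ⟨h2, h3⟩⟩
      · refine ⟨g, isLift_cls g, lt_of_le_of_ne h2 fun e => ?_, h3⟩
        rw [← e] at h1
        linarith
      · refine ⟨_, (isLift_cls g).neg, ?_, by simpa using h3⟩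
        rw [Matrix.neg_apply, neg_pos]
        refine lt_of_le_of_ne h2 fun e => ?_
        rw [e] at h1
        linarith
  rw [e]
  have hc : ∀ i j, Continuous fun g : Matrix.SpecialLinearGroup (Fin 2) ℝ => g i j := fun i j => by
    fun_prop
  refine (isClosed_le ((hc 0 1).mul (hc 1 0)) continuous_const).inter
    (((isClosed_le continuous_const (hc 1 0)).inter ?_).union
      ((isClosed_le (hc 1 0) continuous_const).inter ?_))
  · exact hX.preimage ((hc 0 0).prodMk (hc 1 1).neg)
  · exact hX.preimage ((hc 0 0).neg.prodMk (hc 1 1))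

lemma closure_graphSet {X : Set (ℝ × ℝ)} (h : ∀ x ∈ closure X, 0 ≤ x.1 * x.2) :
    closure (graphSet X) = graphSet (closure X) := by
  apply Subset.antisymm
  · exact closure_minimal (graphSet_mono subset_closure) (isClosed_graphSet isClosed_closure h)
  · rw [graphSet_eq_image, graphSet_eq_image]
    rintro _ ⟨⟨x, c⟩, ⟨hx, hc⟩, rfl⟩
    have hcont : ContinuousOn (fun y => graphPt (y, c)) univ :=
      continuousOn_graphPt.comp (by fun_prop) fun y _ => ⟨mem_univ _, hc⟩
    exact map_mem_closure (f := fun y => graphPt (y, c)) (continuousOn_univ.1 hcont) hx fun y hy => ⟨(y, c), ⟨hy, hc⟩, rfl⟩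

/-! ### The surface and the half-plane as graphs -/

/-- The first coefficient of the lifts of the surface, as a function of `v = 1 / sinh η`. -/
def coefA (k v : ℝ) : ℝ := v ^ (1 - k) * (1 + √(1 + v ^ 2)) ^ k

/-- The last coefficient of the lifts of the surface, as a function of `v = 1 / sinh η`. -/
def coefD (k v : ℝ) : ℝ := v ^ (1 + k) * (1 + √(1 + v ^ 2)) ^ (-k)

lemma continuous_coefA {k : ℝ} (hk : k < 1) : Continuous (coefA k) := by
  have h : ∀ v : ℝ, 0 < 1 + √(1 + v ^ 2) := fun v => by positivity
  exact (Real.continuous_rpow_const (by linarith)).mul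
    (Continuous.rpow_const (by fun_prop) fun v => Or.inl (h v).ne')

lemma continuous_coefD {k : ℝ} (hk : -1 < k) : Continuous (coefD k) := by
  have h : ∀ v : ℝ, 0 < 1 + √(1 + v ^ 2) := fun v => by positivity
  exact (Real.continuous_rpow_const (by linarith)).mul
    (Continuous.rpow_const (by fun_prop) fun v => Or.inl (h v).ne')

/-- With v = 1 / sinh η, e^η = (1 + √(1 + v²)) / v. In the parameter v the curve extends
continuously to v = 0, where it meets the edge. -/
lemma coef_eq (k : ℝ) {η : ℝ} (hη : 0 < η) :
    coefA k (Real.sinh η)⁻¹ = Real.exp (k * η) / Real.sinh η ∧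
      coefD k (Real.sinh η)⁻¹ = Real.exp (-(k * η)) / Real.sinh η := by
  have hs := Real.sinh_pos_iff.2 hη
  have hc := Real.cosh_pos η
  have e : 1 + √(1 + (Real.sinh η)⁻¹ ^ 2) = Real.exp η * (Real.sinh η)⁻¹ := by
    have : 1 + (Real.sinh η)⁻¹ ^ 2 = (Real.cosh η / Real.sinh η) ^ 2 := by
      field_simp
      linarith [Real.cosh_sq η]
    rw [this, Real.sqrt_sq (by positivity), ← Real.cosh_add_sinh]
    field_simp
    ring
  have hv : 0 < (Real.sinh η)⁻¹ := by positivity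
  constructor
  · rw [coefA, e, Real.mul_rpow (Real.exp_pos _).le hv.le, ← Real.exp_mul, mul_left_comm,
      ← Real.rpow_add hv, sub_add_cancel, Real.rpow_one, mul_comm η, div_eq_mul_inv]
  · rw [coefD, e, Real.mul_rpow (Real.exp_pos _).le hv.le, ← Real.exp_mul, mul_left_comm,
      ← Real.rpow_add hv, add_neg_cancel_right, Real.rpow_one, mul_neg, mul_comm η, div_eq_mul_inv]

/-- The profile curve of the surface, parametrized by `v = 1 / sinh η`. -/
def coefCurve (k v : ℝ) : ℝ × ℝ := (coefA k v, coefD k v)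

lemma continuous_coefCurve {k : ℝ} (hk : |k| < 1) : Continuous (coefCurve k) :=
  (continuous_coefA (abs_lt.1 hk).2).prodMk (continuous_coefD (abs_lt.1 hk).1)

lemma coefCurve_zero {k : ℝ} (hk : |k| < 1) : coefCurve k 0 = (0, 0) := by
  have h := abs_lt.1 hk
  rw [coefCurve, coefA, coefD, Real.zero_rpow (by linarith), Real.zero_rpow (by linarith), zero_mul,
    zero_mul]

lemma coefA_mul_coefD (k : ℝ) {v : ℝ} (hv : 0 < v) : coefA k v * coefD k v = v ^ 2 := by
  have h : 0 < 1 + √(1 + v ^ 2) := by positivity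
  rw [coefA, coefD, mul_mul_mul_comm, ← Real.rpow_add hv, ← Real.rpow_add h, add_neg_cancel,
    Real.rpow_zero, mul_one, ← Real.rpow_natCast]
  congr 1
  push_cast
  ring

lemma coef_pos (k : ℝ) {v : ℝ} (hv : 0 < v) : 0 < coefA k v ∧ 0 < coefD k v := by
  rw [coefA, coefD]
  constructor <;> positivity

/-- The product of the coordinates is v², so the parameter is a continuous function of the point and
the image is cut out by closed conditions. -/
lemma isClosed_coefCurve {k : ℝ} (hk : |k| < 1) : IsClosed (coefCurve k '' Ici 0) := by
  have h := abs_lt.1 hk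
  have e : coefCurve k '' Ici 0 = {x | 0 ≤ x.1 ∧ 0 ≤ x.2 ∧ x = coefCurve k (√(x.1 * x.2))} := by
    apply Subset.antisymm
    · rintro _ ⟨v, hv, rfl⟩
      rcases eq_or_lt_of_le (show 0 ≤ v from hv) with rfl | hv
      · simp [coefCurve_zero hk]
      · obtain ⟨h1, h2⟩ := coef_pos k hv
        refine ⟨h1.le, h2.le, ?_⟩
        rw [coefCurve, coefA_mul_coefD k hv, Real.sqrt_sq hv.le, coefCurve]
    · rintro x ⟨-, -, h3⟩
      exact ⟨_, Real.sqrt_nonneg _, h3.symm⟩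
  rw [e]
  exact (isClosed_le continuous_const continuous_fst).inter
    ((isClosed_le continuous_const continuous_snd).inter
      (isClosed_eq continuous_id ((continuous_coefCurve hk).comp (by fun_prop))))

lemma closure_coefCurve {k : ℝ} (hk : |k| < 1) :
    closure (coefCurve k '' Ioi 0) = coefCurve k '' Ici 0 := by
  apply Subset.antisymm
  · exact closure_minimal (image_mono Ioi_subset_Ici_self) (isClosed_coefCurve hk)
  · rw [← closure_Ioi]
    exact image_closure_subset_closure_image (continuous_coefCurve hk)

lemma coefCurve_Ici {k : ℝ} (hk : |k| < 1) :
    coefCurve k '' Ici 0 = coefCurve k '' Ioi 0 ∪ {(0, 0)} := by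
  rw [← Ioi_insert, insert_eq, union_comm, image_union, image_singleton, coefCurve_zero hk]

lemma surf_eq_graphSet (k : ℝ) : surf k = graphSet (coefCurve k '' Ioi 0) := by
  apply Subset.antisymm
  · rintro γ ⟨η, hη, u, h⟩
    have hs := Real.sinh_pos_iff.2 hη
    have hc := Real.cosh_pos η
    refine ⟨_, h, ?_, (Real.sinh η)⁻¹, inv_pos.2 hs, ?_⟩
    · simp only [curveMat, Matrix.of_apply, Matrix.cons_val', Matrix.cons_val_zero,
        Matrix.cons_val_one, Matrix.cons_val_fin_one]
      positivity
    · rw [coefCurve, (coef_eq k hη).1, (coef_eq k hη).2]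
      simp [curveMat]
  · rintro γ ⟨M, hM, hc, v, hv, e⟩
    have hv : 0 < v := hv
    obtain ⟨η, hη, rfl⟩ : ∃ η > 0, (Real.sinh η)⁻¹ = v :=
      ⟨Real.arsinh v⁻¹, Real.arsinh_pos_iff.2 (inv_pos.2 hv), by rw [Real.sinh_arsinh, inv_inv]⟩
    have hs := Real.sinh_pos_iff.2 hη
    have hch := Real.cosh_pos η
    rw [coefCurve, (coef_eq k hη).1, (coef_eq k hη).2, Prod.mk.injEq] at e
    -- The value of u solves e^{-u} cosh η / sinh η = c.
    refine ⟨η, hη, -Real.log (M 1 0 * Real.sinh η / Real.cosh η), ?_⟩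
    have hM' : curveMat k η (-Real.log (M 1 0 * Real.sinh η / Real.cosh η)) = M := by
      have h10 : curveMat k η (-Real.log (M 1 0 * Real.sinh η / Real.cosh η)) 1 0 = M 1 0 := by
        simp only [curveMat, Matrix.of_apply, Matrix.cons_val', Matrix.cons_val_zero,
          Matrix.cons_val_one, Matrix.cons_val_fin_one, neg_neg]
        rw [Real.exp_log (by positivity)]
        field_simp
      refine IsLift.ext_of_pos (det_curveMat k _ hη) hM.det_eq ?_ h10 ?_ (by rw [h10]; exact hc.ne')
      · rw [← e.1]; simp [curveMat]
      · rw [← neg_neg (M 1 1), ← e.2]; simp [curveMat]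
    rwa [hM']

lemma halfPlane_eq_graphSet : halfPlane = graphSet ((fun v : ℝ => (v, v)) '' Ioi 0) := by
  apply Subset.antisymm
  · rintro _ ⟨z, hz, rfl⟩
    have hz : 0 < z.re := hz
    have hi := z.im_pos
    refine ⟨_, isLift_halfTurn z, ?_, z.re / z.im, div_pos hz hi, ?_⟩
    · simp [hi]
    · simp [neg_div]
  · rintro γ ⟨M, hM, hc, v, hv, e⟩
    have hv : 0 < v := hv
    rw [Prod.mk.injEq] at e
    let z : ℍ := ⟨⟨v / M 1 0, 1 / M 1 0⟩, by positivity⟩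
    have hre : z.re = v / M 1 0 := rfl
    have him : z.im = 1 / M 1 0 := rfl
    refine ⟨z, show 0 < z.re by rw [hre]; positivity, ?_⟩
    have h := isLift_halfTurn z
    have e' := IsLift.ext_of_pos h.det_eq hM.det_eq (by simp [hre, him, hc.ne', e.1])
      (by simp [him]) (by simp [hre, him, hc.ne', e.2, neg_div]) (by simp [him, hc.ne'])
    rw [e'] at h
    exact h.unique hM

lemma edge_eq_graphSet : edge = graphSet {(0, 0)} := by
  apply Subset.antisymm
  · rintro _ ⟨z, hz, rfl⟩
    have hz : z.re = 0 := hz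
    have hi := z.im_pos
    refine ⟨_, isLift_halfTurn z, ?_, ?_⟩
    · simp [hi]
    · simp [hz]
  · rintro γ ⟨M, hM, hc, e⟩
    rw [mem_singleton_iff, Prod.mk.injEq] at e
    let z : ℍ := ⟨⟨0, 1 / M 1 0⟩, by positivity⟩
    have hre : z.re = 0 := rfl
    have him : z.im = 1 / M 1 0 := rfl
    refine ⟨z, hre, ?_⟩
    have h := isLift_halfTurn z
    have e' := IsLift.ext_of_pos h.det_eq hM.det_eq (by simp [hre, e.1])
      (by simp [him]) (by simp [hre, neg_eq_zero.1 e.2]) (by simp [him, hc.ne'])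
    rw [e'] at h
    exact h.unique hM

lemma triangle_eq_graphSet : triangle = graphSet (Iic 0 ×ˢ {0}) := by
  ext γ
  rw [mem_triangle_iff]
  constructor
  · rintro ⟨M, hM, h11, h0⟩
    have hd := hM.det_eq'
    have hc : M 1 0 ≠ 0 := fun e => by simp [e, h11] at hd
    rcases lt_or_gt_of_ne hc with hc | hc
    · refine ⟨-M, hM.neg, by simpa using hc, ?_, by simp [h11]⟩
      rw [mem_Iic, Matrix.neg_apply, neg_nonpos]
      by_contra! h
      exact absurd h0 (not_le.2 (div_pos_of_neg_of_neg h hc))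
    · refine ⟨M, hM, hc, ?_, by simp [h11]⟩
      rw [mem_Iic]
      by_contra! h
      exact absurd h0 (not_le.2 (div_pos h hc))
  · rintro ⟨M, hM, hc, h1, h2⟩
    exact ⟨M, hM, neg_eq_zero.1 h2, div_nonpos_of_nonpos_of_nonneg h1 hc.le⟩

lemma disjoint_coefCurve (k : ℝ) : Disjoint (coefCurve k '' Ioi 0) (Iic 0 ×ˢ {0}) := by
  rw [Set.disjoint_left]
  rintro _ ⟨v, hv, rfl⟩ ⟨-, h⟩
  exact (coef_pos k hv).2.ne' h

lemma coefCurve_mul_nonneg {k : ℝ} (hk : |k| < 1) : ∀ x ∈ coefCurve k '' Ici 0, 0 ≤ x.1 * x.2 := by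
  rw [coefCurve_Ici hk]
  rintro _ (⟨v, hv, rfl⟩ | rfl)
  · exact (mul_pos (coef_pos k hv).1 (coef_pos k hv).2).le
  · simp

lemma closure_surf {k : ℝ} (hk : |k| < 1) : closure (surf k) = surf k ∪ edge := by
  have e := closure_coefCurve hk
  rw [surf_eq_graphSet, edge_eq_graphSet, closure_graphSet, e, coefCurve_Ici hk, graphSet_union]
  rw [e]
  exact coefCurve_mul_nonneg hk

lemma edge_subset_triangle : edge ⊆ triangle := by
  rw [edge_eq_graphSet, triangle_eq_graphSet]
  exact graphSet_mono (by simp)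

lemma disjoint_surf_triangle (k : ℝ) : Disjoint (surf k) triangle := by
  rw [surf_eq_graphSet, triangle_eq_graphSet]
  exact disjoint_graphSet (disjoint_coefCurve k)

lemma closure_surf_diff {k : ℝ} (hk : |k| < 1) : closure (surf k) \ surf k = edge := by
  rw [closure_surf hk, union_sdiff_left, sdiff_eq_left]
  exact ((disjoint_surf_triangle k).mono_right edge_subset_triangle).symm

lemma closure_halfPlane_diff : closure halfPlane \ halfPlane = edge := by
  have e : closure ((fun v : ℝ => (v, v)) '' Ioi 0) = (fun v : ℝ => (v, v)) '' Ioi 0 ∪ {(0, 0)} := by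
    have h : (fun v : ℝ => (v, v)) '' Ioi 0 ∪ {(0, 0)} = (fun v : ℝ => (v, v)) '' Ici 0 := by
      rw [← Ioi_insert, insert_eq, union_comm, image_union, image_singleton]
    rw [h]
    apply Subset.antisymm
    · refine closure_minimal (image_mono Ioi_subset_Ici_self) ?_
      have h2 : (fun v : ℝ => (v, v)) '' Ici 0 = {x : ℝ × ℝ | 0 ≤ x.1 ∧ x.1 = x.2} := by
        ext ⟨a, b⟩
        constructor
        · rintro ⟨v, hv, h⟩
          obtain ⟨rfl, rfl⟩ := Prod.mk.inj h
          exact ⟨hv, rfl⟩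
        · rintro ⟨h1, h2⟩
          simp only at h1 h2
          exact ⟨a, h1, by rw [h2]⟩
      rw [h2]
      exact (isClosed_le continuous_const continuous_fst).inter
        (isClosed_eq continuous_fst continuous_snd)
    · rw [← closure_Ioi]
      exact image_closure_subset_closure_image (by fun_prop)
  rw [halfPlane_eq_graphSet, edge_eq_graphSet, closure_graphSet, e, graphSet_union, union_sdiff_left,
    sdiff_eq_left]
  · refine disjoint_graphSet (Set.disjoint_left.2 ?_)
    rintro _ rfl ⟨v, hv, e⟩
    exact hv.ne' (Prod.mk.inj e).1
  · rw [e]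
    rintro _ (⟨v, -, rfl⟩ | rfl)
    · exact mul_self_nonneg v
    · simp

/-- The curve of the surface ends at the origin, which represents the edge and already belongs to
the half-line of the triangle. The union is therefore a closed connected plane set. -/
lemma surf_union_triangle_eq {k : ℝ} (hk : |k| < 1) :
    surf k ∪ triangle = graphSet (coefCurve k '' Ici 0 ∪ Iic 0 ×ˢ {0}) := by
  rw [coefCurve_Ici hk, graphSet_union, graphSet_union, ← surf_eq_graphSet, ← edge_eq_graphSet,
    ← triangle_eq_graphSet, union_assoc, union_eq_self_of_subset_left edge_subset_triangle]

lemma isClosed_surf_union_triangle {k : ℝ} (hk : |k| < 1) : IsClosed (surf k ∪ triangle) := by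
  rw [surf_union_triangle_eq hk]
  refine isClosed_graphSet ((isClosed_coefCurve hk).union (isClosed_Iic.prod isClosed_singleton)) ?_
  rintro x (hx | ⟨-, hx⟩)
  · exact coefCurve_mul_nonneg hk x hx
  · rw [mem_singleton_iff.1 hx, mul_zero]

lemma isConnected_surf_union_triangle {k : ℝ} (hk : |k| < 1) :
    IsConnected (surf k ∪ triangle) := by
  rw [surf_union_triangle_eq hk]
  refine isConnected_graphSet (IsConnected.union ⟨(0, 0), ?_, by simp⟩
    (isConnected_Ici.image _ (continuous_coefCurve hk).continuousOn)
    (isConnected_Iic.prod isConnected_singleton))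
  rw [← coefCurve_zero hk]
  exact mem_image_of_mem _ self_mem_Ici

/-! ### The convex profile of the surface -/

lemma nonneg_of_hasDerivAt {f f' : ℝ → ℝ} (hf : ∀ x, HasDerivAt f (f' x) x) (h0 : f 0 = 0)
    (h : ∀ x, 0 < x → 0 ≤ f' x) {x : ℝ} (hx : 0 ≤ x) : 0 ≤ f x := by
  have hm : MonotoneOn f (Ici 0) := by
    refine monotoneOn_of_deriv_nonneg (convex_Ici 0)
      (fun x _ => (hf x).continuousAt.continuousWithinAt)
      (fun x _ => (hf x).differentiableAt.differentiableWithinAt) fun x hx => ?_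
    rw [interior_Ici] at hx
    rw [(hf x).deriv]
    exact h x hx
  rw [← h0]
  exact hm self_mem_Ici hx hx

lemma cosh_mul_le {k : ℝ} (hk : 0 < k) (hk1 : k < 1) (x : ℝ) : Real.cosh (k * x) ≤ Real.cosh x := by
  rw [Real.cosh_le_cosh, abs_mul, abs_of_pos hk]
  exact mul_le_of_le_one_left (abs_nonneg x) hk1.le

lemma sinh_mul_le {k : ℝ} (hk : 0 < k) (hk1 : k < 1) {x : ℝ} (hx : 0 ≤ x) :
    Real.sinh (k * x) ≤ k * Real.sinh x := by
  have := nonneg_of_hasDerivAt (f := fun x => k * Real.sinh x - Real.sinh (k * x))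
    (f' := fun x => k * Real.cosh x - Real.cosh (k * x) * k)
    (fun x => ((Real.hasDerivAt_sinh x).const_mul k).fun_sub
      (((hasDerivAt_id x).const_mul k).sinh.congr_deriv (by simp))) (by simp)
    (fun x _ => by nlinarith [cosh_mul_le hk hk1 x]) hx
  linarith

/-- The extremal case, as η → ∞, of the tangent line inequality on the side t < η; the derivative is
non-negative because e^{-x} ≤ e^{-kx} = cosh kx - sinh kx. -/
lemma exp_neg_add_sinh_nonneg {k : ℝ} (hk : 0 < k) (hk1 : k < 1) {x : ℝ} (hx : 0 ≤ x) :
    0 ≤ k * Real.exp (-x) - k * Real.cosh (k * x) + Real.sinh (k * x) := by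
  refine nonneg_of_hasDerivAt (f := fun x => k * Real.exp (-x) - k * Real.cosh (k * x) +
      Real.sinh (k * x))
    (f' := fun x => k * (Real.cosh (k * x) - k * Real.sinh (k * x) - Real.exp (-x)))
    (fun x => ?_) (by simp) (fun x hx => ?_) hx
  · have h1 := (hasDerivAt_id x).const_mul k
    refine ((((hasDerivAt_id x).fun_neg.exp).const_mul k).fun_sub (h1.cosh.const_mul k)).fun_add
      h1.sinh |>.congr_deriv ?_
    simp
    ring
  · refine mul_nonneg hk.le ?_
    have h1 : 0 < Real.sinh (k * x) := Real.sinh_pos_iff.2 (by positivity)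
    have h2 : Real.exp (-x) ≤ Real.exp (-(k * x)) := Real.exp_le_exp.2 (by nlinarith)
    rw [← Real.cosh_sub_sinh (k * x)] at h2
    nlinarith

/-- The first coefficient of the support line of the profile at the parameter `η`. -/
def slopeA (k η : ℝ) : ℝ := Real.exp (-(k * η)) * (Real.sinh η + k * Real.cosh η)

/-- The second coefficient of the support line of the profile at the parameter `η`. -/
def slopeD (k η : ℝ) : ℝ := Real.exp (k * η) * (Real.sinh η - k * Real.cosh η)

lemma slopeA_pos {k : ℝ} (hk : 0 < k) {η : ℝ} (hη : 0 < η) : 0 < slopeA k η := by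
  have h1 := Real.sinh_pos_iff.2 hη
  have h2 := Real.cosh_pos η
  rw [slopeA]
  positivity

/-- The profile `(e^{kη}, -e^{-kη}) / cosh η` lies on one side of its tangent lines. -/
lemma tangent_nonneg {k : ℝ} (hk : 0 < k) (hk1 : k < 1) {η : ℝ} (hη : 0 < η) (t : ℝ) :
    0 ≤ 2 * k * Real.cosh t - slopeA k η * Real.exp (k * t) + slopeD k η * Real.exp (-(k * t)) := by
  have hs := Real.sinh_pos_iff.2 hη
  have hc := Real.cosh_pos η
  have e1 : Real.exp (-(k * η)) * Real.exp (k * t) =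
      Real.cosh (k * (t - η)) + Real.sinh (k * (t - η)) := by
    rw [Real.cosh_add_sinh, ← Real.exp_add]; congr 1; ring
  have e2 : Real.exp (k * η) * Real.exp (-(k * t)) =
      Real.cosh (k * (t - η)) - Real.sinh (k * (t - η)) := by
    rw [Real.cosh_sub_sinh, ← Real.exp_add]; congr 1; ring
  have e3 : Real.cosh t = Real.cosh (t - η) * Real.cosh η + Real.sinh (t - η) * Real.sinh η := by
    rw [← Real.cosh_add, sub_add_cancel]
  -- Addition formulas recentre everything at x = t - η. For x ≥ 0 both brackets are non-negative;
  -- for x < 0 the first one is not.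
  have key : 2 * k * Real.cosh t - slopeA k η * Real.exp (k * t) +
      slopeD k η * Real.exp (-(k * t)) = 2 * (Real.sinh η * (k * Real.sinh (t - η) -
        Real.sinh (k * (t - η))) + k * Real.cosh η * (Real.cosh (t - η) - Real.cosh (k * (t - η)))) := by
    rw [slopeA, slopeD, e3]
    linear_combination (-(Real.sinh η + k * Real.cosh η)) * e1 +
      (Real.sinh η - k * Real.cosh η) * e2
  rw [key]
  have h1 := cosh_mul_le hk hk1 (t - η)
  rcases le_total 0 (t - η) with h | h
  · have h2 := sinh_mul_le hk hk1 h
    have h3 := mul_nonneg hs.le (sub_nonneg.2 h2)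
    have h4 := mul_nonneg (mul_pos hk hc).le (sub_nonneg.2 h1)
    linarith
  · obtain ⟨σ, hσ⟩ : ∃ σ, t - η = -σ := ⟨-(t - η), by ring⟩
    rw [hσ] at h h1 ⊢
    have hσ0 : 0 ≤ σ := by linarith
    rw [mul_neg, Real.cosh_neg, Real.cosh_neg, Real.sinh_neg, Real.sinh_neg]
    have h2 := sinh_mul_le hk hk1 hσ0
    have h3 := exp_neg_add_sinh_nonneg hk hk1 hσ0
    rw [← Real.cosh_sub_sinh σ] at h3
    have h4 := mul_nonneg hc.le h3
    -- The non-positive bracket is multiplied by sinh η, so replacing this factor by the larger cosh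
    -- η can only decrease the sum, and the inequality of `exp_neg_add_sinh_nonneg` remains.
    have h5 : Real.sinh η ≤ Real.cosh η := (Real.sinh_lt_cosh η).le
    nlinarith [mul_nonneg (sub_nonneg.2 h5) (sub_nonneg.2 h2)]

lemma tangent_eq (k η : ℝ) :
    2 * k * Real.cosh η - slopeA k η * Real.exp (k * η) + slopeD k η * Real.exp (-(k * η)) = 0 := by
  have e : Real.exp (-(k * η)) * Real.exp (k * η) = 1 := by rw [← Real.exp_add]; simp
  rw [slopeA, slopeD]
  linear_combination (-2 * k * Real.cosh η) * e

/-- The first coordinate of the profile. -/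
def profX (k t : ℝ) : ℝ := Real.exp (k * t) / Real.cosh t

/-- The second coordinate of the profile. -/
def profY (k t : ℝ) : ℝ := -(Real.exp (-(k * t)) / Real.cosh t)

lemma continuous_profX (k : ℝ) : Continuous (profX k) :=
  Continuous.div (by fun_prop) Real.continuous_cosh fun t => (Real.cosh_pos t).ne'

lemma continuous_profY (k : ℝ) : Continuous (profY k) :=
  (Continuous.div (by fun_prop) Real.continuous_cosh fun t => (Real.cosh_pos t).ne').neg

lemma profX_pos (k t : ℝ) : 0 < profX k t := div_pos (Real.exp_pos _) (Real.cosh_pos t)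

lemma profY_neg (k t : ℝ) : profY k t < 0 := neg_neg_of_pos (div_pos (Real.exp_pos _) (Real.cosh_pos t))

lemma profX_mul_profY (k t : ℝ) : profX k t * profY k t = -(1 / Real.cosh t ^ 2) := by
  have e : Real.exp (k * t) * Real.exp (-(k * t)) = 1 := by rw [← Real.exp_add]; simp
  have := Real.cosh_pos t
  rw [profX, profY, mul_neg, div_mul_div_comm, e, sq]

lemma profY_lt {k : ℝ} (hk : 0 < k) {t t' : ℝ} (ht : 0 ≤ t) (h : t < t') :
    profY k t < profY k t' := by
  have h1 : Real.cosh t < Real.cosh t' := Real.cosh_strictMonoOn ht (ht.trans h.le) h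
  rw [profY, profY, neg_lt_neg_iff]
  refine div_lt_div₀ (Real.exp_lt_exp.2 (by nlinarith)) h1.le (Real.exp_pos _).le (Real.cosh_pos t)

lemma neg_one_lt_profY {k : ℝ} (hk : 0 < k) {t : ℝ} (ht : 0 < t) : -1 < profY k t := by
  have h := profY_lt hk le_rfl ht
  simpa [profY] using h

lemma exists_profY_eq {k : ℝ} (hk : 0 < k) {y : ℝ} (hy : -1 < y) (hy' : y < 0) :
    ∃ t > 0, profY k t = y := by
  have h0 : profY k 0 = -1 := by simp [profY]
  obtain ⟨T, hT, hyT⟩ : ∃ T > 0, y < profY k T := by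
    refine ⟨(k * -y)⁻¹, by have : 0 < -y := by linarith
                           positivity, ?_⟩
    -- With kT = 1/(-y), the inequality e^x > x gives e^{-kT} < -y.
    set T := (k * -y)⁻¹ with hT
    have hy2 : 0 < -y := by linarith
    have hT0 : 0 < T := by positivity
    have h1 : profY k T ≥ -Real.exp (-(k * T)) := by
      rw [profY, ge_iff_le, neg_le_neg_iff]
      exact div_le_self (Real.exp_pos _).le (Real.one_le_cosh T)
    have h2 : Real.exp (-(k * T)) < -y := by
      rw [Real.exp_neg, inv_lt_comm₀ (Real.exp_pos _) hy2]
      have h3 := Real.add_one_lt_exp (x := k * T) (by positivity)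
      have h4 : k * T = (-y)⁻¹ := by rw [hT, mul_inv]; field_simp
      rw [h4] at h3 ⊢
      linarith
    linarith
  obtain ⟨t, ht, rfl⟩ := intermediate_value_Ioo hT.le (continuous_profY k).continuousOn
    (show y ∈ Ioo (profY k 0) (profY k T) by rw [h0]; exact ⟨hy, hyT⟩)
  exact ⟨t, ht.1, rfl⟩

/-! ### The convex set -/

/-- The square root of the product of the off-diagonal entries of `(a, -b; c, d)`. -/
def offDiag (M : M2) : ℝ := √(-(M 0 1 * M 1 0))

/-- The concave function whose non-negativity bounds the convex set, at the parameter `η`. -/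
def supportFun (k η : ℝ) (M : M2) : ℝ :=
  2 * k * offDiag M - slopeA k η * M 0 0 - slopeD k η * M 1 1

/-- The linear form defining the affine chart. -/
def chartForm : M2 →ₗ[ℝ] ℝ where
  toFun M := M 1 0 - M 0 1
  map_add' M N := by simp; ring
  map_smul' r M := by simp; ring

lemma chartForm_apply (M : M2) : chartForm M = M 1 0 - M 0 1 := rfl

/-- The region of the affine chart where the boundary of the convex set is considered. -/
def chartRegion : Set M2 := {M | M 0 1 < 0 ∧ 0 < M 1 0 ∧ 0 < offDiag M + M 1 1}

/-- The convex set bounded by the surface and by the lightlike triangle. -/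
def convexSet (k : ℝ) : Set M2 :=
  {M | chartForm M = 1 ∧ M ∈ chartRegion ∧ M 1 1 ≤ 0 ∧ ∀ η > 0, 0 ≤ supportFun k η M}

lemma continuous_offDiag : Continuous offDiag := by unfold offDiag; fun_prop

lemma continuous_supportFun (k η : ℝ) : Continuous (supportFun k η) := by
  have := continuous_offDiag
  unfold supportFun
  fun_prop

lemma isOpen_chartRegion : IsOpen chartRegion := by
  have h := continuous_offDiag
  exact (isOpen_lt (f := fun M : M2 => M 0 1) (by fun_prop) continuous_const).inter
    ((isOpen_lt (g := fun M : M2 => M 1 0) continuous_const (by fun_prop)).inter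
      (isOpen_lt (g := fun M : M2 => offDiag M + M 1 1) continuous_const (by fun_prop)))

lemma offDiag_sq {M : M2} (h : M 0 1 < 0) (h' : 0 < M 1 0) : offDiag M ^ 2 = -(M 0 1 * M 1 0) :=
  Real.sq_sqrt (neg_nonneg.2 (mul_neg_of_neg_of_pos h h').le)

lemma offDiag_pos {M : M2} (h : M 0 1 < 0) (h' : 0 < M 1 0) : 0 < offDiag M :=
  Real.sqrt_pos.2 (neg_pos.2 (mul_neg_of_neg_of_pos h h'))

lemma two_mul_offDiag_le {M N : M2} (hM : M 0 1 < 0) (hM' : 0 < M 1 0) (hN : N 0 1 < 0)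
    (hN' : 0 < N 1 0) :
    2 * (offDiag M * offDiag N) ≤ -(M 0 1 * N 1 0) - N 0 1 * M 1 0 := by
  have h1 := offDiag_sq hM hM'
  have h2 := offDiag_sq hN hN'
  have h3 := mul_neg_of_neg_of_pos hM hN'
  have h4 := mul_neg_of_neg_of_pos hN hM'
  refine abs_le_of_sq_le_sq' ?_ (by linarith) |>.2
  have e : (2 * (offDiag M * offDiag N)) ^ 2 = 4 * ((M 0 1 * N 1 0) * (N 0 1 * M 1 0)) := by
    rw [mul_pow, mul_pow, h1, h2]; ring
  rw [e]
  nlinarith [sq_nonneg (M 0 1 * N 1 0 - N 0 1 * M 1 0)]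

/-- Concavity of the geometric mean √(bc): after squaring, the cross terms are compared by the
arithmetic-geometric inequality `two_mul_offDiag_le`. -/
lemma offDiag_concave {M N : M2} (hM : M 0 1 < 0) (hM' : 0 < M 1 0) (hN : N 0 1 < 0)
    (hN' : 0 < N 1 0) {s t : ℝ} (hs : 0 ≤ s) (ht : 0 ≤ t) :
    s * offDiag M + t * offDiag N ≤ offDiag (s • M + t • N) := by
  refine Real.le_sqrt_of_sq_le ?_
  have h1 := offDiag_sq hM hM'
  have h2 := offDiag_sq hN hN'
  have h3 := mul_le_mul_of_nonneg_left (two_mul_offDiag_le hM hM' hN hN') (mul_nonneg hs ht)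
  simp only [Matrix.add_apply, Matrix.smul_apply, smul_eq_mul]
  linear_combination s ^ 2 * h1 + t ^ 2 * h2 + h3

/-- Each defining condition is linear or is a lower bound on a concave function, the concavity being
that of p = √(bc), whose coefficient 2k in `supportFun` is positive. -/
lemma convex_convexSet {k : ℝ} (hk : 0 < k) : Convex ℝ (convexSet k) := by
  rintro M ⟨h1, ⟨h2, h3, h4⟩, h5, h6⟩ N ⟨g1, ⟨g2, g3, g4⟩, g5, g6⟩ s t hs ht hst
  have hc := offDiag_concave h2 h3 g2 g3 hs ht
  have pos : ∀ x y : ℝ, 0 < x → 0 < y → 0 < s * x + t * y := by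
    intro x y hx hy
    rcases eq_or_lt_of_le hs with rfl | hs
    · have : t = 1 := by linarith
      rw [this]; linarith
    · have := mul_pos hs hx
      have := mul_nonneg ht hy.le
      linarith
  refine ⟨?_, ⟨?_, ?_, ?_⟩, ?_, fun η hη => ?_⟩
  · rw [map_add, map_smul, map_smul, h1, g1]
    simpa using hst
  · have := pos _ _ (neg_pos.2 h2) (neg_pos.2 g2)
    simp only [Matrix.add_apply, Matrix.smul_apply, smul_eq_mul]
    linarith
  · simpa using pos _ _ h3 g3
  · have := pos _ _ h4 g4
    simp only [Matrix.add_apply, Matrix.smul_apply, smul_eq_mul]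
    linarith
  · have e1 := mul_nonneg hs (neg_nonneg.2 h5)
    have e2 := mul_nonneg ht (neg_nonneg.2 g5)
    simp only [Matrix.add_apply, Matrix.smul_apply, smul_eq_mul]
    linarith
  · have e1 := mul_nonneg hs (h6 η hη)
    have e2 := mul_nonneg ht (g6 η hη)
    simp only [supportFun, Matrix.add_apply, Matrix.smul_apply, smul_eq_mul] at e1 e2 ⊢
    nlinarith

/-- Divided by p, the function `supportFun` is an affine function of (a, d)/p that is non-negative
on the profile by `tangent_nonneg`; as `slopeA` is positive, it stays so when a decreases. -/
lemma supportFun_nonneg {k : ℝ} (hk : 0 < k) (hk1 : k < 1) {M : M2} (hp : 0 < offDiag M) {t : ℝ}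
    (h11 : M 1 1 = offDiag M * profY k t) (h00 : M 0 0 ≤ offDiag M * profX k t) {η : ℝ}
    (hη : 0 < η) : 0 ≤ supportFun k η M := by
  have hc := Real.cosh_pos t
  have h1 := tangent_nonneg hk hk1 hη t
  have h2 := mul_le_mul_of_nonneg_left h00 (slopeA_pos hk hη).le
  have h3 : 0 ≤ offDiag M / Real.cosh t * (2 * k * Real.cosh t - slopeA k η * Real.exp (k * t) +
    slopeD k η * Real.exp (-(k * t))) := mul_nonneg (by positivity) h1
  have h4 : offDiag M / Real.cosh t * (2 * k * Real.cosh t - slopeA k η * Real.exp (k * t) +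
    slopeD k η * Real.exp (-(k * t))) = 2 * k * offDiag M - slopeA k η * (offDiag M * profX k t)
      - slopeD k η * (offDiag M * profY k t) := by
    rw [profX, profY]
    field_simp
    ring
  rw [supportFun, h11]
  linarith

lemma le_of_supportFun_nonneg {k : ℝ} (hk : 0 < k) {M : M2} {t : ℝ} (ht : 0 < t)
    (h11 : M 1 1 = offDiag M * profY k t) (h : 0 ≤ supportFun k t M) :
    M 0 0 ≤ offDiag M * profX k t := by
  have hc := Real.cosh_pos t
  have h4 : offDiag M / Real.cosh t * (2 * k * Real.cosh t - slopeA k t * Real.exp (k * t) +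
    slopeD k t * Real.exp (-(k * t))) = 2 * k * offDiag M - slopeA k t * (offDiag M * profX k t)
      - slopeD k t * (offDiag M * profY k t) := by
    rw [profX, profY]
    field_simp
    ring
  rw [tangent_eq, mul_zero] at h4
  rw [supportFun, h11] at h
  refine le_of_mul_le_mul_left ?_ (slopeA_pos hk ht)
  linarith

/-- Inside the region, the points of the convex set lie below the flat face or below the profile. -/
lemma mem_convexSet_iff {k : ℝ} (hk : 0 < k) (hk1 : k < 1) {M : M2} (hM : M ∈ chartRegion)
    (h1 : chartForm M = 1) : M ∈ convexSet k ↔ (M 1 1 = 0 ∧ M 0 0 ≤ 0) ∨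
      ∃ t > 0, M 1 1 = offDiag M * profY k t ∧ M 0 0 ≤ offDiag M * profX k t := by
  have hp := offDiag_pos hM.1 hM.2.1
  constructor
  · rintro ⟨-, -, h2, h3⟩
    rcases eq_or_lt_of_le h2 with h2 | h2
    · refine Or.inl ⟨h2, ?_⟩
      by_contra! h
      -- On the face d = 0 the constraints read `slopeA` · a ≤ 2kp. Since `slopeA` is at least k
      -- e^{(1-k)η}, it tends to infinity and excludes a > 0.
      obtain ⟨η, hη, hlt⟩ : ∃ η > 0, 2 * k * offDiag M < slopeA k η * M 0 0 := by
        have hlim : Tendsto (fun η => Real.exp ((1 - k) * η)) atTop atTop :=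
          Real.tendsto_exp_atTop.comp (tendsto_id.const_mul_atTop (by linarith))
        obtain ⟨η, h4, h5⟩ := ((hlim.eventually_gt_atTop (2 * offDiag M / M 0 0)).and
          (eventually_gt_atTop 0)).exists
        refine ⟨η, h5, ?_⟩
        rw [div_lt_iff₀ h] at h4
        have h6 : k * Real.exp ((1 - k) * η) ≤ slopeA k η := by
          have h8 := Real.sinh_pos_iff.2 h5
          have e : Real.exp ((1 - k) * η) = Real.exp (-(k * η)) * (Real.cosh η + Real.sinh η) := by
            rw [Real.cosh_add_sinh, ← Real.exp_add]; congr 1; ring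
          rw [e, slopeA, mul_left_comm]
          refine mul_le_mul_of_nonneg_left ?_ (Real.exp_pos _).le
          nlinarith
        have h7 := mul_le_mul_of_nonneg_right h6 h.le
        nlinarith
      have := h3 η hη
      rw [supportFun, h2, mul_zero, sub_zero] at this
      linarith
    · obtain ⟨t, ht, e⟩ := exists_profY_eq hk (y := M 1 1 / offDiag M)
        (by rw [lt_div_iff₀ hp]; linarith [hM.2.2]) (div_neg_of_neg_of_pos h2 hp)
      have e' : M 1 1 = offDiag M * profY k t := by rw [e]; field_simp
      exact Or.inr ⟨t, ht, e', le_of_supportFun_nonneg hk ht e' (h3 t ht)⟩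
  · rintro (⟨h2, h3⟩ | ⟨t, ht, h2, h3⟩)
    · refine ⟨h1, hM, h2.le, fun η hη => ?_⟩
      have := mul_nonneg (slopeA_pos hk hη).le (neg_nonneg.2 h3)
      rw [supportFun, h2]
      nlinarith
    · refine ⟨h1, hM, ?_, fun η hη => supportFun_nonneg hk hk1 hp h2 h3 hη⟩
      rw [h2]
      exact (mul_neg_of_pos_of_neg hp (profY_neg k t)).le

/-- The determinant is p² + ad. On the flat face it is p²; elsewhere d = p · `profY` < 0 and a ≤ p ·
`profX` give -ad ≤ p² / cosh² t < p². -/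
lemma convexSet_subset_chart {k : ℝ} (hk : 0 < k) (hk1 : k < 1) :
    convexSet k ⊆ chart chartForm := by
  intro M hM
  have hp := offDiag_pos hM.2.1.1 hM.2.1.2.1
  have hp2 := offDiag_sq hM.2.1.1 hM.2.1.2.1
  refine ⟨hM.1, ?_⟩
  rw [Matrix.det_fin_two]
  rcases (mem_convexSet_iff hk hk1 hM.2.1 hM.1).1 hM with ⟨h1, -⟩ | ⟨t, ht, h1, h2⟩
  · rw [h1, mul_zero]
    have := sq_pos_of_pos hp
    linarith
  · have h3 := mul_le_mul_of_nonneg_left h2 (neg_nonneg.2 (profY_neg k t).le)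
    have h4 := profX_mul_profY k t
    have h5 : 1 / Real.cosh t ^ 2 < 1 := by
      rw [div_lt_one (by positivity)]
      have := Real.one_lt_cosh.2 ht.ne'
      nlinarith
    have h6 : -M 0 0 * M 1 1 ≤ offDiag M ^ 2 * (1 / Real.cosh t ^ 2) := by
      rw [h1]
      have := mul_le_mul_of_nonneg_left h3 hp.le
      have e : offDiag M * (-profY k t * (offDiag M * profX k t)) =
        offDiag M ^ 2 * (1 / Real.cosh t ^ 2) := by linear_combination (-offDiag M ^ 2) * h4
      linarith
    have h7 := mul_lt_mul_of_pos_left h5 (sq_pos_of_pos hp)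
    linarith

/-! ### The surface and the triangle in the affine chart -/

lemma Represents.exists_smul {M N : M2} {γ : AdS} (h : Represents M γ) (hN : IsLift N γ) :
    ∃ r : ℝ, r ≠ 0 ∧ M = r • N := by
  obtain ⟨g, rfl, r, hr, rfl⟩ := h
  rcases hN.eq_or_neg (isLift_cls g) with e | e
  · exact ⟨r, hr, by rw [e]⟩
  · exact ⟨-r, neg_ne_zero.2 hr, by rw [e, smul_neg, neg_smul]⟩

lemma IsLift.represents {N : M2} {γ : AdS} (hN : IsLift N γ) {r : ℝ} (hr : r ≠ 0) :
    Represents (r • N) γ := by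
  obtain ⟨g, rfl, rfl⟩ := hN
  exact ⟨g, rfl, r, hr, rfl⟩

/-- The cone over the surface. -/
def coneMat (k η u : ℝ) : M2 :=
  !![Real.exp (k * η), -(Real.exp u * Real.cosh η); Real.exp (-u) * Real.cosh η,
    -Real.exp (-(k * η))]

lemma curveMat_eq_smul (k η u : ℝ) : curveMat k η u = (Real.sinh η)⁻¹ • coneMat k η u := by
  ext i j
  fin_cases i <;> fin_cases j <;> simp [curveMat, coneMat] <;> ring

lemma chartForm_coneMat (k η u : ℝ) :
    chartForm (coneMat k η u) = Real.cosh η * (Real.exp u + Real.exp (-u)) := by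
  rw [chartForm_apply]
  simp [coneMat]
  ring

lemma chartForm_coneMat_pos (k η u : ℝ) : 0 < chartForm (coneMat k η u) := by
  have := Real.cosh_pos η
  rw [chartForm_coneMat]
  positivity

lemma mem_inChart_surf {k : ℝ} {M : M2} : M ∈ inChart chartForm (surf k) ↔
    chartForm M = 1 ∧ ∃ η > 0, ∃ u, ∃ r : ℝ, 0 < r ∧ M = r • coneMat k η u := by
  constructor
  · rintro ⟨h1, γ, ⟨η, hη, u, h⟩, hM⟩
    have hs := Real.sinh_pos_iff.2 hη
    obtain ⟨r, hr, rfl⟩ := hM.exists_smul h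
    refine ⟨h1, η, hη, u, r * (Real.sinh η)⁻¹, ?_, by rw [curveMat_eq_smul, smul_smul]⟩
    have h2 := chartForm_coneMat_pos k η u
    rw [curveMat_eq_smul, smul_smul, map_smul, smul_eq_mul] at h1
    by_contra! hc
    nlinarith
  · rintro ⟨h1, η, hη, u, r, hr, rfl⟩
    have hs := Real.sinh_pos_iff.2 hη
    obtain ⟨γ, hγ⟩ := exists_isLift_of_det (det_curveMat k u hη)
    refine ⟨h1, γ, ⟨η, hη, u, hγ⟩, ?_⟩
    have e : r • coneMat k η u = (r * Real.sinh η) • curveMat k η u := by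
      rw [curveMat_eq_smul, smul_smul, mul_assoc, mul_inv_cancel₀ hs.ne', mul_one]
    rw [e]
    exact hγ.represents (by positivity)

lemma offDiag_smul_coneMat (k η u : ℝ) {r : ℝ} (hr : 0 < r) :
    offDiag (r • coneMat k η u) = r * Real.cosh η := by
  have hc := Real.cosh_pos η
  have e : Real.exp u * Real.exp (-u) = 1 := by rw [← Real.exp_add]; simp
  rw [offDiag, ← Real.sqrt_sq (show 0 ≤ r * Real.cosh η by positivity)]
  congr 1
  simp [coneMat]
  linear_combination (r * Real.cosh η) ^ 2 * e

lemma smul_coneMat_entries (k η u : ℝ) {r : ℝ} (hr : 0 < r) :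
    (r • coneMat k η u) 0 1 < 0 ∧ 0 < (r • coneMat k η u) 1 0 ∧
      (r • coneMat k η u) 1 1 = offDiag (r • coneMat k η u) * profY k η ∧
      (r • coneMat k η u) 0 0 = offDiag (r • coneMat k η u) * profX k η := by
  have hc := Real.cosh_pos η
  rw [offDiag_smul_coneMat k η u hr, profX, profY]
  refine ⟨?_, ?_, ?_, ?_⟩
  · simp [coneMat]; positivity
  · simp [coneMat]; positivity
  · simp [coneMat]; field_simp
  · simp [coneMat]; field_simp

lemma mem_inChart_surf' {k : ℝ} {M : M2} : M ∈ inChart chartForm (surf k) ↔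
    chartForm M = 1 ∧ M 0 1 < 0 ∧ 0 < M 1 0 ∧
      ∃ t > 0, M 1 1 = offDiag M * profY k t ∧ M 0 0 = offDiag M * profX k t := by
  rw [mem_inChart_surf]
  constructor
  · rintro ⟨h1, η, hη, u, r, hr, rfl⟩
    obtain ⟨h2, h3, h4, h5⟩ := smul_coneMat_entries k η u hr
    exact ⟨h1, h2, h3, η, hη, h4, h5⟩
  · rintro ⟨h1, h2, h3, t, ht, h4, h5⟩
    have hp := offDiag_pos h2 h3
    have hp2 := offDiag_sq h2 h3
    have hc := Real.cosh_pos t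
    have e1 : Real.exp (Real.log (M 1 0 / offDiag M)) = M 1 0 / offDiag M :=
      Real.exp_log (by positivity)
    refine ⟨h1, t, ht, -Real.log (M 1 0 / offDiag M), offDiag M / Real.cosh t, by positivity, ?_⟩
    ext i j
    fin_cases i <;> fin_cases j <;> simp only [coneMat, Fin.zero_eta, Fin.mk_one, Fin.isValue,
      Matrix.smul_apply, smul_eq_mul, Matrix.of_apply, Matrix.cons_val', Matrix.cons_val_zero,
      Matrix.cons_val_one, Matrix.cons_val_fin_one, neg_neg, e1, h4, h5, profX, profY,
      Real.exp_neg (Real.log _)]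
    · field_simp
    · field_simp
      linarith
    · field_simp
    · field_simp

lemma mem_inChart_triangle {M : M2} : M ∈ inChart chartForm triangle ↔
    chartForm M = 1 ∧ M 0 1 < 0 ∧ 0 < M 1 0 ∧ M 1 1 = 0 ∧ M 0 0 ≤ 0 := by
  constructor
  · rintro ⟨h1, γ, hγ, hM⟩
    rw [triangle_eq_graphSet] at hγ
    obtain ⟨N, hN, hc, h0, h11⟩ := hγ
    have h11 : N 1 1 = 0 := neg_eq_zero.1 h11
    have h0 : N 0 0 ≤ 0 := h0
    have hd := hN.det_eq'
    rw [h11, mul_zero] at hd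
    have h01 : N 0 1 < 0 := by
      by_contra! h
      nlinarith [mul_nonneg h hc.le]
    obtain ⟨r, hr, rfl⟩ := hM.exists_smul hN
    have hr' : 0 < r := by
      rw [map_smul, chartForm_apply, smul_eq_mul] at h1
      by_contra! h
      nlinarith
    simp only [Matrix.smul_apply, smul_eq_mul]
    exact ⟨h1, mul_neg_of_pos_of_neg hr' h01, mul_pos hr' hc, by rw [h11, mul_zero],
      mul_nonpos_of_nonneg_of_nonpos hr'.le h0⟩
  · rintro ⟨h1, h01, h10, h11, h00⟩
    have hp := offDiag_pos h01 h10
    have hp2 := offDiag_sq h01 h10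
    obtain ⟨γ, hγ⟩ := exists_isLift_of_det (M := (offDiag M)⁻¹ • M) (by
      rw [Matrix.det_smul, Matrix.det_fin_two, h11, Fintype.card_fin]
      field_simp
      linarith)
    refine ⟨h1, γ, ?_, ?_⟩
    · rw [triangle_eq_graphSet]
      refine ⟨_, hγ, ?_, ?_, ?_⟩
      · simp only [Matrix.smul_apply, smul_eq_mul]
        positivity
      · simp only [Matrix.smul_apply, smul_eq_mul, mem_Iic]
        exact mul_nonpos_of_nonneg_of_nonpos (by positivity) h00
      · simp [h11]
    · have h := hγ.represents hp.ne'
      rwa [smul_smul, mul_inv_cancel₀ hp.ne', one_smul] at h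

lemma inChart_union (ℓ : M2 →ₗ[ℝ] ℝ) (S T : Set AdS) :
    inChart ℓ (S ∪ T) = inChart ℓ S ∪ inChart ℓ T := by
  ext M
  constructor
  · rintro ⟨h1, γ, h | h, hM⟩
    · exact Or.inl ⟨h1, γ, h, hM⟩
    · exact Or.inr ⟨h1, γ, h, hM⟩
  · rintro (⟨h1, γ, h, hM⟩ | ⟨h1, γ, h, hM⟩)
    · exact ⟨h1, γ, Or.inl h, hM⟩
    · exact ⟨h1, γ, Or.inr h, hM⟩

lemma mem_chartRegion_of_profY {k : ℝ} (hk : 0 < k) {M : M2} (h01 : M 0 1 < 0) (h10 : 0 < M 1 0)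
    {t : ℝ} (ht : 0 < t) (h : M 1 1 = offDiag M * profY k t) : M ∈ chartRegion := by
  refine ⟨h01, h10, ?_⟩
  have h1 := neg_one_lt_profY hk ht
  have hp := offDiag_pos h01 h10
  rw [h]
  nlinarith

lemma mem_chartRegion_of_zero {M : M2} (h01 : M 0 1 < 0) (h10 : 0 < M 1 0) (h : M 1 1 = 0) :
    M ∈ chartRegion :=
  ⟨h01, h10, by rw [h, add_zero]; exact offDiag_pos h01 h10⟩

lemma inChart_subset_convexSet {k : ℝ} (hk : 0 < k) (hk1 : k < 1) :
    inChart chartForm (surf k ∪ triangle) ⊆ chartRegion ∩ convexSet k := by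
  rw [inChart_union]
  rintro M (h | h)
  · obtain ⟨h1, h2, h3, t, ht, h4, h5⟩ := mem_inChart_surf'.1 h
    have hr := mem_chartRegion_of_profY hk h2 h3 ht h4
    exact ⟨hr, (mem_convexSet_iff hk hk1 hr h1).2 (Or.inr ⟨t, ht, h4, h5.le⟩)⟩
  · obtain ⟨h1, h2, h3, h4, h5⟩ := mem_inChart_triangle.1 h
    have hr := mem_chartRegion_of_zero h2 h3 h4
    exact ⟨hr, (mem_convexSet_iff hk hk1 hr h1).2 (Or.inl ⟨h4, h5⟩)⟩

/-! ### The frontier of the convex set -/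

lemma mem_chartFrontier_of_ray {ℓ : M2 →ₗ[ℝ] ℝ} {K : Set M2} {M E : M2} (hM : M ∈ K)
    (h1 : ℓ M = 1) (hE : ℓ E = 0) (h : ∀ ε > (0 : ℝ), M + ε • E ∉ K) : M ∈ chartFrontier ℓ K := by
  refine ⟨⟨M, h1⟩, ⟨subset_closure hM, fun hi => ?_⟩, rfl⟩
  let f : ℝ → {M : M2 // ℓ M = 1} := fun ε => ⟨M + ε • E, by simp [h1, hE]⟩
  have hf : Continuous f := by
    refine Continuous.subtype_mk ?_ _
    fun_prop
  have h0 : f 0 = ⟨M, h1⟩ := Subtype.ext (by simp [f])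
  have h2 : ∀ᶠ ε in 𝓝 (0 : ℝ), f ε ∈ (Subtype.val ⁻¹' K : Set {M : M2 // ℓ M = 1}) :=
    hf.continuousAt.eventually_mem (by rw [h0]; exact mem_interior_iff_mem_nhds.1 hi)
  obtain ⟨ε, hε, hε'⟩ := ((h2.filter_mono nhdsWithin_le_nhds).and
    (self_mem_nhdsWithin (s := Ioi (0 : ℝ)))).exists
  exact h ε hε' hε

/-- Inside the open region, the remaining conditions defining the convex set are closed. -/
lemma mem_convexSet_of_closure {k : ℝ} {M : M2} (h1 : chartForm M = 1) (hr : M ∈ chartRegion)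
    (h : (⟨M, h1⟩ : {M : M2 // chartForm M = 1}) ∈ closure (Subtype.val ⁻¹' convexSet k)) :
    M ∈ convexSet k := by
  have hc : IsClosed {M : M2 | M 1 1 ≤ 0 ∧ ∀ η > 0, 0 ≤ supportFun k η M} := by
    have e : {M : M2 | M 1 1 ≤ 0 ∧ ∀ η > 0, 0 ≤ supportFun k η M} =
        {M : M2 | M 1 1 ≤ 0} ∩ ⋂ η, ⋂ (_ : η > 0), {M : M2 | 0 ≤ supportFun k η M} := by
      ext M; simp
    rw [e]
    exact (isClosed_le (f := fun M : M2 => M 1 1) (by fun_prop) continuous_const).inter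
      (isClosed_iInter fun η => isClosed_iInter fun _ =>
        isClosed_le continuous_const (continuous_supportFun k η))
  have h2 := closure_minimal (s := (Subtype.val ⁻¹' convexSet k : Set {M : M2 // chartForm M = 1}))
    (t := Subtype.val ⁻¹' {M : M2 | M 1 1 ≤ 0 ∧ ∀ η > 0, 0 ≤ supportFun k η M})
    (fun x hx => ⟨hx.2.2.1, hx.2.2.2⟩) (hc.preimage continuous_subtype_val) h
  exact ⟨h1, hr, h2.1, h2.2⟩

/-- Strictly below the profile, a small perturbation of d/p changes the parameter t by little,
because `profY` is continuous and strictly increasing, and `profX` stays above a level x chosen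
strictly between. -/
lemma convexSet_mem_nhds {k : ℝ} (hk : 0 < k) (hk1 : k < 1) {M : M2} (hr : M ∈ chartRegion)
    {t : ℝ} (ht : 0 < t) (h11 : M 1 1 = offDiag M * profY k t)
    (h00 : M 0 0 < offDiag M * profX k t) :
    ∀ᶠ N in 𝓝 M, chartForm N = 1 → N ∈ convexSet k := by
  have hp := offDiag_pos hr.1 hr.2.1
  obtain ⟨x, hx, hx'⟩ := exists_between (show M 0 0 / offDiag M < profX k t by
    rw [div_lt_iff₀ hp]; linarith)
  rw [div_lt_iff₀ hp] at hx
  obtain ⟨ε, hε, hball⟩ := Metric.eventually_nhds_iff.1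
    ((continuous_profX k).continuousAt.eventually_const_lt hx')
  have hε2 : 0 < min ε t / 2 := by have := lt_min hε ht; positivity
  have hε3 : min ε t / 2 < ε := by have := min_le_left ε t; linarith
  have hε4 : min ε t / 2 < t := by have := min_le_right ε t; linarith
  generalize min ε t / 2 = δ at hε2 hε3 hε4
  have hY1 := profY_lt hk (t := t - δ) (t' := t) (by linarith) (by linarith)
  have hY2 := profY_lt hk (t := t) (t' := t + δ) ht.le (by linarith)
  have cp := continuous_offDiag
  have c00 : Continuous fun N : M2 => N 0 0 := by fun_prop
  have c11 : Continuous fun N : M2 => N 1 1 := by fun_prop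
  have e1 : ∀ᶠ N in 𝓝 M, N 0 0 < x * offDiag N :=
    c00.continuousAt.eventually_lt (continuous_const.mul cp).continuousAt hx
  have e2 : ∀ᶠ N in 𝓝 M, offDiag N * profY k (t - δ) < N 1 1 :=
    (cp.mul continuous_const).continuousAt.eventually_lt c11.continuousAt
      (h11 ▸ mul_lt_mul_of_pos_left hY1 hp)
  have e3 : ∀ᶠ N in 𝓝 M, N 1 1 < offDiag N * profY k (t + δ) :=
    c11.continuousAt.eventually_lt (cp.mul continuous_const).continuousAt
      (h11 ▸ mul_lt_mul_of_pos_left hY2 hp)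
  filter_upwards [e1, e2, e3, isOpen_chartRegion.mem_nhds hr] with N h1 h2 h3 h4 h5
  have hpN := offDiag_pos h4.1 h4.2.1
  obtain ⟨τ, hτ, e⟩ := intermediate_value_Ioo (show t - δ ≤ t + δ by linarith)
    (continuous_profY k).continuousOn (show N 1 1 / offDiag N ∈ _ from
      ⟨by rw [lt_div_iff₀ hpN]; linarith, by rw [div_lt_iff₀ hpN]; linarith⟩)
  refine (mem_convexSet_iff hk hk1 h4 h5).2 (Or.inr ⟨τ, by linarith [hτ.1], ?_, ?_⟩)
  · rw [e]; field_simp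
  · have h6 := hball (y := τ) (by
      rw [Real.dist_eq, abs_lt]
      constructor <;> linarith [hτ.1, hτ.2])
    have h7 := mul_lt_mul_of_pos_right h6 hpN
    linarith

lemma inChart_eq {k : ℝ} (hk : 0 < k) (hk1 : k < 1) :
    inChart chartForm (surf k ∪ triangle) =
      chartRegion ∩ chart chartForm ∩ chartFrontier chartForm (convexSet k) := by
  apply Subset.antisymm
  · intro M hM
    obtain ⟨hr, hK⟩ := inChart_subset_convexSet hk hk1 hM
    refine ⟨⟨hr, convexSet_subset_chart hk hk1 hK⟩, ?_⟩
    rw [inChart_union] at hM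
    rcases hM with hM | hM
    · obtain ⟨h1, h2, h3, t, ht, h4, h5⟩ := mem_inChart_surf'.1 hM
      -- On the surface, increasing a alone violates the tangent constraint at the same parameter;
      -- on the triangle, increasing d alone violates d ≤ 0. Neither move changes the chart form.
      refine mem_chartFrontier_of_ray (E := !![1, 0; 0, 0]) hK h1 (by simp [chartForm_apply])
        fun ε hε h => ?_
      have e : offDiag (M + ε • !![1, 0; 0, 0]) = offDiag M := by simp [offDiag]
      have := le_of_supportFun_nonneg hk ht (by rw [e, ← h4]; simp) (h.2.2.2 t ht)
      rw [e, ← h5] at this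
      simp at this
      linarith
    · obtain ⟨h1, h2, h3, h4, h5⟩ := mem_inChart_triangle.1 hM
      refine mem_chartFrontier_of_ray (E := !![0, 0; 0, 1]) hK h1 (by simp [chartForm_apply])
        fun ε hε h => ?_
      have := h.2.2.1
      simp [h4] at this
      linarith
  · rintro _ ⟨⟨hr, -⟩, ⟨M, h1⟩, ⟨hcl, hint⟩, rfl⟩
    have hK := mem_convexSet_of_closure h1 hr hcl
    rw [inChart_union]
    rcases (mem_convexSet_iff hk hk1 hr h1).1 hK with ⟨h2, h3⟩ | ⟨t, ht, h2, h3⟩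
    · exact Or.inr (mem_inChart_triangle.2 ⟨h1, hr.1, hr.2.1, h2, h3⟩)
    · rcases eq_or_lt_of_le h3 with h3 | h3
      · exact Or.inl (mem_inChart_surf'.2 ⟨h1, hr.1, hr.2.1, t, ht, h2, h3⟩)
      · refine absurd (mem_interior_iff_mem_nhds.2 ?_) hint
        filter_upwards [continuous_subtype_val.continuousAt.eventually
          (convexSet_mem_nhds hk hk1 hr ht h2 h3)] with N hN using hN N.2

/-! ### Support planes -/

/-- The normal to the surface. -/
def normalMat (k η u : ℝ) : M2 :=
  !![slopeD k η, k * Real.exp u; -(k * Real.exp (-u)), slopeA k η]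

lemma det_normalMat (k η u : ℝ) :
    (normalMat k η u).det = (1 - k ^ 2) * Real.sinh η ^ 2 := by
  have e1 : Real.exp u * Real.exp (-u) = 1 := by rw [← Real.exp_add]; simp
  have e2 : Real.exp (k * η) * Real.exp (-(k * η)) = 1 := by rw [← Real.exp_add]; simp
  rw [normalMat, Matrix.det_fin_two_of, slopeA, slopeD]
  linear_combination k ^ 2 * e1 + (Real.sinh η ^ 2 - k ^ 2 * Real.cosh η ^ 2) * e2 -
    k ^ 2 * Real.cosh_sq η

/-- By the arithmetic-geometric inequality e^u c + e^{-u} b ≥ 2√(bc), the pairing with the normal is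
at least half of `supportFun`. -/
lemma adsForm_normalMat_nonneg {k : ℝ} (hk : 0 < k) {η : ℝ} (hη : 0 < η) (u : ℝ) {Y : M2}
    (hY : Y ∈ convexSet k) : 0 ≤ adsForm Y (normalMat k η u) := by
  obtain ⟨-, ⟨h01, h10, -⟩, -, h⟩ := hY
  have h1 := h η hη
  have h2 := two_mul_offDiag_le (M := !![0, -Real.exp u; Real.exp (-u), 0]) (by simp; positivity)
    (by simp; positivity) h01 h10
  have e1 : Real.exp u * Real.exp (-u) = 1 := by rw [← Real.exp_add]; simp
  have e2 : offDiag !![0, -Real.exp u; Real.exp (-u), 0] = 1 := by simp [offDiag, e1]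
  rw [e2, one_mul] at h2
  simp at h2
  have h3 := mul_le_mul_of_nonneg_left h2 hk.le
  rw [adsForm_eq]
  simp only [normalMat, supportFun, Matrix.of_apply, Matrix.cons_val', Matrix.cons_val_zero,
    Matrix.cons_val_one, Matrix.cons_val_fin_one] at h1 ⊢
  linarith

lemma adsForm_coneMat (k η u : ℝ) (N : M2) : adsForm (coneMat k η u) N =
    -(1 / 2) * (Real.exp (k * η) * N 1 1 + Real.exp u * Real.cosh η * N 1 0 -
      Real.exp (-u) * Real.cosh η * N 0 1 - Real.exp (-(k * η)) * N 0 0) := by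
  rw [adsForm_eq]
  simp [coneMat]
  ring

lemma adsForm_smul (r : ℝ) (M N : M2) : adsForm (r • M) N = r * adsForm M N := by
  rw [adsForm_eq, adsForm_eq]
  simp
  ring

/-- The support planes at the points of the surface. -/
lemma IsSupport.eq_normalMat {k : ℝ} (hk : 0 < k) (hk1 : k < 1) {η u r : ℝ} (hη : 0 < η)
    (hr : 0 < r) {N : M2} (h : IsSupport (convexSet k) (r • coneMat k η u) N) :
    ∃ c : ℝ, c ≠ 0 ∧ N = c • normalMat k η u := by
  obtain ⟨hN, h0, hsign⟩ := h
  rw [adsForm_smul, mul_eq_zero, or_iff_right hr.ne'] at h0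
  have hpt : ∀ η' > 0, ∀ u', (chartForm (coneMat k η' u'))⁻¹ • coneMat k η' u' ∈ convexSet k := by
    intro η' hη' u'
    have hpos := chartForm_coneMat_pos k η' u'
    refine (inChart_subset_convexSet hk hk1 ?_).2
    rw [inChart_union]
    refine Or.inl (mem_inChart_surf.2 ⟨?_, η', hη', u', _, inv_pos.2 hpos, rfl⟩)
    rw [map_smul, smul_eq_mul, inv_mul_cancel₀ hpos.ne']
  have hsign' : (∀ η' > 0, ∀ u', 0 ≤ adsForm (coneMat k η' u') N) ∨
      ∀ η' > 0, ∀ u', adsForm (coneMat k η' u') N ≤ 0 := by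
    refine hsign.imp (fun h η' hη' u' => ?_) fun h η' hη' u' => ?_
    · have h1 := h _ (hpt η' hη' u')
      rw [adsForm_smul] at h1
      exact (mul_nonneg_iff_of_pos_left (inv_pos.2 (chartForm_coneMat_pos k η' u'))).1 h1
    · have h1 := h _ (hpt η' hη' u')
      rw [adsForm_smul] at h1
      exact nonpos_of_mul_nonpos_right h1 (inv_pos.2 (chartForm_coneMat_pos k η' u'))
  have d1 : HasDerivAt (fun u' => adsForm (coneMat k η u') N) (-(1 / 2) * (Real.exp u * Real.cosh η
      * N 1 0 + Real.exp (-u) * Real.cosh η * N 0 1)) u := by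
    simp only [adsForm_coneMat]
    refine ((((((Real.hasDerivAt_exp u).mul_const (Real.cosh η)).mul_const (N 1 0)).const_add
      (Real.exp (k * η) * N 1 1)).fun_sub (((hasDerivAt_id u).fun_neg.exp.mul_const
      (Real.cosh η)).mul_const (N 0 1))).sub_const (Real.exp (-(k * η)) * N 0 0)).const_mul
      (-(1 / 2)) |>.congr_deriv ?_
    simp
  have d2 : HasDerivAt (fun η' => adsForm (coneMat k η' u) N) (-(1 / 2) * (k * Real.exp (k * η) *
      N 1 1 + Real.exp u * Real.sinh η * N 1 0 - Real.exp (-u) * Real.sinh η * N 0 1 +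
      k * Real.exp (-(k * η)) * N 0 0)) η := by
    simp only [adsForm_coneMat]
    have hl := (hasDerivAt_id η).const_mul k
    refine ((((hl.exp.mul_const (N 1 1)).fun_add (((Real.hasDerivAt_cosh η).const_mul
      (Real.exp u)).mul_const (N 1 0))).fun_sub (((Real.hasDerivAt_cosh η).const_mul
      (Real.exp (-u))).mul_const (N 0 1))).fun_sub (hl.fun_neg.exp.mul_const (N 0 0))).const_mul
      (-(1 / 2)) |>.congr_deriv ?_
    simp
    ring
  -- The pairing with N has constant sign on the cone over the surface and vanishes at the point
  -- considered, so both partial derivatives vanish there. Together with the vanishing itself, this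
  -- gives three linear equations for N, which determine it up to scale.
  have z1 := IsLocalExtr.hasDerivAt_eq_zero (hsign'.imp
    (fun h => Eventually.of_forall fun u' => by rw [h0]; exact h η hη u')
    fun h => Eventually.of_forall fun u' => by rw [h0]; exact h η hη u') d1
  have z2 := IsLocalExtr.hasDerivAt_eq_zero (hsign'.imp
    (fun h => (lt_mem_nhds hη).mono fun η' hη' => by rw [h0]; exact h η' hη' u)
    fun h => (lt_mem_nhds hη).mono fun η' hη' => by rw [h0]; exact h η' hη' u) d2
  rw [adsForm_coneMat] at h0
  have hc := Real.cosh_pos η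
  have e1 : Real.exp u * Real.exp (-u) = 1 := by rw [← Real.exp_add]; simp
  have e2 : Real.exp (k * η) * Real.exp (-(k * η)) = 1 := by rw [← Real.exp_add]; simp
  have e3 : Real.exp u * N 1 0 + Real.exp (-u) * N 0 1 = 0 := by
    apply mul_left_cancel₀ hc.ne'
    linarith
  set c := -(Real.exp u * N 1 0 / k) with hcdef
  have e4 : Real.exp u * N 1 0 = -(k * c) := by rw [hcdef]; field_simp
  have e5 : Real.exp (-u) * N 0 1 = k * c := by linarith
  have e6 : Real.exp (k * η) * N 1 1 = c * (Real.sinh η + k * Real.cosh η) := by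
    apply mul_left_cancel₀ hk.ne'
    linear_combination -z2 - k * h0 - ((Real.sinh η + k * Real.cosh η) / 2) * e4 +
      ((Real.sinh η + k * Real.cosh η) / 2) * e5
  have e7 : Real.exp (-(k * η)) * N 0 0 = c * (Real.sinh η - k * Real.cosh η) := by
    apply mul_left_cancel₀ hk.ne'
    linear_combination -z2 + k * h0 - ((Real.sinh η - k * Real.cosh η) / 2) * e4 +
      ((Real.sinh η - k * Real.cosh η) / 2) * e5
  have e : N = c • normalMat k η u := by
    ext i j
    fin_cases i <;> fin_cases j <;> simp [normalMat, slopeA, slopeD]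
    · linear_combination Real.exp (k * η) * e7 - N 0 0 * e2
    · linear_combination Real.exp u * e5 - N 0 1 * e1
    · linear_combination Real.exp (-u) * e4 - N 1 0 * e1
    · linear_combination Real.exp (-(k * η)) * e6 - N 1 1 * e2
  refine ⟨c, fun hc0 => hN ?_, e⟩
  rw [e, hc0, zero_smul]

/-- The support planes at the points of the triangle. -/
lemma IsSupport.eq_diagonal {k : ℝ} (hk : 0 < k) (hk1 : k < 1) {M N : M2}
    (hM : M ∈ inChart chartForm triangle) (h : IsSupport (convexSet k) M N) :
    N 0 1 = 0 ∧ N 1 0 = 0 ∧ (((∀ Y ∈ convexSet k, 0 ≤ adsForm Y N) ∧ 0 ≤ N 0 0 ∧ 0 ≤ N 1 1) ∨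
      (N 0 0 ≤ 0 ∧ N 1 1 ≤ 0)) := by
  obtain ⟨-, h0, hsign⟩ := h
  obtain ⟨h1, h01, h10, h11, h00⟩ := mem_inChart_triangle.1 hM
  rw [chartForm_apply] at h1
  -- The triangle in the chart is the strip a ≤ 0, 0 < b < 1, on which the pairing with N is affine
  -- in b and in a. Criticality in b gives N₁₀ + N₀₁ = 0.
  have hpt : ∀ a b : ℝ, a ≤ 0 → 0 < b → b < 1 → (!![a, -b; 1 - b, 0] : M2) ∈ convexSet k := by
    intro a b ha hb hb1
    refine (inChart_subset_convexSet hk hk1 ?_).2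
    rw [inChart_union]
    refine Or.inr (mem_inChart_triangle.2 ?_)
    simp [chartForm_apply, ha, hb, hb1]
  have hval : ∀ a b : ℝ, adsForm !![a, -b; 1 - b, 0] N =
      -(1 / 2) * (a * N 1 1 + b * (N 1 0 + N 0 1) - N 0 1) := by
    intro a b
    rw [adsForm_eq]
    simp
    ring
  have hsign' : (∀ a b : ℝ, a ≤ 0 → 0 < b → b < 1 →
      a * N 1 1 + b * (N 1 0 + N 0 1) - N 0 1 ≤ 0) ∨ (∀ a b : ℝ, a ≤ 0 → 0 < b → b < 1 →
      0 ≤ a * N 1 1 + b * (N 1 0 + N 0 1) - N 0 1) := by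
    refine hsign.imp (fun h a b ha hb hb1 => ?_) fun h a b ha hb hb1 => ?_
    · have := h _ (hpt a b ha hb hb1)
      rw [hval] at this
      linarith
    · have := h _ (hpt a b ha hb hb1)
      rw [hval] at this
      linarith
  have h0' : M 0 0 * N 1 1 + -M 0 1 * (N 1 0 + N 0 1) - N 0 1 = 0 := by
    rw [adsForm_eq, h11, show M 1 0 = 1 + M 0 1 by linarith] at h0
    linarith
  have hb0 : 0 < -M 0 1 := by linarith
  have hb1 : -M 0 1 < 1 := by linarith
  have e1 : N 1 0 + N 0 1 = 0 := by
    have d : HasDerivAt (fun b => M 0 0 * N 1 1 + b * (N 1 0 + N 0 1) - N 0 1) (N 1 0 + N 0 1)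
        (-M 0 1) := by
      refine ((((hasDerivAt_id (-M 0 1)).mul_const (N 1 0 + N 0 1)).const_add
        (M 0 0 * N 1 1)).sub_const (N 0 1)).congr_deriv ?_
      simp
    have hnear : ∀ᶠ b in 𝓝 (-M 0 1), b ∈ Ioo (0 : ℝ) 1 := Ioo_mem_nhds hb0 hb1
    exact IsLocalExtr.hasDerivAt_eq_zero (hsign'.symm.imp
      (fun h => hnear.mono fun b hb => by rw [h0']; exact h _ _ h00 hb.1 hb.2)
      fun h => hnear.mono fun b hb => by rw [h0']; exact h _ _ h00 hb.1 hb.2) d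
  rw [e1, mul_zero, add_zero] at h0'
  simp only [e1, mul_zero, add_zero] at hsign'
  have e2 : M 0 0 * N 1 1 = 0 := by
    rcases hsign' with h | h
    · have g1 := h 0 2⁻¹ le_rfl (by norm_num) (by norm_num)
      have g2 := h (2 * M 0 0) 2⁻¹ (by linarith) (by norm_num) (by norm_num)
      linarith
    · have g1 := h 0 2⁻¹ le_rfl (by norm_num) (by norm_num)
      have g2 := h (2 * M 0 0) 2⁻¹ (by linarith) (by norm_num) (by norm_num)
      linarith
  have e3 : N 0 1 = 0 := by linarith
  refine ⟨e3, by linarith, ?_⟩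
  -- A point with a = 0, d < 0 detects the sign of N₀₀, and a point of the triangle with a = -1 the
  -- sign of N₁₁. Hence both entries have the same weak sign and det N ≥ 0.
  obtain ⟨t, ht, hY⟩ := exists_profY_eq hk (y := -(1 / 2)) (by norm_num) (by norm_num)
  have hp : offDiag !![0, -(1 / 2); 1 / 2, -(1 / 4)] = 1 / 2 := by
    rw [offDiag, ← Real.sqrt_sq (show (0 : ℝ) ≤ 1 / 2 by norm_num)]
    congr 1
    norm_num
  have hpt' : (!![0, -(1 / 2); 1 / 2, -(1 / 4)] : M2) ∈ convexSet k := by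
    refine (mem_convexSet_iff hk hk1 ?_ ?_).2 (Or.inr ⟨t, ht, ?_, ?_⟩)
    · refine ⟨by simp, by simp, ?_⟩
      rw [hp]
      norm_num
    · rw [chartForm_apply]
      norm_num
    · rw [hp, hY]
      norm_num
    · rw [hp]
      have := profX_pos k t
      simp only [Matrix.of_apply, Matrix.cons_val', Matrix.cons_val_zero, Matrix.cons_val_fin_one]
      positivity
  have hval' : adsForm !![0, -(1 / 2); 1 / 2, -(1 / 4)] N = N 0 0 / 8 := by
    rw [adsForm_eq, e3, show N 1 0 = 0 by linarith]
    simp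
    ring
  have hval'' : adsForm !![-1, -(1 / 2); 1 - 1 / 2, 0] N = N 1 1 / 2 := by
    rw [hval, e1, e3]
    ring
  have hpt'' := hpt (-1) (1 / 2) (by norm_num) (by norm_num) (by norm_num)
  rcases hsign with h | h
  · have g1 := h _ hpt'
    have g2 := h _ hpt''
    rw [hval'] at g1
    rw [hval''] at g2
    exact Or.inl ⟨h, by linarith, by linarith⟩
  · have g1 := h _ hpt'
    have g2 := h _ hpt''
    rw [hval'] at g1
    rw [hval''] at g2
    exact Or.inr ⟨by linarith, by linarith⟩

lemma isFuture_iff {M N : M2} : IsFuture M N ↔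
    N 1 0 * M 1 1 - N 1 1 * M 1 0 < N 0 1 * M 0 0 - N 0 0 * M 0 1 := by
  rw [IsFuture, Matrix.adjugate_fin_two, Matrix.mul_apply, Matrix.mul_apply, Fin.sum_univ_two,
    Fin.sum_univ_two]
  simp only [Matrix.of_apply, Matrix.cons_val', Matrix.cons_val_zero, Matrix.cons_val_one,
    Matrix.cons_val_fin_one]
  rw [mul_neg, mul_neg, ← sub_eq_add_neg, neg_add_eq_sub]

/-- The normal to the surface is future-directed. -/
lemma isFuture_normalMat {k : ℝ} (hk : 0 < k) (hk1 : k < 1) {η u r c : ℝ} (hη : 0 < η)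
    (hr : 0 < r) (h : IsFuture (r • coneMat k η u) (c • normalMat k η u)) : 0 < c := by
  have hs := Real.sinh_pos_iff.2 hη
  have hc := Real.cosh_pos η
  have hsq := Real.cosh_sq η
  have hlt := Real.sinh_lt_cosh η
  rw [isFuture_iff] at h
  simp only [coneMat, normalMat, slopeA, slopeD, Matrix.smul_apply, smul_eq_mul, Matrix.of_apply,
    Matrix.cons_val', Matrix.cons_val_zero, Matrix.cons_val_one, Matrix.cons_val_fin_one] at h
  have g1 : 0 < Real.sinh η * (Real.cosh η - k * Real.sinh η) :=
    mul_pos hs (by nlinarith)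
  have g2 : 0 < Real.sinh η * (Real.cosh η + k * Real.sinh η) := by positivity
  have g3 : 0 < r * (Real.exp u * Real.exp (k * η) *
      (Real.sinh η * (Real.cosh η - k * Real.sinh η)) + Real.exp (-u) * Real.exp (-(k * η)) *
      (Real.sinh η * (Real.cosh η + k * Real.sinh η))) := by positivity
  refine pos_of_mul_pos_left (b := _) ?_ g3.le
  rw [← sub_pos] at h
  refine h.trans_eq ?_
  linear_combination (c * r * k * (Real.exp (-u) * Real.exp (-(k * η)) -
    Real.exp u * Real.exp (k * η))) * hsq

lemma det_pos_of_isSupport {k : ℝ} (hk : 0 < k) (hk1 : k < 1) {M N : M2}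
    (hM : M ∈ inChart chartForm (surf k)) (h : IsSupport (convexSet k) M N) : 0 < N.det := by
  obtain ⟨-, η, hη, u, r, hr, rfl⟩ := mem_inChart_surf.1 hM
  obtain ⟨c, hc, rfl⟩ := h.eq_normalMat hk hk1 hη hr
  have hs := Real.sinh_pos_iff.2 hη
  rw [Matrix.det_smul, det_normalMat]
  have : 0 < 1 - k ^ 2 := by nlinarith
  have : 0 < c ^ 2 := by positivity
  simp only [Fintype.card_fin]
  positivity

/-- The plane d = 0 contains the triangle and bounds the convex set; its normal diag(1, 0) is null.
-/
lemma exists_lightlike_support {k : ℝ} {M : M2} (hM : M ∈ inChart chartForm triangle) :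
    ∃ N : M2, IsSupport (convexSet k) M N ∧ N.det = 0 := by
  refine ⟨!![1, 0; 0, 0], ⟨fun e => ?_, ?_, Or.inl fun Y hY => ?_⟩, by simp⟩
  · simpa using congrFun (congrFun e 0) 0
  · rw [adsForm_eq, (mem_inChart_triangle.1 hM).2.2.2.1]
    simp
  · rw [adsForm_eq]
    have := hY.2.2.1
    simp
    linarith

lemma exists_represents {k : ℝ} {γ : AdS} (h : γ ∈ surf k ∪ triangle) :
    ∃ M, chartForm M = 1 ∧ Represents M γ := by
  have key : ∀ {M : M2}, IsLift M γ → 0 < chartForm M → ∃ M, chartForm M = 1 ∧ Represents M γ :=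
    fun {M} h hp => ⟨(chartForm M)⁻¹ • M, by rw [map_smul, smul_eq_mul, inv_mul_cancel₀ hp.ne'],
      h.represents (inv_ne_zero hp.ne')⟩
  rcases h with ⟨η, hη, u, h⟩ | h
  · refine key h ?_
    rw [curveMat_eq_smul, map_smul, smul_eq_mul]
    exact mul_pos (inv_pos.2 (Real.sinh_pos_iff.2 hη)) (chartForm_coneMat_pos k η u)
  · rw [triangle_eq_graphSet] at h
    obtain ⟨M, hM, hc, -, h11⟩ := h
    have h11 : M 1 1 = 0 := neg_eq_zero.1 h11
    refine key hM ?_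
    have hd := hM.det_eq'
    rw [h11] at hd
    rw [chartForm_apply]
    by_contra! h
    nlinarith

lemma isPastConvex_surf_union_triangle {k : ℝ} (hk : 0 < k) (hk1 : k < 1) :
    IsPastConvex chartForm (convexSet k) (surf k ∪ triangle) where
  convex := convex_convexSet hk
  subset_chart := convexSet_subset_chart hk hk1
  covered _ h := exists_represents h
  connected := isConnected_surf_union_triangle (abs_lt.2 ⟨by linarith, hk1⟩)
  region := ⟨chartRegion, isOpen_chartRegion, inChart_eq hk hk1⟩
  nontimelike M hM N hN := by
    rw [inChart_union] at hM
    rcases hM with hM | hM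
    · exact (det_pos_of_isSupport hk hk1 hM hN).le
    · obtain ⟨h1, h2, ⟨-, h3, h4⟩ | ⟨h3, h4⟩⟩ := hN.eq_diagonal hk hk1 hM
      · rw [Matrix.det_fin_two, h1, zero_mul, sub_zero]
        exact mul_nonneg h3 h4
      · rw [Matrix.det_fin_two, h1, zero_mul, sub_zero]
        exact mul_nonneg_of_nonpos_of_nonpos h3 h4
  past M hM N hN hf Y hY := by
    have hYK := (inChart_subset_convexSet hk hk1 hY).2
    rw [inChart_union] at hM
    rcases hM with hM | hM
    · obtain ⟨-, η, hη, u, r, hr, rfl⟩ := mem_inChart_surf.1 hM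
      obtain ⟨c, hc, rfl⟩ := hN.eq_normalMat hk hk1 hη hr
      have hc := isFuture_normalMat hk hk1 hη hr hf
      have e : adsForm Y (c • normalMat k η u) = c * adsForm Y (normalMat k η u) := by
        rw [adsForm_eq, adsForm_eq]
        simp
        ring
      rw [e]
      exact mul_nonneg hc.le (adsForm_normalMat_nonneg hk hη u hYK)
    · obtain ⟨h1, h2, ⟨h, -, -⟩ | ⟨h3, h4⟩⟩ := hN.eq_diagonal hk hk1 hM
      · exact h Y hYK
      · exfalso
        obtain ⟨-, g1, g2, g3, -⟩ := mem_inChart_triangle.1 hM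
        rw [isFuture_iff, h1, h2, g3] at hf
        nlinarith [mul_nonneg_of_nonpos_of_nonpos h3 g1.le,
          mul_nonneg (neg_nonneg.2 h4) g2.le]

lemma spacelikePart_eq {k : ℝ} (hk : 0 < k) (hk1 : k < 1) :
    spacelikePart chartForm (convexSet k) (surf k ∪ triangle) = surf k := by
  apply Subset.antisymm
  · rintro γ ⟨h | h, hs⟩
    · exact h
    · exfalso
      obtain ⟨M, h1, hM⟩ := exists_represents (k := k) (Or.inr h)
      obtain ⟨N, hN, hdet⟩ := exists_lightlike_support (k := k) ⟨h1, γ, h, hM⟩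
      exact (hs M N h1 hM hN).ne' hdet
  · exact fun γ h => ⟨Or.inl h, fun M N h1 hM hN =>
      det_pos_of_isSupport hk hk1 ⟨h1, γ, h, hM⟩ hN⟩

lemma lightlikePart_eq {k : ℝ} (hk : 0 < k) (hk1 : k < 1) :
    lightlikePart chartForm (convexSet k) (surf k ∪ triangle) = triangle := by
  apply Subset.antisymm
  · rintro γ ⟨h | h, M, N, h1, hM, hN, hdet⟩
    · exact absurd hdet (det_pos_of_isSupport hk hk1 ⟨h1, γ, h, hM⟩ hN).ne'
    · exact h
  · intro γ h
    obtain ⟨M, h1, hM⟩ := exists_represents (k := k) (Or.inr h)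
    obtain ⟨N, hN, hdet⟩ := exists_lightlike_support (k := k) ⟨h1, γ, h, hM⟩
    exact ⟨Or.inr h, M, N, h1, hM, hN, hdet⟩

/-! ### The profile and its surface -/

lemma image_shear_halfStrip (φ : ℝ → ℝ) : shear φ '' halfStrip = halfStrip := by
  apply Subset.antisymm
  · rintro _ ⟨w, hw, rfl⟩
    exact shear_mem hw
  · intro w hw
    refine ⟨w + (φ w.im : ℂ), ?_, ?_⟩
    · simpa [halfStrip] using hw
    · simp [shear]

lemma shear_add_ofReal (φ : ℝ → ℝ) (a : ℝ) (w : ℂ) : shear φ (w + a) = shear φ w + a := by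
  simp only [shear, Complex.add_im, Complex.ofReal_im, add_zero]
  ring

lemma isPosSelfAdjoint_b₀ (φ : ℝ → ℝ) : IsPosSelfAdjoint halfStrip (b₀ φ) := by
  rw [isPosSelfAdjoint_iff fun w _ => b₀_eq φ w]
  intro w _
  have hq : 0 < √(4 + deriv φ w.im ^ 2) := Real.sqrt_pos.2 (by positivity)
  refine ⟨rfl, by positivity, by positivity, ?_⟩
  rw [div_mul_div_comm, div_mul_div_comm, ← sub_div]
  refine div_pos ?_ (mul_pos hq hq)
  nlinarith [sq_nonneg (deriv φ w.im)]

lemma pullsBackBy_b₀ {φ : ℝ → ℝ} (hd : ∀ t ∈ Ioo (-(Real.pi / 2)) 0, DifferentiableAt ℝ φ t) :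
    PullsBackBy halfStrip (shear φ) (b₀ φ) := by
  rw [pullsBackBy_shear_iff hd fun w _ => b₀_eq φ w]
  intro w _
  have h4 : 0 < 4 + deriv φ w.im ^ 2 := by positivity
  have hq : 0 < √(4 + deriv φ w.im ^ 2) := Real.sqrt_pos.2 h4
  have hsq := Real.sq_sqrt h4.le
  generalize √(4 + deriv φ w.im ^ 2) = q at hq hsq
  generalize deriv φ w.im = r at hsq h4
  refine ⟨?_, ?_, ?_⟩ <;> field_simp <;> rw [hsq] <;> ring

/-- The lifts of `σ` along the curve `s = s₀ + φ(t) / 2`. -/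
lemma isLift_along_curve {k n : ℝ} {φ : ℝ → ℝ} {σ : ℂ → AdS}
    (hσ : ∀ w ∈ halfStrip, IsLift (curveMat k (eta n w.im) (w.re - φ w.im / 2)) (σ w)) (s₀ : ℝ)
    {t : ℝ} (ht : t ∈ Ioo (-(Real.pi / 2)) 0) :
    IsLift (curveMat k (eta n t) s₀) (σ ((s₀ + φ t / 2 : ℝ) + t * Complex.I)) := by
  have hre : (((s₀ + φ t / 2 : ℝ) : ℂ) + t * Complex.I).re = s₀ + φ t / 2 := by simp
  have him : (((s₀ + φ t / 2 : ℝ) : ℂ) + t * Complex.I).im = t := by simp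
  have h := hσ ((s₀ + φ t / 2 : ℝ) + t * Complex.I) (by rw [halfStrip, mem_ofPred_eq, him]; exact ht)
  rwa [hre, him, add_sub_cancel_right] at h

/-- Adding a to s leaves η unchanged and adds a to u, which is conjugation by the translation. -/
lemma equivariant_of_isLift {k n : ℝ} {φ : ℝ → ℝ} {σ : ℂ → AdS}
    (hσ : ∀ w ∈ halfStrip, IsLift (curveMat k (eta n w.im) (w.re - φ w.im / 2)) (σ w)) (a : ℝ)
    {w : ℂ} (hw : w ∈ halfStrip) :
    σ (w + a) = translation a * σ w * (translation a)⁻¹ := by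
  have hre : (w + a).re = w.re + a := by simp
  have him : (w + a).im = w.im := by simp
  have h := hσ (w + a) (by rw [halfStrip, mem_ofPred_eq, him]; exact hw)
  rw [hre, him, add_sub_right_comm] at h
  exact h.unique (isLift_conj_translation (hσ w hw) a)

end AdSBarrier

end

/-! ### Assembly of the theorem -/

theorem mainTheorem6 (θ : ℝ) (hθ : θ ∈ Set.Ioo 0 Real.pi) :
    -- Landslides of the form `(s - φ(t), t)` are governed by the second order equation.
    (∀ φ : ℝ → ℝ, ContDiffOn ℝ ∞ φ (Ioo (-(Real.pi / 2)) 0) →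
      (∀ t ∈ Ioo (-(Real.pi / 2)) 0, deriv φ t ≠ 0) →
      (IsLandslide θ halfStrip (shear φ) ↔ SolvesODE θ φ) ∧
      (IsLandslideTensor θ halfStrip (shear φ) (tensor θ φ) ↔ SolvesODE θ φ)) ∧
    -- The constant `C = F(+∞)` is finite, and `G` is an increasing bijection.
    Tendsto (F θ) atTop (𝓝 (C θ)) ∧
    StrictMonoOn (G θ) (Ici 0) ∧
    G θ '' Ici 0 = Ico (-(Real.pi / 2)) 0 ∧
    -- Every solution of the integrated equation solves the equation, with these asymptotics.
    (∀ φ : ℝ → ℝ, SolvesIntegrated θ φ →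
      ContDiffOn ℝ ∞ φ (Ioo (-(Real.pi / 2)) 0) ∧
      (∀ t ∈ Ioo (-(Real.pi / 2)) 0, 0 < deriv φ t ∧ G θ (deriv φ t) = t) ∧
      SolvesODE θ φ ∧
      Tendsto (deriv φ) (𝓝[>] (-(Real.pi / 2))) (𝓝 0) ∧
      Tendsto (deriv φ) (𝓝[<] 0) atTop ∧
      Tendsto (fun t => t * deriv φ t) (𝓝[<] 0) (𝓝 (-√(2 * (1 - Real.cos θ)))) ∧
      Tendsto φ (𝓝[<] 0) atTop ∧
      Tendsto (fun t => t * Real.exp (φ t / 2)) (𝓝[<] 0) (𝓝 0)) ∧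
    -- The normalized solution exists and is unique.
    (∃ φ : ℝ → ℝ, IsProfile θ φ ∧
      ∀ ψ, IsProfile θ ψ → EqOn ψ φ (Ioo (-(Real.pi / 2)) 0)) ∧
    ∀ φ : ℝ → ℝ, IsProfile θ φ →
      -- The map `Φ_θ` is a `θ`-landslide of the half-plane commuting with the translations.
      shear φ '' halfStrip = halfStrip ∧
      (∀ (a : ℝ) (w : ℂ), shear φ (w + a) = shear φ w + a) ∧
      IsLandslide θ halfStrip (shear φ) ∧
      IsPosSelfAdjoint halfStrip (b₀ φ) ∧
      PullsBackBy halfStrip (shear φ) (b₀ φ) ∧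
      IsLandslideTensor θ halfStrip (shear φ)
        (tensor θ φ) ∧
      -- The map `σ` is well defined.
      (∀ w ∈ halfStrip,
        ∃! γ, IsSigmaAt (shear φ) (tensor θ φ) w γ) ∧
      ∀ σ : ℂ → AdS,
        (∀ w ∈ halfStrip,
          IsSigmaAt (shear φ) (tensor θ φ) w (σ w)) →
        -- It is an equivariant embedding of constant curvature.
        (∀ (a : ℝ), ∀ w ∈ halfStrip,
          σ (w + a) = translation a * σ w * (translation a)⁻¹) ∧
        IsEmbedding (fun w : halfStrip => σ w) ∧
        IsSpacelikeOfCurvature σ halfStrip (-1 / Real.cos (θ / 2) ^ 2) ∧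
        -- Convergence to the half-turns, as `t → 0`, and to the ideal points, as `t → -π/2`.
        (∀ s₀ : ℝ, Tendsto (fun t : ℝ => σ ((s₀ + φ t / 2 : ℝ) + t * Complex.I)) (𝓝[<] 0)
          (𝓝 (halfTurn (toH s₀)))) ∧
        (∀ s₀ : ℝ,
          Tendsto (fun t : ℝ => ((act (σ ((s₀ + φ t / 2 : ℝ) + t * Complex.I))
            (toH s₀) : UpperHalfPlane) : ℂ)) (𝓝[>] (-(Real.pi / 2)))
            (𝓝 (Real.exp s₀ : ℂ)) ∧
          Tendsto (fun t : ℝ => ((act (σ ((s₀ + φ t / 2 : ℝ) + t * Complex.I))⁻¹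
            (toH s₀) : UpperHalfPlane) : ℂ)) (𝓝[>] (-(Real.pi / 2)))
            (𝓝 (Real.exp s₀ : ℂ))) ∧
        -- The surface and the totally geodesic half-plane have the same boundary.
        closure (σ '' halfStrip) \ σ '' halfStrip = edge ∧
        closure halfPlane \ halfPlane = edge ∧
        idealBoundary (σ '' halfStrip)
          = (fun p => (p, p)) '' posArc ∧
        idealBoundary halfPlane
          = (fun p => (p, p)) '' posArc ∧
        -- With the lightlike triangle, it is a past-convex surface whose boundary at infinity is
        -- completed by the sawtooth.
        Disjoint (σ '' halfStrip) triangle ∧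
        edge ⊆ triangle ∧
        IsClosed (σ '' halfStrip ∪ triangle) ∧
        idealBoundary triangle = sawtooth ∧
        idealBoundary (σ '' halfStrip ∪ triangle)
          = (fun p => (p, p)) '' posArc ∪ sawtooth ∧
        ∃ (ℓ : M2 →ₗ[ℝ] ℝ) (K : Set M2),
          IsPastConvex ℓ K (σ '' halfStrip ∪ triangle) ∧
          spacelikePart ℓ K (σ '' halfStrip ∪ triangle)
            = σ '' halfStrip ∧
          lightlikePart ℓ K (σ '' halfStrip ∪ triangle)
            = triangle := by
  obtain ⟨hk, hn, hkn⟩ := half_angle hθ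
  have hk1 : Real.sin (θ / 2) < 1 := by nlinarith
  have habs : |Real.sin (θ / 2)| < 1 := abs_lt.2 ⟨by linarith, hk1⟩
  refine ⟨fun φ hφ h0 => ⟨isLandslide_iff hθ hφ h0, isLandslideTensor_iff hθ hφ h0⟩,
    tendsto_F_integral hθ, strictMonoOn_G hθ, image_G hθ,
    fun φ hφ => solvesIntegrated_properties hθ hφ,
    ⟨_, isProfile_profile hθ, fun ψ hψ => hψ.eqOn hθ⟩, fun φ hφ => ?_⟩
  obtain ⟨hsmooth, hpos, hode, -⟩ := solvesIntegrated_properties hθ hφ.1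
  have h0 : ∀ t ∈ Ioo (-(Real.pi / 2)) 0, deriv φ t ≠ 0 := fun t ht => (hpos t ht).1.ne'
  refine ⟨image_shear_halfStrip φ, shear_add_ofReal φ, (isLandslide_iff hθ hsmooth h0).2 hode,
    isPosSelfAdjoint_b₀ φ, pullsBackBy_b₀ fun t ht => (hφ.1 t ht).1,
    (isLandslideTensor_iff hθ hsmooth h0).2 hode,
    fun w hw => existsUnique_isSigmaAt hθ hφ hw, fun σ hσ => ?_⟩
  have hlift := fun w hw => isLift_of_isSigmaAt hθ hφ hw (hσ w hw)
  have hcurve := fun (s₀ t : ℝ) ht => isLift_along_curve hlift s₀ (t := t) ht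
  rw [image_eq_surf hθ hφ hσ]
  have hsurf := idealBoundary_surf hk hk1
  refine ⟨fun a w hw => equivariant_of_isLift hlift a hw, isEmbedding_of_isLift hn hsmooth hlift,
    isSpacelikeOfCurvature_curveMat hn hkn hsmooth ((solvesIntegrated_iff hθ).1 hφ.1) hlift,
    fun s₀ => tendsto_halfTurn habs hn (hcurve s₀),
    fun s₀ => tendsto_act_left hn (hcurve s₀) (toH s₀),
    closure_surf_diff habs, closure_halfPlane_diff, hsurf, idealBoundary_halfPlane,
    disjoint_surf_triangle _, edge_subset_triangle, isClosed_surf_union_triangle habs,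
    idealBoundary_triangle, ?_, chartForm, convexSet (Real.sin (θ / 2)),
    isPastConvex_surf_union_triangle hk hk1, spacelikePart_eq hk hk1, lightlikePart_eq hk hk1⟩
  rw [idealBoundary_union, hsurf, idealBoundary_triangle]
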